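/- Let $R_1$ be the first Riesz transform on $L^2(\mathbb{R}^2)$, i.e. the Fourier multiplier with symbol $-i\xi_1/|\xi|$, and consider the Cauchy problem $$\partial_t\omega=\omega\,R_1^2\omega,\qquad \omega(0,\cdot)=\omega_0 .$$ A smooth solution on $[0,T)$ is a real-valued $\omega\in C^\infty([0,T)\times\mathbb{R}^2)$ with $\omega(t,\cdot)\in L^2(\mathbb{R}^2)$ for every $t\in[0,T)$, such that $R_1^2\omega$ is (has a representative that is) continuous on $[0,T)\times\mathbb{R}^2$, the equation holds at every point of $[0,T)\times\mathbb{R}^2$, and $\omega(0,\cdot)=\omega_0$. There exists a non-negative, smooth, compactly supported $\omega_0:\mathbb{R}^2\to\mathbb{R}$ whose unique solution develops a singularity in finite time. That is, there are $0<T<\infty$ and a smooth solution $\omega$ on $[0,T)$ with initial datum $\omega_0$ such that every smooth solution with initial datum $\omega_0$ on an interval $[0,T')$ satisfies $T'\le T$ and coincides with $\omega$ on $[0,T')$; and $\omega$ does not extend to a $C^\infty$ function on $[0,T]\times\mathbb{R}^2$. -/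

import Mathlib

open MeasureTheory Set
open scoped ContDiff FourierTransform

noncomputable section

/-- The Euclidean plane. -/
abbrev Plane : Type := EuclideanSpace ℝ (Fin 2)

/-- The symbol `-i ξ₁ / |ξ|` of the first Riesz transform (with value `0` at the origin, a null
set). -/
def rieszSymbol (ξ : Plane) : ℂ := -Complex.I * (ξ 0 : ℂ) / (‖ξ‖ : ℂ)

lemma norm_rieszSymbol_le (ξ : Plane) : ‖rieszSymbol ξ‖ ≤ 1 := by
  have h : |ξ 0| ≤ ‖ξ‖ := by
    simpa using PiLp.norm_apply_le ξ 0
  have h2 : ‖rieszSymbol ξ‖ = |ξ 0| / ‖ξ‖ := by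
    simp [rieszSymbol]
  rw [h2]
  exact div_le_one_of_le₀ h (norm_nonneg _)

lemma measurable_rieszSymbol : Measurable rieszSymbol := by
  unfold rieszSymbol
  fun_prop

lemma memLp_rieszSymbol_mul (f : Lp ℂ 2 (volume : Measure Plane)) :
    MemLp (fun ξ => rieszSymbol ξ * f ξ) 2 (volume : Measure Plane) :=
  (Lp.memLp f).of_le
    (measurable_rieszSymbol.aestronglyMeasurable.mul (Lp.aestronglyMeasurable f))
    (Filter.Eventually.of_forall fun ξ => by
      rw [norm_mul]
      exact mul_le_of_le_one_left (norm_nonneg _) (norm_rieszSymbol_le ξ))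

/-- The first Riesz transform `R₁` on `L²(ℝ²; ℂ)`: the Fourier multiplier with symbol
`-i ξ₁ / |ξ|`. -/
def rieszTransform (f : Lp ℂ 2 (volume : Measure Plane)) : Lp ℂ 2 (volume : Measure Plane) :=
  𝓕⁻ ((memLp_rieszSymbol_mul (𝓕 f)).toLp (fun ξ => rieszSymbol ξ * (𝓕 f) ξ))

/-- `f` is a real function in `L²(ℝ²)` and `g` is a real-valued representative of `R₁ (R₁ f)`. -/
def IsRieszSq (f g : Plane → ℝ) : Prop :=
  ∃ hf : MemLp (fun x => (f x : ℂ)) 2 (volume : Measure Plane),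
    (fun x => (g x : ℂ)) =ᵐ[volume] rieszTransform (rieszTransform (hf.toLp fun x => (f x : ℂ)))

/-- `w` is a smooth solution on `[0, T) × ℝ²` of `∂ₜ w = w R₁² w` with initial datum `w₀`: it is
jointly smooth up to the initial time, each `w t` lies in `L²` (so that `R₁² (w t)` is defined),
`R₁² w` is continuous on `[0, T) × ℝ²`, and the equation holds at every point (at `t = 0` with
the one-sided time derivative). The values of `w t` for `t ∉ [0, T)` play no role, except that
`w 0 = w₀` is required in any case. -/
structure IsSmoothSolution (T : ℝ) (w₀ : Plane → ℝ) (w : ℝ → Plane → ℝ) : Prop where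
  initial : w 0 = w₀
  smooth : ContDiffOn ℝ ∞ (fun p : ℝ × Plane => w p.1 p.2) (Ico 0 T ×ˢ univ)
  equation : ∃ g : ℝ → Plane → ℝ,
    ContinuousOn (fun p : ℝ × Plane => g p.1 p.2) (Ico 0 T ×ˢ univ) ∧
    ∀ t ∈ Ico 0 T, IsRieszSq (w t) (g t) ∧
      ∀ x, HasDerivWithinAt (fun s => w s x) (w t x * g t x) (Ico 0 T) t

end

/-! The mechanism is a Riccati inequality for a weighted mean of `log ω`. Pointwise in `x` the
equation is a linear ODE in time, so `ω = ω₀ exp ∫ R₁²ω`: sign and support are preserved, and `∂ₜ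
log ω = R₁²ω` where `ω₀ > 0`. Away from the diagonal `R₁²` has a kernel proportional to `(x₀² -
x₁²)/|x|⁴`, which is positive near the horizontal axis; the obstruction to growth is the local part,
which has no favourable sign.

The datum defeats the local part by placing disjoint bumps at the points `(2⁻ʲ, 0)`. Let `ρⱼ` be a
radial density of mass independent of `j`, living on the plateau of the `j`-th bump, and let `Vⱼ =
R₁²ρⱼ`. At a point of the `k`-th bump, `Vⱼ ≥ 0` for `j < k`, each `Vⱼ` with `j > k` is at least a
fixed multiple of `4ᵏ`, and `|V_k| + ρ_k` is at most a constant times `4ᵏ`. Choosing `q < 1` close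
to `1`, the finer bumps together outweigh the single bad term, and `∑ qʲ ρⱼ ≤ ∑ qʲ Vⱼ` on the
support (`exists_tsum_density_le_tsum_potential`). There must be infinitely many bumps, since a
finest one would have nothing to compensate it. The heights `1/j!` make the sum smooth, while their
logarithms stay summable against `qʲ`.

For `F = ∑ qʲ ∫ ρⱼ log ω` and `m = ∑ qʲ ∫ ρⱼ`, symmetry of `R₁²` and Jensen's inequality give `F' =
∑ qʲ ∫ Vⱼ ω ≥ ∑ qʲ ∫ ρⱼ ω ≥ m exp (F/m)`, so no smooth solution outlives `exp (-F(0)/m)`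
(`exists_lifespan_bound`).

The rest is well-posedness. Local solutions are power series in time, controlled in weighted `L¹`
norms of the Fourier transform; the existence time depends only on the unweighted norm `wnorm 0 0`.
An `L²` estimate gives uniqueness. Hence there is a maximal solution; a smooth extension to its
final time would keep `wnorm 0 0` bounded and allow continuation past that time
(`exists_maximal_solution`). -/

noncomputable section

/-! ### The inverse Fourier transform of integrable functions -/

section FourierInv

open scoped SchwartzMap

lemma norm_fourier_le_integral (F : Plane → ℂ) (x : Plane) : ‖𝓕 F x‖ ≤ ∫ ξ, ‖F ξ‖ :=
  VectorFourier.norm_fourierIntegral_le_integral_norm _ _ _ F x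

lemma norm_fourierInv_le_integral (F : Plane → ℂ) (x : Plane) : ‖𝓕⁻ F x‖ ≤ ∫ ξ, ‖F ξ‖ := by
  rw [Real.fourierInv_eq_fourier_neg]
  exact norm_fourier_le_integral F _

lemma continuous_fourier {F : Plane → ℂ} (hF : Integrable F) : Continuous (𝓕 F) :=
  VectorFourier.fourierIntegral_continuous Real.continuous_fourierChar continuous_inner hF

lemma continuous_fourierInv {F : Plane → ℂ} (hF : Integrable F) : Continuous (𝓕⁻ F) := by
  rw [Real.fourierInv_eq_fourier_comp_neg]
  exact continuous_fourier hF.comp_neg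

lemma integral_fourier_mul {F G : Plane → ℂ} (hF : Integrable F) (hG : Integrable G) :
    ∫ x, 𝓕 F x * G x = ∫ x, F x * 𝓕 G x := by
  have := VectorFourier.integral_fourierIntegral_smul_eq_flip (L := innerₗ Plane)
    (μ := volume) (ν := volume) Real.continuous_fourierChar continuous_inner hF hG
  rw [flip_innerₗ] at this
  exact this

lemma integral_fourierInv_mul {F G : Plane → ℂ} (hF : Integrable F) (hG : Integrable G) :
    ∫ x, 𝓕⁻ F x * G x = ∫ x, F x * 𝓕⁻ G x := by
  rw [Real.fourierInv_eq_fourier_comp_neg, integral_fourier_mul hF.comp_neg hG,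
    ← integral_neg_eq_self]
  simp [Real.fourierInv_eq_fourier_neg]

lemma moments_comp_neg {F : Plane → ℂ} (hF : ∀ k : ℕ, Integrable fun ξ => ‖ξ‖ ^ k * ‖F ξ‖) (k : ℕ) :
    Integrable fun ξ : Plane => ‖ξ‖ ^ k * ‖F (-ξ)‖ := by
  simpa using (hF k).comp_neg

lemma contDiff_fourierInv {F : Plane → ℂ} (hF : ∀ k : ℕ, Integrable fun ξ => ‖ξ‖ ^ k * ‖F ξ‖) :
    ContDiff ℝ ∞ (𝓕⁻ F) := by
  rw [Real.fourierInv_eq_fourier_comp_neg]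
  exact Real.contDiff_fourier (N := ⊤) fun k _ => moments_comp_neg hF k

lemma norm_iteratedFDeriv_fourierInv_le {F : Plane → ℂ} (hm : AEStronglyMeasurable F)
    (hF : ∀ k : ℕ, Integrable fun ξ => ‖ξ‖ ^ k * ‖F ξ‖) (k : ℕ) (x : Plane) :
    ‖iteratedFDeriv ℝ k (𝓕⁻ F) x‖ ≤ (2 * Real.pi) ^ k * ∫ ξ, ‖ξ‖ ^ k * ‖F ξ‖ := by
  have hm' : AEStronglyMeasurable (fun ξ : Plane => F (-ξ)) :=
    hm.comp_quasiMeasurePreserving (Measure.measurePreserving_neg volume).quasiMeasurePreserving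
  rw [Real.fourierInv_eq_fourier_comp_neg,
    Real.iteratedFDeriv_fourier (N := ⊤) (fun k _ => moments_comp_neg hF k) hm' le_top]
  refine (VectorFourier.norm_fourierIntegral_le_integral_norm _ _ _ _ _).trans ?_
  rw [← integral_neg_eq_self, ← integral_const_mul]
  have hIntegrable : Integrable fun ξ : Plane => (2 * Real.pi) ^ k * (‖ξ‖ ^ k * ‖F ξ‖) :=
    (hF k).const_mul _
  refine integral_mono_of_nonneg (ae_of_all _ fun _ => norm_nonneg _) hIntegrable
    (ae_of_all _ fun ξ => ?_)
  refine (VectorFourier.norm_fourierPowSMulRight_le _ _ _ _).trans ?_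
  have h1 : ‖innerSL ℝ (E := Plane)‖ ≤ 1 := norm_innerSL_le ℝ
  simp only [neg_neg, norm_neg]
  rw [mul_assoc]
  exact mul_le_mul_of_nonneg_right (pow_le_pow_left₀ (by positivity)
    (mul_le_of_le_one_right (by positivity) h1) k) (by positivity)

/-- On `L¹ ∩ L²` the inverse Fourier transform of `L²` is given by the Fourier integral. -/
lemma fourierInv_toLp_ae_eq {F : Plane → ℂ} (h1 : Integrable F) (h2 : MemLp F 2) :
    ((𝓕⁻ (h2.toLp F) : Lp ℂ 2 (volume : Measure Plane)) : Plane → ℂ) =ᵐ[volume] 𝓕⁻ F := by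
  -- Both sides are locally integrable, so it suffices to pair them with test functions; the `L²`
  -- transform is moved onto the test function as for tempered distributions, the Fourier integral
  -- by Fubini.
  refine ae_eq_of_integral_contDiff_smul_eq ((Lp.memLp _).locallyIntegrable (by norm_num))
    (continuous_fourierInv h1).locallyIntegrable fun η hη hc => ?_
  have hη' : ContDiff ℝ ∞ (fun x => (η x : ℂ)) := Complex.ofRealCLM.contDiff.comp hη
  have hc' : HasCompactSupport (fun x => (η x : ℂ)) := hc.comp_left (g := ((↑) : ℝ → ℂ)) rfl
  have key := congrArg (fun d => d (hc'.toSchwartzMap hη'))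
    (Lp.fourierInv_toTemperedDistribution_eq (h2.toLp F))
  simp only [TemperedDistribution.fourierInv_apply, Lp.toTemperedDistribution_apply,
    SchwartzMap.fourierInv_coe] at key
  have e1 : ∀ (f : Plane → ℂ), ∫ x, η x • f x = ∫ x, (hc'.toSchwartzMap hη') x • f x := by
    exact fun f => integral_congr_ae (ae_of_all _ fun x => Complex.coe_smul (η x) (f x) |>.symm)
  rw [e1, e1, ← key]
  have hi : Integrable (fun x => (η x : ℂ)) := hη'.continuous.integrable_of_hasCompactSupport hc'
  have := integral_fourierInv_mul hi h1
  refine Eq.trans ?_ this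
  refine integral_congr_ae ?_
  filter_upwards [h2.coeFn_toLp] with x hx
  rw [hx, smul_eq_mul]
  rfl

lemma moments_integrable {F : Plane → ℂ} (hm : AEStronglyMeasurable F)
    (hF : ∀ k : ℕ, Integrable fun ξ => ‖ξ‖ ^ k * ‖F ξ‖) : Integrable F := by
  have := hF 0
  simp only [pow_zero, one_mul] at this
  exact (integrable_norm_iff hm).1 this

end FourierInv

/-! ### Smooth compactly supported functions and the multiplier `R₁²` -/

/-- Smooth functions with compact support. -/
structure IsTest (f : Plane → ℝ) : Prop where
  smooth : ContDiff ℝ ∞ f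
  compact : HasCompactSupport f

/-- The Fourier transform of a real function. -/
def realFourier (f : Plane → ℝ) : Plane → ℂ := 𝓕 fun x => (f x : ℂ)

/-- The symbol `-ξ₁² / |ξ|²` of `R₁²`. -/
def symbolSq (ξ : Plane) : ℝ := -(ξ 0) ^ 2 / ‖ξ‖ ^ 2

/-- The Fourier integral defining `R₁² f`, for `f` smooth with compact support. -/
def rieszSq (f : Plane → ℝ) (x : Plane) : ℝ :=
  (𝓕⁻ (fun ξ => (symbolSq ξ : ℂ) * realFourier f ξ) x).re

lemma rieszSymbol_mul_self (ξ : Plane) : rieszSymbol ξ * rieszSymbol ξ = symbolSq ξ := by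
  simp only [rieszSymbol, symbolSq]
  push_cast
  rw [div_mul_div_comm]
  congr 1
  · linear_combination (ξ 0 : ℂ) ^ 2 * Complex.I_sq
  · ring

lemma abs_symbolSq_le (ξ : Plane) : |symbolSq ξ| ≤ 1 := by
  have h := norm_rieszSymbol_le ξ
  have h2 : |symbolSq ξ| = ‖rieszSymbol ξ‖ * ‖rieszSymbol ξ‖ := by
    rw [← norm_mul, rieszSymbol_mul_self]; simp
  rw [h2]
  nlinarith [norm_nonneg (rieszSymbol ξ)]

lemma measurable_symbolSq : Measurable symbolSq := by
  unfold symbolSq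
  fun_prop

lemma symbolSq_neg (ξ : Plane) : symbolSq (-ξ) = symbolSq ξ := by simp [symbolSq]

namespace IsTest

variable {f g : Plane → ℝ}

lemma continuous (hf : IsTest f) : Continuous f := hf.smooth.continuous

lemma smooth_complex (hf : IsTest f) : ContDiff ℝ ∞ fun x => (f x : ℂ) :=
  Complex.ofRealCLM.contDiff.comp hf.smooth

lemma compact_complex (hf : IsTest f) : HasCompactSupport fun x => (f x : ℂ) :=
  hf.compact.comp_left (g := ((↑) : ℝ → ℂ)) rfl

/-- A smooth compactly supported function as a complex-valued Schwartz function. -/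
def schwartz (hf : IsTest f) : SchwartzMap Plane ℂ :=
  hf.compact_complex.toSchwartzMap hf.smooth_complex

lemma coe_schwartz (hf : IsTest f) : (hf.schwartz : Plane → ℂ) = fun x => (f x : ℂ) := rfl

lemma realFourier_eq (hf : IsTest f) : realFourier f = (𝓕 hf.schwartz : SchwartzMap Plane ℂ) := rfl

lemma integrable (hf : IsTest f) : Integrable f :=
  hf.continuous.integrable_of_hasCompactSupport hf.compact

lemma integrable_complex (hf : IsTest f) : Integrable fun x => (f x : ℂ) := hf.integrable.ofReal

lemma memLp (hf : IsTest f) (p : ENNReal) : MemLp f p :=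
  hf.continuous.memLp_of_hasCompactSupport hf.compact

lemma memLp_complex (hf : IsTest f) : MemLp (fun x => (f x : ℂ)) 2 :=
  (hf.memLp 2).ofReal

lemma continuous_realFourier (hf : IsTest f) : Continuous (realFourier f) :=
  continuous_fourier hf.integrable_complex

lemma moments (hf : IsTest f) (k : ℕ) : Integrable fun ξ => ‖ξ‖ ^ k * ‖realFourier f ξ‖ := by
  rw [hf.realFourier_eq]
  exact (𝓕 hf.schwartz).integrable_pow_mul volume k

lemma integrable_realFourier (hf : IsTest f) : Integrable (realFourier f) :=
  moments_integrable hf.continuous_realFourier.aestronglyMeasurable hf.moments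

lemma aestronglyMeasurable_mul (hf : IsTest f) :
    AEStronglyMeasurable fun ξ => (symbolSq ξ : ℂ) * realFourier f ξ :=
  (Complex.measurable_ofReal.comp measurable_symbolSq).aestronglyMeasurable.mul
    hf.continuous_realFourier.aestronglyMeasurable

lemma norm_symbolSq_mul_le (F : Plane → ℂ) (ξ : Plane) : ‖(symbolSq ξ : ℂ) * F ξ‖ ≤ ‖F ξ‖ := by
  rw [norm_mul, Complex.norm_real]
  exact mul_le_of_le_one_left (norm_nonneg _) (abs_symbolSq_le ξ)

lemma moments_mul (hf : IsTest f) (k : ℕ) :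
    Integrable fun ξ => ‖ξ‖ ^ k * ‖(symbolSq ξ : ℂ) * realFourier f ξ‖ := by
  refine (hf.moments k).mono' ?_ (ae_of_all _ fun ξ => ?_)
  · exact ((continuous_norm.pow k).aestronglyMeasurable).mul hf.aestronglyMeasurable_mul.norm
  · rw [norm_mul, norm_norm, norm_pow, norm_norm]
    gcongr
    exact norm_symbolSq_mul_le _ ξ

lemma integrable_mul (hf : IsTest f) : Integrable fun ξ => (symbolSq ξ : ℂ) * realFourier f ξ :=
  moments_integrable hf.aestronglyMeasurable_mul hf.moments_mul

lemma fourierInv_realFourier (hf : IsTest f) (x : Plane) : 𝓕⁻ (realFourier f) x = f x :=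
  congrFun (hf.smooth_complex.continuous.fourierInv_fourier_eq hf.integrable_complex
    hf.integrable_realFourier) x

end IsTest

lemma realFourier_neg (f : Plane → ℝ) (ξ : Plane) :
    realFourier f (-ξ) = (starRingEnd ℂ) (realFourier f ξ) := by
  simp only [realFourier, Real.fourier_eq', ← integral_conj]
  congr 1
  ext x
  simp [← Complex.exp_conj, map_ofNat]

/-- The symbol is real and even, so the multiplier preserves real functions and the real part in
`rieszSq` discards nothing. -/
lemma ofReal_rieszSq (f : Plane → ℝ) (x : Plane) :
    (rieszSq f x : ℂ) = 𝓕⁻ (fun ξ => (symbolSq ξ : ℂ) * realFourier f ξ) x := by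
  have h : (starRingEnd ℂ) (𝓕⁻ (fun ξ => (symbolSq ξ : ℂ) * realFourier f ξ) x) =
      𝓕⁻ (fun ξ => (symbolSq ξ : ℂ) * realFourier f ξ) x := by
    simp only [Real.fourierInv_eq', ← integral_conj]
    rw [← integral_neg_eq_self]
    congr 1
    ext ξ
    simp [symbolSq_neg, realFourier_neg, ← Complex.exp_conj, map_ofNat]
  exact Complex.conj_eq_iff_re.1 h

namespace IsTest

variable {f g : Plane → ℝ}

lemma contDiff_rieszSq (hf : IsTest f) : ContDiff ℝ ∞ (rieszSq f) :=
  Complex.reCLM.contDiff.comp (contDiff_fourierInv hf.moments_mul)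

lemma abs_rieszSq_le (hf : IsTest f) (x : Plane) :
    |rieszSq f x| ≤ ∫ ξ, ‖realFourier f ξ‖ := by
  rw [← Real.norm_eq_abs, ← Complex.norm_real, ofReal_rieszSq]
  refine (norm_fourierInv_le_integral _ x).trans ?_
  exact integral_mono hf.integrable_mul.norm hf.integrable_realFourier.norm
    fun ξ => norm_symbolSq_mul_le _ ξ

lemma norm_iteratedFDeriv_le (hf : IsTest f) (k : ℕ) (x : Plane) :
    ‖iteratedFDeriv ℝ k f x‖ ≤ (2 * Real.pi) ^ k * ∫ ξ, ‖ξ‖ ^ k * ‖realFourier f ξ‖ := by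
  have h := norm_iteratedFDeriv_fourierInv_le
    hf.continuous_realFourier.aestronglyMeasurable hf.moments k x
  have e : 𝓕⁻ (realFourier f) = Complex.ofRealLI ∘ f := funext hf.fourierInv_realFourier
  rwa [e, LinearIsometry.norm_iteratedFDeriv_comp_left (n := ∞) _ hf.smooth.contDiffAt
    (mod_cast le_top)] at h

lemma toLp_eq_schwartz (hf : IsTest f) (h : MemLp (fun x => (f x : ℂ)) 2) :
    h.toLp (fun x => (f x : ℂ)) = hf.schwartz.toLp 2 := rfl

/-- Between the two Riesz transforms `𝓕` and `𝓕⁻` cancel, so the symbols multiply to `symbolSq`; the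
resulting function is in `L¹ ∩ L²`, where the `L²` inverse transform is an integral. -/
lemma isRieszSq (hf : IsTest f) : IsRieszSq f (rieszSq f) := by
  refine ⟨hf.memLp_complex, ?_⟩
  have h2 : MemLp (fun ξ => (symbolSq ξ : ℂ) * realFourier f ξ) 2 := by
    refine ((𝓕 hf.schwartz).memLp 2 volume).of_le hf.aestronglyMeasurable_mul
      (ae_of_all _ fun ξ => ?_)
    rw [← hf.realFourier_eq]
    exact norm_symbolSq_mul_le _ ξ
  have key : rieszTransform (rieszTransform (hf.memLp_complex.toLp fun x => (f x : ℂ))) =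
      𝓕⁻ (h2.toLp fun ξ => (symbolSq ξ : ℂ) * realFourier f ξ) := by
    rw [rieszTransform]
    congr 1
    refine MemLp.toLp_congr _ _ ?_
    have e1 : 𝓕 (rieszTransform (hf.memLp_complex.toLp fun x => (f x : ℂ))) =
        (memLp_rieszSymbol_mul (𝓕 (hf.memLp_complex.toLp fun x => (f x : ℂ)))).toLp _ := by
      rw [rieszTransform, FourierTransform.fourier_fourierInv_eq]
    have e2 : 𝓕 (hf.memLp_complex.toLp fun x => (f x : ℂ)) = (𝓕 hf.schwartz).toLp 2 := by
      rw [hf.toLp_eq_schwartz, SchwartzMap.toLp_fourier_eq]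
    rw [e1]
    filter_upwards [MemLp.coeFn_toLp
      (memLp_rieszSymbol_mul (𝓕 (hf.memLp_complex.toLp fun x => (f x : ℂ)))),
      (𝓕 hf.schwartz).coeFn_toLp 2 volume] with ξ h3 h4
    rw [h3, e2, h4, ← mul_assoc, rieszSymbol_mul_self, hf.realFourier_eq]
  rw [key]
  filter_upwards [fourierInv_toLp_ae_eq hf.integrable_mul h2] with x hx
  rw [hx, ofReal_rieszSq]

end IsTest

/-- Continuous functions that agree almost everywhere agree. This replaces the unspecified
representative in `IsSmoothSolution` by a concrete integral. -/
lemma IsRieszSq.eq_rieszSq {f g : Plane → ℝ} (h : IsRieszSq f g) (hf : IsTest f)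
    (hg : Continuous g) : g = rieszSq f := by
  obtain ⟨_, h1⟩ := h
  obtain ⟨_, h2⟩ := hf.isRieszSq
  refine (Continuous.ae_eq_iff_eq volume hg hf.contDiff_rieszSq.continuous).1 ?_
  filter_upwards [h1, h2] with x hx hy
  exact_mod_cast hx.trans hy.symm

lemma norm_rieszTransform_le (f : Lp ℂ 2 (volume : Measure Plane)) :
    ‖rieszTransform f‖ ≤ ‖f‖ := by
  rw [← Lp.norm_fourier_eq (rieszTransform f), rieszTransform,
    FourierTransform.fourier_fourierInv_eq, ← Lp.norm_fourier_eq f]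
  refine Lp.norm_le_norm_of_ae_le ?_
  filter_upwards [MemLp.coeFn_toLp (memLp_rieszSymbol_mul (𝓕 f))] with ξ hξ
  rw [hξ, norm_mul]
  exact mul_le_of_le_one_left (norm_nonneg _) (norm_rieszSymbol_le ξ)

/-! ### `L²` contractivity, linearity and symmetry of `R₁²` -/

namespace IsTest

variable {f g : Plane → ℝ}

lemma memLp_rieszSq (hf : IsTest f) : MemLp (rieszSq f) 2 := by
  obtain ⟨h, h1⟩ := hf.isRieszSq
  have := (memLp_congr_ae h1).2 (Lp.memLp _)
  exact this.re

lemma integral_rieszSq_sq_le (hf : IsTest f) : ∫ x, rieszSq f x ^ 2 ≤ ∫ x, f x ^ 2 := by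
  obtain ⟨h, h1⟩ := hf.isRieszSq
  have h2 : MemLp (fun x => (rieszSq f x : ℂ)) 2 := (memLp_congr_ae h1).2 (Lp.memLp _)
  have key : ‖h2.toLp _‖ ≤ ‖h.toLp _‖ := by
    have : h2.toLp _ = rieszTransform (rieszTransform (h.toLp fun x => (f x : ℂ))) := by
      refine Lp.ext ?_
      filter_upwards [h2.coeFn_toLp, h1] with x hx hy
      rw [hx, hy]
    rw [this]
    exact (norm_rieszTransform_le _).trans (norm_rieszTransform_le _)
  have e : ∀ (u : Plane → ℝ) (hu : MemLp (fun x => (u x : ℂ)) 2), ‖hu.toLp _‖ ^ 2 = ∫ x, u x ^ 2 := by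
    intro u hu
    have h5 : (‖hu.toLp _‖ ^ 2 : ℝ) = RCLike.re (inner ℂ (hu.toLp _) (hu.toLp _)) :=
      norm_sq_eq_re_inner (𝕜 := ℂ) _
    rw [h5, L2.inner_def, ← integral_re (L2.integrable_inner _ _)]
    refine integral_congr_ae ?_
    filter_upwards [hu.coeFn_toLp] with x hx
    rw [hx]
    simp [← Complex.ofReal_mul, sq]
  rw [← e _ h2, ← e _ h]
  gcongr

lemma sub (hf : IsTest f) (hg : IsTest g) : IsTest fun x => f x - g x :=
  ⟨hf.smooth.sub hg.smooth, hf.compact.sub hg.compact⟩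

lemma add (hf : IsTest f) (hg : IsTest g) : IsTest fun x => f x + g x :=
  ⟨hf.smooth.add hg.smooth, hf.compact.add hg.compact⟩

lemma const_mul (hf : IsTest f) (c : ℝ) : IsTest fun x => c * f x :=
  ⟨contDiff_const.mul hf.smooth, hf.compact.mul_left⟩

lemma mul_smooth (hf : IsTest f) (hg : ContDiff ℝ ∞ g) : IsTest fun x => f x * g x :=
  ⟨hf.smooth.mul hg, hf.compact.mul_right⟩

lemma realFourier_add (hf : IsTest f) (hg : IsTest g) (ξ : Plane) :
    realFourier (fun x => f x + g x) ξ = realFourier f ξ + realFourier g ξ := by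
  have := congrArg (fun h : SchwartzMap Plane ℂ => h ξ)
    (FourierTransform.fourier_add hf.schwartz hg.schwartz)
  simp only [add_apply] at this
  rw [hf.realFourier_eq, hg.realFourier_eq, ← this, (hf.add hg).realFourier_eq]
  congr 2
  ext x
  simp [coe_schwartz]

end IsTest

lemma realFourier_const_mul (c : ℝ) (f : Plane → ℝ) (ξ : Plane) :
    realFourier (fun x => c * f x) ξ = c * realFourier f ξ := by
  simp only [realFourier, Real.fourier_eq', ← integral_const_mul]
  congr 1
  ext x
  simp only [smul_eq_mul, Complex.ofReal_mul]
  ring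

namespace IsTest

variable {f g : Plane → ℝ}

lemma realFourier_sub (hf : IsTest f) (hg : IsTest g) (ξ : Plane) :
    realFourier (fun x => f x - g x) ξ = realFourier f ξ - realFourier g ξ := by
  have h := hf.realFourier_add (hg.const_mul (-1)) ξ
  rw [realFourier_const_mul] at h
  simp only [neg_mul, one_mul, ← sub_eq_add_neg] at h
  rw [h]
  push_cast
  ring

lemma rieszSq_sub (hf : IsTest f) (hg : IsTest g) (x : Plane) :
    rieszSq (fun x => f x - g x) x = rieszSq f x - rieszSq g x := by
  have h : (rieszSq (fun x => f x - g x) x : ℂ) = rieszSq f x - rieszSq g x := by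
    simp only [ofReal_rieszSq, Real.fourierInv_eq]
    rw [← integral_sub]
    · congr 1
      ext ξ
      rw [hf.realFourier_sub hg, mul_sub, smul_sub]
    · simpa using (Real.fourierIntegral_convergent_iff (-x)).2 hf.integrable_mul
    · simpa using (Real.fourierIntegral_convergent_iff (-x)).2 hg.integrable_mul
  exact_mod_cast h

/-- `R₁²` is symmetric. -/
lemma integral_mul_rieszSq (hf : IsTest f) (hg : IsTest g) :
    ∫ x, f x * rieszSq g x = ∫ x, rieszSq f x * g x := by
  have h : (∫ x, (f x : ℂ) * rieszSq g x) = ∫ x, (rieszSq f x : ℂ) * g x := by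
    simp only [ofReal_rieszSq]
    rw [← integral_fourierInv_mul hf.integrable_complex hg.integrable_mul,
      integral_fourierInv_mul hf.integrable_mul hg.integrable_complex, ← integral_neg_eq_self]
    congr 1
    ext ξ
    rw [Real.fourierInv_eq_fourier_neg, Real.fourierInv_eq_fourier_neg, neg_neg, symbolSq_neg]
    change realFourier f ξ * (_ * realFourier g (-ξ)) = _ * _ * realFourier g (-ξ)
    ring
  have h' : ((∫ x, f x * rieszSq g x : ℝ) : ℂ) = ((∫ x, rieszSq f x * g x : ℝ) : ℂ) := by
    rw [← integral_complex_ofReal, ← integral_complex_ofReal]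
    push_cast
    exact h
  exact_mod_cast h'

end IsTest

end

noncomputable section

/-! ### Weighted Fourier norms -/

/-- The submultiplicative weight `(1 + ε |ξ|) ^ K`. -/
def weight (ε : ℝ) (K : ℕ) (ξ : Plane) : ℝ := (1 + ε * ‖ξ‖) ^ K

/-- The weighted `L¹` norm of the Fourier transform. -/
def wnorm (ε : ℝ) (K : ℕ) (f : Plane → ℝ) : ℝ := ∫ ξ, weight ε K ξ * ‖realFourier f ξ‖

section Weight

variable {ε : ℝ} (K : ℕ)

lemma one_le_weight (hε : 0 ≤ ε) (ξ : Plane) : 1 ≤ weight ε K ξ :=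
  one_le_pow₀ (by have := norm_nonneg ξ; nlinarith [mul_nonneg hε this])

lemma weight_nonneg (hε : 0 ≤ ε) (ξ : Plane) : 0 ≤ weight ε K ξ :=
  zero_le_one.trans (one_le_weight K hε ξ)

/-- This is what makes the weighted norm submultiplicative under convolution. -/
lemma weight_add_le (hε : 0 ≤ ε) (ξ η : Plane) : weight ε K (ξ + η) ≤ weight ε K ξ * weight ε K η := by
  unfold weight
  rw [← mul_pow]
  have h := norm_add_le ξ η
  have h1 := norm_nonneg ξ
  have h2 := norm_nonneg η
  refine pow_le_pow_left₀ (by positivity) ?_ K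
  nlinarith [mul_le_mul_of_nonneg_left h hε, mul_nonneg (mul_nonneg hε h1) (mul_nonneg hε h2)]

lemma wnorm_nonneg (hε : 0 ≤ ε) (f : Plane → ℝ) : 0 ≤ wnorm ε K f :=
  integral_nonneg fun ξ => mul_nonneg (weight_nonneg K hε ξ) (norm_nonneg _)

end Weight

/-! ### Algebra estimates in the weighted Fourier norms -/

namespace IsTest

variable {f g : Plane → ℝ} {ε : ℝ} (K : ℕ)

lemma integrable_weight (hf : IsTest f) :
    Integrable fun ξ => weight ε K ξ * ‖realFourier f ξ‖ := by
  have h : (fun ξ => weight ε K ξ * ‖realFourier f ξ‖) = fun ξ =>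
      ∑ m ∈ Finset.range (K + 1), (ε ^ m * K.choose m) * (‖ξ‖ ^ m * ‖realFourier f ξ‖) := by
    ext ξ
    rw [weight, add_comm, add_pow, Finset.sum_mul]
    refine Finset.sum_congr rfl fun m _ => ?_
    rw [mul_pow, one_pow]
    ring
  rw [h]
  exact integrable_finsetSum _ fun m _ => (hf.moments m).const_mul _

lemma wnorm_add_le (hε : 0 ≤ ε) (hf : IsTest f) (hg : IsTest g) :
    wnorm ε K (fun x => f x + g x) ≤ wnorm ε K f + wnorm ε K g := by
  unfold wnorm
  rw [← integral_add (hf.integrable_weight K) (hg.integrable_weight K)]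
  refine integral_mono ((hf.add hg).integrable_weight K)
    ((hf.integrable_weight K).add (hg.integrable_weight K)) fun ξ => ?_
  dsimp only
  rw [← mul_add, hf.realFourier_add hg]
  exact mul_le_mul_of_nonneg_left (norm_add_le _ _) (weight_nonneg K hε ξ)

lemma wnorm_const_mul (c : ℝ) (f : Plane → ℝ) :
    wnorm ε K (fun x => c * f x) = |c| * wnorm ε K f := by
  unfold wnorm
  rw [← integral_const_mul]
  congr 1
  ext ξ
  rw [realFourier_const_mul, norm_mul, Complex.norm_real, Real.norm_eq_abs]
  ring

lemma zero : IsTest fun _ => (0 : ℝ) := ⟨contDiff_const, HasCompactSupport.zero⟩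

lemma sum {ι : Type*} (s : Finset ι) {h : ι → Plane → ℝ} (hh : ∀ i ∈ s, IsTest (h i)) :
    IsTest fun x => ∑ i ∈ s, h i x := by
  classical
  induction s using Finset.induction_on with
  | empty => simpa using zero
  | insert a s ha ih =>
    simp only [Finset.sum_insert ha]
    exact (hh a (by simp)).add (ih fun i hi => hh i (by simp [hi]))

lemma wnorm_sum_le (hε : 0 ≤ ε) {ι : Type*} (s : Finset ι) {h : ι → Plane → ℝ}
    (hh : ∀ i ∈ s, IsTest (h i)) :
    wnorm ε K (fun x => ∑ i ∈ s, h i x) ≤ ∑ i ∈ s, wnorm ε K (h i) := by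
  classical
  induction s using Finset.induction_on with
  | empty => simp [wnorm, realFourier, Real.fourier_eq]
  | insert a s ha ih =>
    simp only [Finset.sum_insert ha]
    have hs : ∀ i ∈ s, IsTest (h i) := fun i hi => hh i (by simp [hi])
    exact (wnorm_add_le K hε (hh a (by simp)) (sum s hs)).trans (by gcongr; exact ih hs)

open scoped Convolution in
-- The convolution theorem is applied to the inverse transform of the convolution, which is the
-- product on the left. Inversion then holds at every point because the convolution is continuous
-- and integrable and its transform is a reflected test function.
lemma realFourier_mul_rieszSq (hf : IsTest f) (hg : IsTest g) :
    realFourier (fun x => f x * rieszSq g x) =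
      (realFourier f ⋆[ContinuousLinearMap.mul ℂ ℂ] fun ξ => (symbolSq ξ : ℂ) * realFourier g ξ) := by
  set F := realFourier f
  set G : Plane → ℂ := fun ξ => (symbolSq ξ : ℂ) * realFourier g ξ
  have hF : Integrable F := hf.integrable_realFourier
  have hG : Integrable G := hg.integrable_mul
  have hfg := hf.mul_smooth hg.contDiff_rieszSq
  have hcont : Continuous (F ⋆[ContinuousLinearMap.mul ℂ ℂ] G) := by
    refine BddAbove.continuous_convolution_left_of_integrable _ ?_ hf.continuous_realFourier hG
    refine ⟨∫ x, ‖(f x : ℂ)‖, ?_⟩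
    rintro _ ⟨ξ, rfl⟩
    exact norm_fourier_le_integral _ ξ
  have hIntegrable : Integrable (F ⋆[ContinuousLinearMap.mul ℂ ℂ] G) :=
    hF.integrable_convolution _ hG
  have hinv : 𝓕⁻ (F ⋆[ContinuousLinearMap.mul ℂ ℂ] G) = fun x => ((f x * rieszSq g x : ℝ) : ℂ) := by
    ext x
    rw [Real.fourierInv_eq_fourier_neg, Real.fourier_mul_convolution_eq hF hG,
      ← Real.fourierInv_eq_fourier_neg, ← Real.fourierInv_eq_fourier_neg, Complex.ofReal_mul,
      ofReal_rieszSq, hf.fourierInv_realFourier]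
  have hfour : 𝓕 (F ⋆[ContinuousLinearMap.mul ℂ ℂ] G) =
      fun x => ((f (-x) * rieszSq g (-x) : ℝ) : ℂ) := by
    ext x
    have := congrFun hinv (-x)
    rwa [Real.fourierInv_eq_fourier_neg, neg_neg] at this
  have hIntegrable' : Integrable (𝓕 (F ⋆[ContinuousLinearMap.mul ℂ ℂ] G)) := by
    rw [hfour]
    exact hfg.integrable_complex.comp_neg
  rw [← hcont.fourier_fourierInv_eq hIntegrable hIntegrable', hinv]
  rfl

open scoped Convolution in
-- Young's inequality `L¹ * L¹ ⊆ L¹` for the weighted transforms; the multiplier costs nothing since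
-- its symbol is bounded by one.
lemma wnorm_mul_rieszSq_le (hε : 0 ≤ ε) (hf : IsTest f) (hg : IsTest g) :
    wnorm ε K (fun x => f x * rieszSq g x) ≤ wnorm ε K f * wnorm ε K g := by
  have hF := hf.integrable_weight (ε := ε) K
  have hG := hg.integrable_weight (ε := ε) K
  have hconv := hF.integrable_convolution (ContinuousLinearMap.mul ℝ ℝ) hG
  have e : wnorm ε K f * wnorm ε K g = ∫ ξ, ((fun ξ => weight ε K ξ * ‖realFourier f ξ‖)
      ⋆[ContinuousLinearMap.mul ℝ ℝ] fun ξ => weight ε K ξ * ‖realFourier g ξ‖) ξ := by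
    rw [integral_convolution _ hF hG]
    rfl
  rw [e]
  refine integral_mono_ae ((hf.mul_smooth hg.contDiff_rieszSq).integrable_weight K) hconv ?_
  filter_upwards [hF.ae_convolution_exists (ContinuousLinearMap.mul ℝ ℝ) hG] with ξ hξ
  rw [hf.realFourier_mul_rieszSq hg, convolution_def, convolution_def]
  calc weight ε K ξ * ‖∫ t, (ContinuousLinearMap.mul ℂ ℂ) (realFourier f t)
        ((symbolSq (ξ - t) : ℂ) * realFourier g (ξ - t))‖
      ≤ weight ε K ξ * ∫ t, ‖(ContinuousLinearMap.mul ℂ ℂ) (realFourier f t)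
        ((symbolSq (ξ - t) : ℂ) * realFourier g (ξ - t))‖ :=
        mul_le_mul_of_nonneg_left (norm_integral_le_integral_norm _) (weight_nonneg K hε ξ)
    _ = ∫ t, weight ε K ξ * ‖(ContinuousLinearMap.mul ℂ ℂ) (realFourier f t)
        ((symbolSq (ξ - t) : ℂ) * realFourier g (ξ - t))‖ := (integral_const_mul _ _).symm
    _ ≤ _ := by
        refine integral_mono_of_nonneg
          (ae_of_all _ fun t => mul_nonneg (weight_nonneg K hε ξ) (norm_nonneg _)) hξ
          (ae_of_all _ fun t => ?_)
        have h1 := weight_add_le K hε t (ξ - t)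
        rw [add_sub_cancel] at h1
        have h2 := norm_symbolSq_mul_le (realFourier g) (ξ - t)
        simp only [ContinuousLinearMap.mul_apply', norm_mul] at h2 ⊢
        calc weight ε K ξ * (‖realFourier f t‖ * (‖(symbolSq (ξ - t) : ℂ)‖ * ‖realFourier g (ξ - t)‖))
            ≤ (weight ε K t * weight ε K (ξ - t)) *
              (‖realFourier f t‖ * ‖realFourier g (ξ - t)‖) :=
              mul_le_mul h1 (mul_le_mul_of_nonneg_left h2 (norm_nonneg _))
                (by positivity) (mul_nonneg (weight_nonneg K hε _) (weight_nonneg K hε _))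
          _ = _ := by ring

lemma integral_pow_mul_le_wnorm (hε : 0 < ε) (hf : IsTest f) :
    ∫ ξ, ‖ξ‖ ^ K * ‖realFourier f ξ‖ ≤ (ε⁻¹) ^ K * wnorm ε K f := by
  unfold wnorm
  rw [← integral_const_mul]
  refine integral_mono (hf.moments K) ((hf.integrable_weight K).const_mul _) fun ξ => ?_
  dsimp only
  rw [← mul_assoc, weight, ← mul_pow]
  gcongr
  rw [mul_add, inv_mul_cancel_left₀ hε.ne']
  have : 0 < ε⁻¹ := by positivity
  linarith

/-- Convexity of `y ↦ y ^ K` between `1` and `1 + ‖ξ‖`. As `ε → 0` every weighted norm is thus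
nearly bounded by the unweighted one, so that derivatives of all orders converge for the same length
of time. -/
lemma wnorm_le_of_le_one (hε : 0 ≤ ε) (hε1 : ε ≤ 1) (hf : IsTest f) :
    wnorm ε K f ≤ wnorm 0 0 f + ε * wnorm 1 K f := by
  unfold wnorm
  rw [← integral_const_mul, ← integral_add (hf.integrable_weight 0)
    ((hf.integrable_weight K).const_mul ε)]
  refine integral_mono (hf.integrable_weight K)
    ((hf.integrable_weight 0).add ((hf.integrable_weight K).const_mul ε)) fun ξ => ?_
  have hconv := (convexOn_pow K).2 (x := (1 : ℝ)) (by simp) (y := 1 + ‖ξ‖)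
    (mem_Ici.2 (by positivity)) (sub_nonneg.2 hε1) hε (by ring)
  simp only [smul_eq_mul, one_pow] at hconv
  have h1 : (1 - ε) * 1 + ε * (1 + ‖ξ‖) = 1 + ε * ‖ξ‖ := by ring
  rw [h1] at hconv
  have h2 : weight ε K ξ ≤ 1 + ε * weight 1 K ξ := by
    simp only [weight, one_mul]
    linarith
  have h3 := mul_le_mul_of_nonneg_right h2 (norm_nonneg (realFourier f ξ))
  simp only [weight, pow_zero] at h3 ⊢
  linarith

end IsTest

/-! ### The Taylor coefficients in time of the solution -/

/-- The Taylor coefficients in time of the solution with initial datum `u`. -/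
def coef (u : Plane → ℝ) : ℕ → Plane → ℝ
  | 0 => u
  | n + 1 => fun x => ((n : ℝ) + 1)⁻¹ *
      ∑ i : Fin (n + 1), coef u i x * rieszSq (coef u (n - i)) x
decreasing_by all_goals omega

lemma coef_zero (u : Plane → ℝ) : coef u 0 = u := by rw [coef]

lemma coef_succ (u : Plane → ℝ) (n : ℕ) : coef u (n + 1) = fun x => ((n : ℝ) + 1)⁻¹ *
    ∑ i ∈ Finset.range (n + 1), coef u i x * rieszSq (coef u (n - i)) x := by
  rw [coef]
  ext x
  rw [Finset.sum_range (fun i => coef u i x * rieszSq (coef u (n - i)) x)]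

section Coef

variable {u : Plane → ℝ}

lemma isTest_coef (hu : IsTest u) (n : ℕ) : IsTest (coef u n) := by
  induction n using Nat.strong_induction_on with
  | _ n ih =>
    cases n with
    | zero => rwa [coef_zero]
    | succ n =>
      rw [coef_succ]
      refine (IsTest.sum _ fun i hi => ?_).const_mul _
      rw [Finset.mem_range] at hi
      exact (ih i hi).mul_smooth (ih (n - i) (by omega)).contDiff_rieszSq

/-- Every summand of the recursion keeps an undifferentiated factor `coef u i x`, so supports do not
grow although `R₁²` is nonlocal. -/
lemma coef_eq_zero {x : Plane} (hx : u x = 0) (n : ℕ) : coef u n x = 0 := by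
  induction n using Nat.strong_induction_on with
  | _ n ih =>
    cases n with
    | zero => rwa [coef_zero]
    | succ n =>
      rw [coef_succ]
      simp only
      rw [Finset.sum_eq_zero, mul_zero]
      intro i hi
      rw [ih i (Finset.mem_range.1 hi), zero_mul]

/-- Each of the `n + 1` products in the recursion contributes the same power `n + 2` of the norm,
and the prefactor `1 / (n + 1)` cancels their number. -/
lemma wnorm_coef_le {ε : ℝ} (hε : 0 ≤ ε) (K : ℕ) (hu : IsTest u) (n : ℕ) :
    wnorm ε K (coef u n) ≤ wnorm ε K u ^ (n + 1) := by
  induction n using Nat.strong_induction_on with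
  | _ n ih =>
    cases n with
    | zero => rw [coef_zero, zero_add, pow_one]
    | succ n =>
      have hN := wnorm_nonneg K hε u
      rw [coef_succ, IsTest.wnorm_const_mul, abs_of_pos (by positivity)]
      have h1 : wnorm ε K (fun x => ∑ i ∈ Finset.range (n + 1), coef u i x *
          rieszSq (coef u (n - i)) x) ≤ ∑ i ∈ Finset.range (n + 1), wnorm ε K u ^ (n + 2) := by
        refine (IsTest.wnorm_sum_le K hε _ fun i _ => (isTest_coef hu i).mul_smooth
          (isTest_coef hu (n - i)).contDiff_rieszSq).trans (Finset.sum_le_sum fun i hi => ?_)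
        rw [Finset.mem_range] at hi
        refine ((isTest_coef hu i).wnorm_mul_rieszSq_le K hε (isTest_coef hu (n - i))).trans ?_
        refine (mul_le_mul (ih i hi) (ih (n - i) (by omega)) (wnorm_nonneg K hε _)
          (by positivity)).trans_eq ?_
        rw [← pow_add]
        congr 1
        omega
      rw [Finset.sum_const, Finset.card_range, nsmul_eq_mul] at h1
      push_cast at h1
      calc _ ≤ ((n : ℝ) + 1)⁻¹ * (((n : ℝ) + 1) * wnorm ε K u ^ (n + 2)) := by gcongr
        _ = wnorm ε K u ^ (n + 1 + 1) := by field_simp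

/-- Within the time `1 / wnorm 0 0 u` the Taylor series converges with all its derivatives. -/
lemma exists_bound_coef (hu : IsTest u) {ρ r : ℝ} (hρ : ρ * wnorm 0 0 u ≤ 1) (hr : 0 ≤ r)
    (hrρ : r < ρ) (k : ℕ) :
    ∃ C, ∀ n x, ‖iteratedFDeriv ℝ k (coef u n) x‖ * r ^ n ≤ C := by
  have h0 : 0 ≤ wnorm 0 0 u := wnorm_nonneg 0 le_rfl u
  have h1 : 0 ≤ wnorm 1 k u := wnorm_nonneg k zero_le_one u
  have hlt : r * wnorm 0 0 u < 1 := by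
    rcases h0.eq_or_lt with h | h
    · rw [← h]; simp
    · exact (mul_lt_mul_of_pos_right hrρ h).trans_le hρ
  obtain ⟨ε, hε, hε1, hle⟩ : ∃ ε, 0 < ε ∧ ε ≤ 1 ∧ r * wnorm ε k u ≤ 1 := by
    -- This `ε` makes `r * (wnorm 0 0 u + ε * wnorm 1 k u) ≤ 1`, using the gap `r * wnorm 0 0 u <
    -- 1`.
    refine ⟨min 1 ((1 - r * wnorm 0 0 u) / (r * wnorm 1 k u + 1)), ?_, min_le_left _ _, ?_⟩
    · exact lt_min one_pos (div_pos (by linarith) (by positivity))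
    set ε := min 1 ((1 - r * wnorm 0 0 u) / (r * wnorm 1 k u + 1)) with hdef
    have hε : 0 ≤ ε := le_min zero_le_one (div_nonneg (by linarith) (by positivity))
    have h2 := hu.wnorm_le_of_le_one k hε (min_le_left _ _)
    have h3 : ε * (r * wnorm 1 k u + 1) ≤ 1 - r * wnorm 0 0 u := by
      rw [← le_div_iff₀ (by positivity)]
      exact min_le_right _ _
    nlinarith [mul_le_mul_of_nonneg_left h2 hr]
  refine ⟨(2 * Real.pi) ^ k * ((ε⁻¹) ^ k * wnorm ε k u), fun n x => ?_⟩
  have hN := wnorm_nonneg k hε.le u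
  have h3 : wnorm ε k (coef u n) * r ^ n ≤ wnorm ε k u := by
    calc wnorm ε k (coef u n) * r ^ n ≤ wnorm ε k u ^ (n + 1) * r ^ n := by
          gcongr
          exact wnorm_coef_le hε.le k hu n
      _ = wnorm ε k u * (r * wnorm ε k u) ^ n := by ring
      _ ≤ wnorm ε k u * 1 := by
          gcongr
          exact pow_le_one₀ (by positivity) hle
      _ = _ := mul_one _
  calc ‖iteratedFDeriv ℝ k (coef u n) x‖ * r ^ n
      ≤ ((2 * Real.pi) ^ k * ((ε⁻¹) ^ k * wnorm ε k (coef u n))) * r ^ n := by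
        gcongr
        exact ((isTest_coef hu n).norm_iteratedFDeriv_le k x).trans
          (by gcongr; exact (isTest_coef hu n).integral_pow_mul_le_wnorm k hε)
    _ = (2 * Real.pi) ^ k * ((ε⁻¹) ^ k * (wnorm ε k (coef u n) * r ^ n)) := by ring
    _ ≤ _ := by gcongr

lemma summable_wnorm_coef (hu : IsTest u) {ρ t : ℝ} (hρ : ρ * wnorm 0 0 u ≤ 1) (ht : |t| < ρ) :
    Summable fun n => |t| ^ n * wnorm 0 0 (coef u n) := by
  have h0 : 0 ≤ wnorm 0 0 u := wnorm_nonneg 0 le_rfl u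
  have hlt : |t| * wnorm 0 0 u < 1 := by
    rcases h0.eq_or_lt with h | h
    · rw [← h]; simp
    · exact (mul_lt_mul_of_pos_right ht h).trans_le hρ
  refine Summable.of_nonneg_of_le (fun n => mul_nonneg (by positivity) (wnorm_nonneg 0 le_rfl _))
    (fun n => ?_) ((summable_geometric_of_lt_one (by positivity) hlt).mul_left (wnorm 0 0 u))
  calc |t| ^ n * wnorm 0 0 (coef u n) ≤ |t| ^ n * wnorm 0 0 u ^ (n + 1) := by
        gcongr
        exact wnorm_coef_le le_rfl 0 hu n
    _ = _ := by ring

end Coef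

end

noncomputable section

/-! ### Power series in time with smooth coefficients -/

/-- The first two binomial terms. It absorbs the factor `n + 1` produced by a time derivative into a
slightly larger radius. -/
lemma add_pow_ge_first_order {r δ : ℝ} (hr : 0 ≤ r) (hδ : 0 ≤ δ) (n : ℕ) :
    r ^ (n + 1) + (n + 1) * r ^ n * δ ≤ (r + δ) ^ (n + 1) := by
  induction n with
  | zero => simp
  | succ n ih =>
    have h := mul_le_mul_of_nonneg_right ih (add_nonneg hr hδ)
    rw [pow_succ (r + δ)]
    refine le_trans ?_ h
    have : 0 ≤ (n + 1) * r ^ n * δ ^ 2 := by positivity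
    push_cast
    ring_nf at this ⊢
    linarith

/-- The coefficients `b n` are smooth, and all derivatives of `∑ tⁿ b n` converge for `|t| < ρ`,
uniformly in space. -/
structure SmoothSeries {F : Type} [NormedAddCommGroup F] [NormedSpace ℝ F] (ρ : ℝ)
    (b : ℕ → Plane → F) : Prop where
  smooth : ∀ n, ContDiff ℝ ∞ (b n)
  bound : ∀ (k : ℕ) (r : ℝ), 0 ≤ r → r < ρ → ∃ C, ∀ n x, ‖iteratedFDeriv ℝ k (b n) x‖ * r ^ n ≤ C

namespace SmoothSeries

variable {F : Type} [NormedAddCommGroup F] [NormedSpace ℝ F] {ρ : ℝ} {b : ℕ → Plane → F}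

/-- These are the coefficients of the time derivative. -/
lemma shift (h : SmoothSeries ρ b) : SmoothSeries ρ fun n x => ((n : ℝ) + 1) • b (n + 1) x where
  smooth n := contDiff_const.smul (h.smooth (n + 1))
  bound k r hr hrρ := by
    obtain ⟨r', hr', hr'ρ⟩ := exists_between hrρ
    obtain ⟨C, hC⟩ := h.bound k r' (hr.trans hr'.le) hr'ρ
    refine ⟨C / (r' - r), fun n x => ?_⟩
    have e : iteratedFDeriv ℝ k (fun x => ((n : ℝ) + 1) • b (n + 1) x) x =
        ((n : ℝ) + 1) • iteratedFDeriv ℝ k (b (n + 1)) x :=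
      iteratedFDeriv_const_smul_apply' ((h.smooth (n + 1)).of_le (mod_cast le_top)).contDiffAt
    rw [e, norm_smul, le_div_iff₀ (by linarith), Real.norm_of_nonneg (by positivity)]
    have h1 := add_pow_ge_first_order hr (sub_nonneg.2 hr'.le) n
    rw [add_sub_cancel] at h1
    have h2 : 0 ≤ r ^ (n + 1) := by positivity
    calc _ = ‖iteratedFDeriv ℝ k (b (n + 1)) x‖ * ((n + 1) * r ^ n * (r' - r)) := by ring
      _ ≤ ‖iteratedFDeriv ℝ k (b (n + 1)) x‖ * r' ^ (n + 1) := by gcongr; linarith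
      _ ≤ C := hC _ _

lemma fderiv (h : SmoothSeries ρ b) : SmoothSeries ρ fun n => fderiv ℝ (b n) where
  smooth n := (h.smooth n).fderiv_right (mod_cast le_top)
  bound k r hr hrρ := by
    obtain ⟨C, hC⟩ := h.bound (k + 1) r hr hrρ
    refine ⟨C, fun n x => ?_⟩
    rw [norm_iteratedFDeriv_fderiv]
    exact hC n x

lemma exists_summable (h : SmoothSeries ρ b) {r : ℝ} (hr : 0 ≤ r) (hrρ : r < ρ) :
    ∃ u : ℕ → ℝ, Summable u ∧ ∀ n x, ‖b n x‖ * r ^ n ≤ u n := by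
  obtain ⟨r', hr', hr'ρ⟩ := exists_between hrρ
  have hr'0 : 0 < r' := hr.trans_lt hr'
  obtain ⟨C, hC⟩ := h.bound 0 r' hr'0.le hr'ρ
  refine ⟨fun n => C * (r / r') ^ n, (summable_geometric_of_lt_one (by positivity)
    ((div_lt_one hr'0).2 hr')).mul_left C, fun n x => ?_⟩
  have h1 := hC n x
  rw [norm_iteratedFDeriv_zero] at h1
  calc ‖b n x‖ * r ^ n = (‖b n x‖ * r' ^ n) * (r / r') ^ n := by
        rw [div_pow]; field_simp
    _ ≤ _ := mul_le_mul_of_nonneg_right h1 (by positivity)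

lemma summable [CompleteSpace F] (h : SmoothSeries ρ b) {t : ℝ} (ht : |t| < ρ) (x : Plane) :
    Summable fun n => ‖t ^ n • b n x‖ := by
  obtain ⟨u, hu, hb⟩ := h.exists_summable (abs_nonneg t) ht
  refine Summable.of_nonneg_of_le (fun _ => norm_nonneg _) (fun n => ?_) hu
  rw [norm_smul, norm_pow, Real.norm_eq_abs, mul_comm]
  exact hb n x

/-- Termwise differentiation: the time part `A` is dominated by the series of `h.shift`, the space
part `B` by that of `h.fderiv`. -/
lemma hasFDerivAt [CompleteSpace F] (h : SmoothSeries ρ b) {p : ℝ × Plane} (hp : |p.1| < ρ) :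
    HasFDerivAt (fun p : ℝ × Plane => ∑' n, p.1 ^ n • b n p.2)
      ((ContinuousLinearMap.fst ℝ ℝ Plane).smulRight
          (∑' n : ℕ, p.1 ^ n • (((n : ℝ) + 1) • b (n + 1) p.2)) +
        (∑' n : ℕ, p.1 ^ n • _root_.fderiv ℝ (b n) p.2).comp (ContinuousLinearMap.snd ℝ ℝ Plane)) p := by
  obtain ⟨r, hpr, hrρ⟩ := exists_between hp
  have hr : 0 ≤ r := (abs_nonneg _).trans hpr.le
  have hs : IsOpen (Ioo (-r) r ×ˢ (univ : Set Plane)) := isOpen_Ioo.prod isOpen_univ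
  have hs' : IsPreconnected (Ioo (-r) r ×ˢ (univ : Set Plane)) :=
    isPreconnected_Ioo.prod isPreconnected_univ
  obtain ⟨u, hu, hub⟩ := h.shift.exists_summable hr hrρ
  obtain ⟨v, hv, hvb⟩ := h.fderiv.exists_summable hr hrρ
  set A : ℕ → ℝ × Plane → (ℝ × Plane →L[ℝ] F) := fun n p =>
    (ContinuousLinearMap.fst ℝ ℝ Plane).smulRight (((n : ℝ) * p.1 ^ (n - 1)) • b n p.2)
  set B : ℕ → ℝ × Plane → (ℝ × Plane →L[ℝ] F) := fun n p =>
    (p.1 ^ n • _root_.fderiv ℝ (b n) p.2).comp (ContinuousLinearMap.snd ℝ ℝ Plane)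
  -- The time derivative of the term `n + 1` is the term `n` of the shifted series, and that of the
  -- term `0` vanishes.
  set u' : ℕ → ℝ := fun n => Nat.casesOn n 0 u
  have hu' : Summable u' := (summable_nat_add_iff 1).1 hu
  have hA : ∀ n p, p ∈ Ioo (-r) r ×ˢ (univ : Set Plane) → ‖A n p‖ ≤ u' n := by
    intro n p hp
    have hp1 : |p.1| ≤ r := (abs_lt.2 hp.1).le
    refine (ContinuousLinearMap.norm_smulRight_apply _ _).trans_le ?_
    refine (mul_le_of_le_one_left (norm_nonneg _) (ContinuousLinearMap.norm_fst_le ..)).trans ?_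
    cases n with
    | zero => simp [u']
    | succ n =>
      refine le_trans ?_ (hub n p.2)
      rw [norm_smul, norm_smul, norm_mul, norm_pow, Nat.add_sub_cancel, Real.norm_eq_abs p.1]
      push_cast
      rw [mul_right_comm]
      gcongr
  have hB : ∀ n p, p ∈ Ioo (-r) r ×ˢ (univ : Set Plane) → ‖B n p‖ ≤ v n := by
    intro n p hp
    have hp1 : |p.1| ≤ r := (abs_lt.2 hp.1).le
    refine (ContinuousLinearMap.opNorm_comp_le _ _).trans ?_
    refine (mul_le_of_le_one_right (norm_nonneg _) (ContinuousLinearMap.norm_snd_le ..)).trans ?_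
    refine le_trans ?_ (hvb n p.2)
    rw [norm_smul, norm_pow, Real.norm_eq_abs p.1, mul_comm]
    gcongr
  have hmem : p ∈ Ioo (-r) r ×ˢ (univ : Set Plane) := ⟨abs_lt.1 hpr, mem_univ _⟩
  have key := hasFDerivAt_tsum_of_isPreconnected (𝕜 := ℝ) (f := fun n (p : ℝ × Plane) =>
      p.1 ^ n • b n p.2) (f' := fun n p => A n p + B n p) (hu'.add hv) hs hs' (fun n p _ => ?_)
    (fun n p hp => (norm_add_le _ _).trans (add_le_add (hA n p hp) (hB n p hp))) hmem
    (h.summable hp p.2).of_norm hmem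
  · have sA : Summable fun n => A n p := Summable.of_norm_bounded hu' fun n => hA n p hmem
    have sB : Summable fun n => B n p := Summable.of_norm_bounded hv fun n => hB n p hmem
    rw [sA.tsum_add sB] at key
    refine key.congr_fderiv (Eq.symm ?_)
    have sA' : Summable fun n : ℕ => p.1 ^ n • (((n : ℝ) + 1) • b (n + 1) p.2) :=
      (h.shift.summable hp p.2).of_norm
    have sB' : Summable fun n : ℕ => p.1 ^ n • _root_.fderiv ℝ (b n) p.2 :=
      (h.fderiv.summable hp p.2).of_norm
    congr 1
    · rw [sA.tsum_eq_zero_add]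
      have e0 : A 0 p = 0 := by simp [A]
      rw [e0, zero_add]
      have := ((ContinuousLinearMap.smulRightL ℝ (ℝ × Plane) F)
        (ContinuousLinearMap.fst ℝ ℝ Plane)).map_tsum sA'
      refine Eq.trans this ?_
      refine tsum_congr fun n => ?_
      simp only [A, Nat.add_sub_cancel, smul_smul]
      push_cast
      rw [mul_comm]
      rfl
    · exact ((ContinuousLinearMap.compL ℝ (ℝ × Plane) Plane F).flip
        (ContinuousLinearMap.snd ℝ ℝ Plane)).map_tsum sB'
  · have h1 : HasFDerivAt (fun p : ℝ × Plane => p.1 ^ n)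
        (((n : ℝ) * p.1 ^ (n - 1)) • ContinuousLinearMap.fst ℝ ℝ Plane) p := by
      simpa using (hasFDerivAt_fst (𝕜 := ℝ) (p := p)).pow n
    have h2 : HasFDerivAt (fun p : ℝ × Plane => b n p.2)
        ((_root_.fderiv ℝ (b n) p.2).comp (ContinuousLinearMap.snd ℝ ℝ Plane)) p :=
      (((h.smooth n).differentiable (by simp)) p.2).hasFDerivAt.comp p hasFDerivAt_snd
    refine (h1.smul h2).congr_fderiv ?_
    ext q <;> simp [A, B, mul_smul]

/-- The differential is a continuous linear function of two sums of the same kind, for `h.shift` and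
`h.fderiv`. The second has values in another space, so the induction generalizes over `F`. -/
lemma contDiffOn_nat [CompleteSpace F] (h : SmoothSeries ρ b) (m : ℕ) :
    ContDiffOn ℝ m (fun p : ℝ × Plane => ∑' n, p.1 ^ n • b n p.2) (Ioo (-ρ) ρ ×ˢ univ) := by
  have hs : IsOpen (Ioo (-ρ) ρ ×ˢ (univ : Set Plane)) := isOpen_Ioo.prod isOpen_univ
  induction m generalizing F with
  | zero =>
    exact contDiffOn_zero.2 fun p hp =>
      (h.hasFDerivAt (abs_lt.2 hp.1)).continuousAt.continuousWithinAt
  | succ m ih =>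
    push_cast
    rw [contDiffOn_succ_iff_fderiv_of_isOpen hs]
    refine ⟨fun p hp => (h.hasFDerivAt (abs_lt.2 hp.1)).differentiableAt.differentiableWithinAt,
      by simp, ?_⟩
    have h1 := ih h.shift
    have h2 := ih h.fderiv
    refine ContDiffOn.congr (f := fun p : ℝ × Plane =>
      ((ContinuousLinearMap.smulRightL ℝ (ℝ × Plane) F) (ContinuousLinearMap.fst ℝ ℝ Plane))
          (∑' n : ℕ, p.1 ^ n • (((n : ℝ) + 1) • b (n + 1) p.2)) +
        ((ContinuousLinearMap.compL ℝ (ℝ × Plane) Plane F).flip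
          (ContinuousLinearMap.snd ℝ ℝ Plane)) (∑' n : ℕ, p.1 ^ n • _root_.fderiv ℝ (b n) p.2)) ?_
      fun p hp => (h.hasFDerivAt (abs_lt.2 hp.1)).fderiv
    exact ((ContinuousLinearMap.contDiff _).comp_contDiffOn h1).add
      ((ContinuousLinearMap.contDiff _).comp_contDiffOn h2)

lemma contDiffOn [CompleteSpace F] (h : SmoothSeries ρ b) :
    ContDiffOn ℝ ∞ (fun p : ℝ × Plane => ∑' n, p.1 ^ n • b n p.2) (Ioo (-ρ) ρ ×ˢ univ) :=
  contDiffOn_infty.2 h.contDiffOn_nat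

end SmoothSeries

/-! ### Local existence -/

/-- The sum of the Taylor series in time. -/
def taylorSol (u : Plane → ℝ) (t : ℝ) (x : Plane) : ℝ := ∑' n, t ^ n • coef u n x

section TaylorSol

variable {u : Plane → ℝ} {ρ : ℝ}

lemma smoothSeries_coef (hu : IsTest u) (hρ : ρ * wnorm 0 0 u ≤ 1) : SmoothSeries ρ (coef u) where
  smooth n := (isTest_coef hu n).smooth
  bound k _ hr hrρ := exists_bound_coef hu hρ hr hrρ k

lemma taylorSol_zero (u : Plane → ℝ) : taylorSol u 0 = u := by
  ext x
  rw [taylorSol, tsum_eq_single 0]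
  · simp [coef_zero]
  · intro n hn
    simp [hn]

lemma contDiffOn_taylorSol (hu : IsTest u) (hρ : ρ * wnorm 0 0 u ≤ 1) :
    ContDiffOn ℝ ∞ (fun p : ℝ × Plane => taylorSol u p.1 p.2) (Ioo (-ρ) ρ ×ˢ univ) :=
  (smoothSeries_coef hu hρ).contDiffOn

lemma taylorSol_eq_zero {x : Plane} (hx : u x = 0) (t : ℝ) : taylorSol u t x = 0 := by
  simp [taylorSol, coef_eq_zero hx]

lemma isTest_taylorSol (hu : IsTest u) (hρ : ρ * wnorm 0 0 u ≤ 1) {t : ℝ} (ht : |t| < ρ) :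
    IsTest (taylorSol u t) where
  smooth := by
    have h := (contDiffOn_taylorSol hu hρ).comp (s := univ) (f := fun x : Plane => (t, x))
      (by fun_prop) fun x _ => ⟨abs_lt.1 ht, mem_univ _⟩
    exact contDiffOn_univ.1 h
  compact := hu.compact.mono fun x hx hux => hx (taylorSol_eq_zero hux t)

/-- All coefficients live on the compact set `tsupport u`, so uniform summability suffices for
integrating termwise. -/
lemma realFourier_taylorSol (hu : IsTest u) (hρ : ρ * wnorm 0 0 u ≤ 1) {t : ℝ} (ht : |t| < ρ)
    (ξ : Plane) :
    HasSum (fun n => (t : ℂ) ^ n * realFourier (coef u n) ξ) (realFourier (taylorSol u t) ξ) := by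
  have hS := smoothSeries_coef hu hρ
  obtain ⟨v, hv, hvb⟩ := hS.exists_summable (abs_nonneg t) ht
  have hK : IsCompact (tsupport u) := hu.compact
  have hsupp : ∀ n, Function.support (fun x => (t : ℂ) ^ n * (coef u n x : ℂ)) ⊆ tsupport u := by
    intro n x hx
    refine subset_tsupport _ fun h0 => hx ?_
    simp [coef_eq_zero h0]
  have hnorm : ∀ n, ∫ x, ‖Complex.exp (↑(-2 * Real.pi * inner ℝ x ξ) * Complex.I) •
      ((t : ℂ) ^ n * (coef u n x : ℂ))‖ ≤ v n * volume.real (tsupport u) := by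
    intro n
    simp only [norm_smul, Complex.norm_exp_ofReal_mul_I, one_mul]
    rw [← setIntegral_eq_integral_of_forall_compl_eq_zero (s := tsupport u)]
    · calc ∫ x in tsupport u, ‖(t : ℂ) ^ n * (coef u n x : ℂ)‖
          ≤ ∫ x in tsupport u, v n := by
            refine setIntegral_mono_on ?_ (integrableOn_const hK.measure_lt_top.ne) hK.measurableSet
              fun x _ => ?_
            · exact ((isTest_coef hu n).integrable_complex.const_mul _).norm.integrableOn
            · have := hvb n x
              simpa [mul_comm] using this
        _ = _ := by simp [mul_comm]
    · intro x hx
      rw [norm_eq_zero]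
      exact Function.notMem_support.1 fun h => hx (hsupp n h)
  have key := hasSum_integral_of_summable_integral_norm (μ := (volume : Measure Plane))
    (F := fun n x => Complex.exp (↑(-2 * Real.pi * inner ℝ x ξ) * Complex.I) •
      ((t : ℂ) ^ n * (coef u n x : ℂ))) (fun n => ?_)
    (Summable.of_nonneg_of_le (fun n => integral_nonneg fun _ => norm_nonneg _) hnorm
      (hv.mul_right _))
  · have e1 : ∀ n, ∫ x, Complex.exp (↑(-2 * Real.pi * inner ℝ x ξ) * Complex.I) •
        ((t : ℂ) ^ n * (coef u n x : ℂ)) = (t : ℂ) ^ n * realFourier (coef u n) ξ := by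
      intro n
      rw [realFourier, Real.fourier_eq', ← integral_const_mul]
      congr 1
      ext x
      simp only [smul_eq_mul]
      ring
    have e2 : ∀ x, ∑' n, Complex.exp (↑(-2 * Real.pi * inner ℝ x ξ) * Complex.I) •
        ((t : ℂ) ^ n * (coef u n x : ℂ)) =
        Complex.exp (↑(-2 * Real.pi * inner ℝ x ξ) * Complex.I) • (taylorSol u t x : ℂ) := by
      intro x
      simp only [smul_eq_mul]
      rw [tsum_mul_left, taylorSol, Complex.ofReal_tsum]
      simp
    simp only [e1, e2] at key
    rwa [realFourier, Real.fourier_eq']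
  · have := (isTest_coef hu n).integrable_complex.const_mul ((t : ℂ) ^ n)
    have h2 := (Real.fourierIntegral_convergent_iff (μ := volume) ξ).2 this
    refine h2.congr (ae_of_all _ fun x => ?_)
    simp only [Circle.smul_def, Real.fourierChar_apply]
    congr 3
    push_cast
    ring

lemma integral_norm_realFourier_eq (f : Plane → ℝ) : ∫ ξ, ‖realFourier f ξ‖ = wnorm 0 0 f := by
  simp [wnorm, weight]

lemma rieszSq_taylorSol (hu : IsTest u) (hρ : ρ * wnorm 0 0 u ≤ 1) {t : ℝ} (ht : |t| < ρ)
    (x : Plane) :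
    HasSum (fun n => t ^ n * rieszSq (coef u n) x) (rieszSq (taylorSol u t) x) := by
  have key := hasSum_integral_of_summable_integral_norm (μ := (volume : Measure Plane))
    (F := fun n ξ => Complex.exp (↑(2 * Real.pi * inner ℝ ξ x) * Complex.I) •
      ((symbolSq ξ : ℂ) * ((t : ℂ) ^ n * realFourier (coef u n) ξ))) (fun n => ?_) ?_
  · have e1 : ∀ n, ∫ ξ, Complex.exp (↑(2 * Real.pi * inner ℝ ξ x) * Complex.I) •
      ((symbolSq ξ : ℂ) * ((t : ℂ) ^ n * realFourier (coef u n) ξ)) =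
        ((t ^ n * rieszSq (coef u n) x : ℝ) : ℂ) := by
      intro n
      rw [Complex.ofReal_mul, ofReal_rieszSq, Real.fourierInv_eq', ← integral_const_mul]
      congr 1
      ext x
      simp only [smul_eq_mul, Complex.ofReal_pow]
      ring
    have e2 : ∀ ξ, ∑' n, Complex.exp (↑(2 * Real.pi * inner ℝ ξ x) * Complex.I) •
        ((symbolSq ξ : ℂ) * ((t : ℂ) ^ n * realFourier (coef u n) ξ)) =
        Complex.exp (↑(2 * Real.pi * inner ℝ ξ x) * Complex.I) •
          ((symbolSq ξ : ℂ) * realFourier (taylorSol u t) ξ) := by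
      intro ξ
      simp only [smul_eq_mul]
      rw [tsum_mul_left, tsum_mul_left, (realFourier_taylorSol hu hρ ht ξ).tsum_eq]
    simp only [e1, e2] at key
    rw [← Real.fourierInv_eq', ← ofReal_rieszSq] at key
    exact_mod_cast key
  · have := (isTest_coef hu n).integrable_mul.const_mul ((t : ℂ) ^ n)
    have h2 := (Real.fourierIntegral_convergent_iff (μ := volume) (-x)).2 this
    refine h2.congr (ae_of_all _ fun ξ => ?_)
    simp only [Circle.smul_def, Real.fourierChar_apply, smul_eq_mul, inner_neg_right, neg_neg]
    ring
  · refine Summable.of_nonneg_of_le (fun n => integral_nonneg fun _ => norm_nonneg _) (fun n => ?_)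
      (summable_wnorm_coef hu hρ ht)
    rw [← integral_norm_realFourier_eq, ← integral_const_mul]
    refine integral_mono_of_nonneg (ae_of_all _ fun _ => norm_nonneg _)
      ((isTest_coef hu n).integrable_realFourier.norm.const_mul _) (ae_of_all _ fun ξ => ?_)
    simp only [norm_smul, Complex.norm_exp_ofReal_mul_I, one_mul]
    refine (IsTest.norm_symbolSq_mul_le (fun ξ => (t : ℂ) ^ n * realFourier (coef u n) ξ) ξ).trans_eq ?_
    simp

lemma continuousOn_rieszSq_taylorSol (hu : IsTest u) (hρ : ρ * wnorm 0 0 u ≤ 1) :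
    ContinuousOn (fun p : ℝ × Plane => rieszSq (taylorSol u p.1) p.2) (Ioo (-ρ) ρ ×ˢ univ) := by
  intro p hp
  obtain ⟨r, hpr, hrρ⟩ := exists_between (abs_lt.2 hp.1)
  have hr : 0 ≤ r := (abs_nonneg _).trans hpr.le
  have hopen : IsOpen (Ioo (-r) r ×ˢ (univ : Set Plane)) := isOpen_Ioo.prod isOpen_univ
  have hmem : p ∈ Ioo (-r) r ×ˢ (univ : Set Plane) := ⟨abs_lt.1 hpr, mem_univ _⟩
  have hsum : Summable fun n => r ^ n * wnorm 0 0 (coef u n) := by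
    have := summable_wnorm_coef hu hρ (t := r) (by rwa [abs_of_nonneg hr])
    rwa [abs_of_nonneg hr] at this
  have h1 : ContinuousOn (fun p : ℝ × Plane => ∑' n, p.1 ^ n * rieszSq (coef u n) p.2)
      (Ioo (-r) r ×ˢ univ) := by
    refine continuousOn_tsum (fun n => ?_) hsum fun n q hq => ?_
    · have := (isTest_coef hu n).contDiff_rieszSq.continuous
      exact Continuous.continuousOn (by fun_prop)
    · rw [norm_mul, norm_pow, Real.norm_eq_abs, Real.norm_eq_abs]
      have := (isTest_coef hu n).abs_rieszSq_le q.2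
      rw [integral_norm_realFourier_eq] at this
      have h3 := (abs_lt.2 hq.1).le
      gcongr
  have h2 : ContinuousOn (fun p : ℝ × Plane => rieszSq (taylorSol u p.1) p.2)
      (Ioo (-r) r ×ˢ univ) :=
    h1.congr fun q hq => (rieszSq_taylorSol hu hρ ((abs_lt.2 hq.1).trans hrρ) q.2).tsum_eq.symm
  exact (h2.continuousAt (hopen.mem_nhds hmem)).continuousWithinAt

/-- The recursion for `coef` is the Cauchy product of the series of the solution with that of its
`R₁²`. -/
lemma hasDerivAt_taylorSol (hu : IsTest u) (hρ : ρ * wnorm 0 0 u ≤ 1) {t : ℝ} (ht : |t| < ρ)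
    (x : Plane) :
    HasDerivAt (fun s => taylorSol u s x) (taylorSol u t x * rieszSq (taylorSol u t) x) t := by
  have hS := smoothSeries_coef hu hρ
  have h1 := (hS.hasFDerivAt (p := (t, x)) ht).comp_hasDerivAt t
    ((hasDerivAt_id t).prodMk (hasDerivAt_const t x))
  refine h1.congr_deriv ?_
  simp only [add_apply, ContinuousLinearMap.smulRight_apply,
    ContinuousLinearMap.coe_fst', ContinuousLinearMap.comp_apply, ContinuousLinearMap.coe_snd',
    map_zero, add_zero, one_smul]
  have s1 := hS.summable ht x
  have s2 : Summable fun n => ‖t ^ n * rieszSq (coef u n) x‖ :=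
    (rieszSq_taylorSol hu hρ ht x).summable.norm
  rw [← (rieszSq_taylorSol hu hρ ht x).tsum_eq, taylorSol,
    tsum_mul_tsum_eq_tsum_sum_range_of_summable_norm s1 s2]
  refine tsum_congr fun n => ?_
  rw [coef_succ]
  simp only [smul_eq_mul]
  rw [mul_inv_cancel_left₀ (by positivity), Finset.mul_sum]
  refine Finset.sum_congr rfl fun i hi => ?_
  rw [Finset.mem_range] at hi
  have : t ^ n = t ^ i * t ^ (n - i) := by rw [← pow_add]; congr 1; omega
  rw [this]
  ring

end TaylorSol

end

noncomputable section

/-! ### Scalar linear equations -/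

lemma eq_mul_exp_integral {T : ℝ} {a y : ℝ → ℝ} (ha : ContinuousOn a (Ico 0 T))
    (hy : ∀ t ∈ Ico 0 T, HasDerivWithinAt y (y t * a t) (Ico 0 T) t) {t : ℝ} (ht : t ∈ Ico 0 T) :
    y t = y 0 * Real.exp (∫ s in (0 : ℝ)..t, a s) := by
  have hsub : Icc 0 t ⊆ Ico 0 T := fun s hs => ⟨hs.1, hs.2.trans_lt ht.2⟩
  -- A continuous extension to the whole line, so that the primitive is differentiable at the
  -- endpoints too.
  set A : ℝ → ℝ := IccExtend ht.1 ((Icc 0 t).domRestrict a)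
  have hA : Continuous A := (ha.mono hsub).domRestrict.Icc_extend'
  have hAa : ∀ s ∈ Icc 0 t, A s = a s := fun s hs => by
    simp only [A, IccExtend_of_mem _ _ hs]
    rfl
  have hIntegrable : ∫ s in (0 : ℝ)..t, a s = ∫ s in (0 : ℝ)..t, A s := by
    refine intervalIntegral.integral_congr fun s hs => ?_
    rw [uIcc_of_le ht.1] at hs
    exact (hAa s hs).symm
  set G : ℝ → ℝ := fun s => ∫ r in (0 : ℝ)..s, A r
  have hG : ∀ s, HasDerivAt G (A s) s := fun s => (hA.integral_hasStrictDerivAt 0 s).hasDerivAt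
  have hder : ∀ s ∈ Icc 0 t, HasDerivWithinAt (fun s => y s * Real.exp (-G s)) 0 (Ico 0 T) s := by
    intro s hs
    refine ((hy s (hsub hs)).mul ((hG s).neg.exp.hasDerivWithinAt)).congr_deriv ?_
    rw [hAa s hs]
    ring
  have key := constant_of_has_deriv_right_zero (f := fun s => y s * Real.exp (-G s))
    (fun s hs => ((hder s hs).mono hsub).continuousWithinAt)
    (fun s hs => (hder s (Ico_subset_Icc_self hs)).mono_of_mem_nhdsWithin ?_) t
    (right_mem_Icc.2 ht.1)
  · have h0 : G 0 = 0 := by simp [G]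
    simp only [h0, neg_zero, Real.exp_zero, mul_one] at key
    rw [hIntegrable, ← key, mul_assoc, ← Real.exp_add]
    simp [G]
  · refine Filter.mem_of_superset (Ico_mem_nhdsGE (hs.2.trans ht.2)) fun r hr => ⟨hs.1.trans hr.1, hr.2⟩

/-! ### The equation near a time -/

/-- `v` solves `∂ₜ v = v R₁² v` at the time `t`, relative to the set of times `S`, and it is smooth
with compact support there. -/
structure SolvesAt (S : Set ℝ) (v : ℝ → Plane → ℝ) (t : ℝ) : Prop where
  isTest : IsTest (v t)
  smooth : ∀ x, ContDiffWithinAt ℝ ∞ (fun p : ℝ × Plane => v p.1 p.2) (S ×ˢ univ) (t, x)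
  cont : ∀ x, ContinuousWithinAt (fun p : ℝ × Plane => rieszSq (v p.1) p.2) (S ×ˢ univ) (t, x)
  deriv : ∀ x, HasDerivWithinAt (fun s => v s x) (v t x * rieszSq (v t) x) S t

namespace SolvesAt

variable {S S' : Set ℝ} {v v' : ℝ → Plane → ℝ} {t : ℝ}

/-- Solving at `t` depends only on the germ in time, since `R₁²` is nonlocal in space alone. This is
what allows solutions to be glued. -/
lemma congr (h : SolvesAt S v t) (hS : S ∈ nhdsWithin t S')
    (hv : ∀ᶠ s in nhdsWithin t S', v' s = v s) (ht : v' t = v t) : SolvesAt S' v' t := by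
  have hprod : ∀ x : Plane, S ×ˢ (univ : Set Plane) ∈ nhdsWithin (t, x) (S' ×ˢ univ) := by
    intro x
    rw [nhdsWithin_prod_eq]
    exact Filter.prod_mem_prod hS Filter.univ_mem
  have hev : ∀ x : Plane, ∀ᶠ p : ℝ × Plane in nhdsWithin (t, x) (S' ×ˢ univ), v' p.1 = v p.1 := by
    intro x
    rw [nhdsWithin_prod_eq]
    exact Filter.tendsto_fst.eventually hv
  refine ⟨by rw [ht]; exact h.isTest, fun x => ?_, fun x => ?_, fun x => ?_⟩
  · refine ((h.smooth x).mono_of_mem_nhdsWithin (hprod x)).congr_of_eventuallyEq ?_ (by simp [ht])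
    filter_upwards [hev x] with p hp
    rw [hp]
  · refine ((h.cont x).mono_of_mem_nhdsWithin (hprod x)).congr_of_eventuallyEq ?_ (by simp [ht])
    filter_upwards [hev x] with p hp
    rw [hp]
  · rw [ht]
    refine ((h.deriv x).mono_of_mem_nhdsWithin hS).congr_of_eventuallyEq ?_ (by simp [ht])
    filter_upwards [hv] with s hs
    rw [hs]

lemma comp_sub {c : ℝ} (h : SolvesAt S v (t - c)) (hS : ∀ s ∈ S', s - c ∈ S) :
    SolvesAt S' (fun s => v (s - c)) t := by
  have hmaps : ∀ x : Plane, MapsTo (fun p : ℝ × Plane => (p.1 - c, p.2)) (S' ×ˢ univ) (S ×ˢ univ) :=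
    fun x p hp => ⟨hS p.1 hp.1, mem_univ _⟩
  refine ⟨h.isTest, fun x => ?_, fun x => ?_, fun x => ?_⟩
  · exact (h.smooth x).comp (t, x) (f := fun p : ℝ × Plane => (p.1 - c, p.2))
      (by fun_prop) (hmaps x)
  · exact (h.cont x).comp (f := fun p : ℝ × Plane => (p.1 - c, p.2)) (x := (t, x))
      (by fun_prop) (hmaps x)
  · have := (h.deriv x).scomp t (h := fun s => s - c) (s := S')
      ((hasDerivWithinAt_id t S').sub_const c) hS
    simpa [Function.comp_def] using this

end SolvesAt

lemma solvesAt_taylorSol {u : Plane → ℝ} {ρ t : ℝ} (hu : IsTest u) (hρ : ρ * wnorm 0 0 u ≤ 1)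
    (ht : |t| < ρ) : SolvesAt (Ioo (-ρ) ρ) (taylorSol u) t where
  isTest := isTest_taylorSol hu hρ ht
  smooth x := contDiffOn_taylorSol hu hρ (t, x) ⟨abs_lt.1 ht, mem_univ _⟩
  cont x := continuousOn_rieszSq_taylorSol hu hρ (t, x) ⟨abs_lt.1 ht, mem_univ _⟩
  deriv x := (hasDerivAt_taylorSol hu hρ ht x).hasDerivWithinAt

namespace IsSmoothSolution

variable {T : ℝ} {w₀ : Plane → ℝ} {w : ℝ → Plane → ℝ}

lemma of_solvesAt (h0 : w 0 = w₀) (h : ∀ t ∈ Ico 0 T, SolvesAt (Ico 0 T) w t) :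
    IsSmoothSolution T w₀ w where
  initial := h0
  smooth p hp := (h p.1 hp.1).smooth p.2
  equation := ⟨fun t => rieszSq (w t), fun p hp => (h p.1 hp.1).cont p.2,
    fun t ht => ⟨(h t ht).isTest.isRieszSq, (h t ht).deriv⟩⟩

/-- At fixed `x` the equation is a linear ODE with continuous coefficient `g · x`. Hence solutions
stay compactly supported and the theory of `IsTest` applies to each `w t`. -/
lemma eq_zero (h : IsSmoothSolution T w₀ w) {t : ℝ} (ht : t ∈ Ico 0 T) {x : Plane}
    (hx : w₀ x = 0) : w t x = 0 := by
  obtain ⟨g, hg, heq⟩ := h.equation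
  have hc : ContinuousOn (fun s => g s x) (Ico 0 T) :=
    hg.comp (f := fun s => (s, x)) (by fun_prop) fun s hs => ⟨hs, mem_univ _⟩
  rw [eq_mul_exp_integral hc (fun s hs => (heq s hs).2 x) ht, h.initial, hx, zero_mul]

lemma isTest (h : IsSmoothSolution T w₀ w) (h0 : IsTest w₀) {t : ℝ} (ht : t ∈ Ico 0 T) :
    IsTest (w t) where
  smooth := contDiffOn_univ.1 (h.smooth.comp (s := univ) (f := fun x : Plane => (t, x))
    (by fun_prop) fun x _ => ⟨ht, mem_univ _⟩)
  compact := h0.compact.mono fun x hx hux => hx (h.eq_zero ht hux)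

lemma solvesAt (h : IsSmoothSolution T w₀ w) (h0 : IsTest w₀) {t : ℝ} (ht : t ∈ Ico 0 T) :
    SolvesAt (Ico 0 T) w t := by
  obtain ⟨g, hg, heq⟩ := h.equation
  have hgt : ∀ s ∈ Ico 0 T, g s = rieszSq (w s) := by
    intro s hs
    refine (heq s hs).1.eq_rieszSq (h.isTest h0 hs) ?_
    exact continuousOn_univ.1 (hg.comp (f := fun x : Plane => (s, x)) (by fun_prop)
      fun x _ => ⟨hs, mem_univ _⟩)
  refine ⟨h.isTest h0 ht, fun x => h.smooth (t, x) ⟨ht, mem_univ _⟩, fun x => ?_, fun x => ?_⟩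
  · exact (hg (t, x) ⟨ht, mem_univ _⟩).congr (fun p hp => by rw [hgt p.1 hp.1])
      (by rw [hgt t ht])
  · rw [← hgt t ht]
    exact (heq t ht).2 x

lemma mono (h : IsSmoothSolution T w₀ w) (h0 : IsTest w₀) {T' : ℝ} (hT : T' ≤ T) :
    IsSmoothSolution T' w₀ w :=
  of_solvesAt h.initial fun _ ht => (h.solvesAt h0 ⟨ht.1, ht.2.trans_le hT⟩).congr
    (Filter.mem_of_superset self_mem_nhdsWithin fun _ hs => ⟨hs.1, hs.2.trans_le hT⟩)
    (Filter.Eventually.of_forall fun _ => rfl) rfl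

lemma continuousOn (h : IsSmoothSolution T w₀ w) :
    ContinuousOn (fun p : ℝ × Plane => w p.1 p.2) (Ico 0 T ×ˢ univ) := h.smooth.continuousOn

lemma continuousOn_rieszSq (h : IsSmoothSolution T w₀ w) (h0 : IsTest w₀) :
    ContinuousOn (fun p : ℝ × Plane => rieszSq (w p.1) p.2) (Ico 0 T ×ˢ univ) :=
  fun p hp => (h.solvesAt h0 hp.1).cont p.2

lemma hasDerivAt (h : IsSmoothSolution T w₀ w) (h0 : IsTest w₀) {t : ℝ} (ht : t ∈ Ioo 0 T)
    (x : Plane) : HasDerivAt (fun s => w s x) (w t x * rieszSq (w t) x) t :=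
  ((h.solvesAt h0 (Ioo_subset_Ico_self ht)).deriv x).hasDerivAt (Ico_mem_nhds ht.1 ht.2)

lemma eq_mul_exp (h : IsSmoothSolution T w₀ w) (h0 : IsTest w₀) {t : ℝ} (ht : t ∈ Ico 0 T)
    (x : Plane) : w t x = w₀ x * Real.exp (∫ s in (0 : ℝ)..t, rieszSq (w s) x) := by
  have hc : ContinuousOn (fun s => rieszSq (w s) x) (Ico 0 T) :=
    (h.continuousOn_rieszSq h0).comp (f := fun s => (s, x)) (by fun_prop)
      fun s hs => ⟨hs, mem_univ _⟩
  rw [← h.initial]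
  exact eq_mul_exp_integral hc (fun s hs => (h.solvesAt h0 hs).deriv x) ht

lemma exists_bound (h : IsSmoothSolution T w₀ w) (h0 : IsTest w₀) {b : ℝ} (hb : b < T) :
    ∃ M, 0 ≤ M ∧ ∀ t ∈ Icc 0 b, ∀ x ∈ tsupport w₀, |w t x| ≤ M ∧ |rieszSq (w t) x| ≤ M := by
  have hK : IsCompact (Icc 0 b ×ˢ tsupport w₀) := isCompact_Icc.prod h0.compact
  have hsub : Icc 0 b ×ˢ tsupport w₀ ⊆ Ico 0 T ×ˢ univ :=
    prod_mono (fun s hs => ⟨hs.1, hs.2.trans_lt hb⟩) (subset_univ _)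
  obtain ⟨C, hC⟩ := hK.exists_bound_of_continuousOn (h.continuousOn.mono hsub)
  obtain ⟨D, hD⟩ := hK.exists_bound_of_continuousOn ((h.continuousOn_rieszSq h0).mono hsub)
  refine ⟨max 0 (max C D), le_max_left _ _, fun _ ht _ hx => ⟨?_, ?_⟩⟩
  · exact (hC (_, _) ⟨ht, hx⟩).trans ((le_max_left _ _).trans (le_max_right _ _))
  · exact (hD (_, _) ⟨ht, hx⟩).trans ((le_max_right _ _).trans (le_max_right _ _))

/-! ### Uniqueness -/

lemma energy_hasDerivAt {v : ℝ → Plane → ℝ} (hv : IsSmoothSolution T w₀ v)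
    (hw : IsSmoothSolution T w₀ w) (h0 : IsTest w₀) {t : ℝ} (ht : t ∈ Ioo 0 T) :
    HasDerivAt (fun s => ∫ x, (v s x - w s x) ^ 2)
      (∫ x, 2 * (v t x - w t x) * (v t x * rieszSq (v t) x - w t x * rieszSq (w t) x)) t := by
  obtain ⟨b, htb, hbT⟩ := exists_between ht.2
  obtain ⟨M, hM0, hM⟩ := hv.exists_bound h0 hbT
  obtain ⟨N, hN0, hN⟩ := hw.exists_bound h0 hbT
  have htI : t ∈ Ico 0 T := Ioo_subset_Ico_self ht
  have hd : ∀ s ∈ Ico 0 T, IsTest fun x => v s x - w s x :=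
    fun s hs => (hv.isTest h0 hs).sub (hw.isTest h0 hs)
  refine (hasDerivAt_integral_of_dominated_loc_of_deriv_le (s := Ioo 0 b)
    (F := fun s x => (v s x - w s x) ^ 2) (F' := fun s x => 2 * (v s x - w s x) *
      (v s x * rieszSq (v s) x - w s x * rieszSq (w s) x))
    (bound := (tsupport w₀).indicator fun _ => 2 * (M + N) * (M * M + N * N))
    (Ioo_mem_nhds ht.1 htb) ?_ ?_ ?_ ?_ ?_ ?_).2
  · filter_upwards [Ioo_mem_nhds ht.1 ht.2] with s hs
    have := (hd s (Ioo_subset_Ico_self hs)).continuous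
    exact (this.pow 2).aestronglyMeasurable
  · exact ((hd t htI).memLp 2).integrable_sq
  · have h1 := (hv.isTest h0 htI).continuous
    have h2 := (hw.isTest h0 htI).continuous
    have h3 := (hv.isTest h0 htI).contDiff_rieszSq.continuous
    have h4 := (hw.isTest h0 htI).contDiff_rieszSq.continuous
    exact Continuous.aestronglyMeasurable (by fun_prop)
  · refine ae_of_all _ fun x s hs => ?_
    have hsI : s ∈ Ico 0 T := ⟨hs.1.le, hs.2.trans hbT⟩
    by_cases hx : x ∈ tsupport w₀
    · rw [indicator_of_mem hx]
      obtain ⟨h1, h2⟩ := hM s ⟨hs.1.le, hs.2.le⟩ x hx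
      obtain ⟨h3, h4⟩ := hN s ⟨hs.1.le, hs.2.le⟩ x hx
      rw [Real.norm_eq_abs, abs_mul, abs_mul, abs_two]
      have h5 : |v s x - w s x| ≤ M + N := (abs_sub _ _).trans (add_le_add h1 h3)
      have h6 : |v s x * rieszSq (v s) x - w s x * rieszSq (w s) x| ≤ M * M + N * N := by
        refine (abs_sub _ _).trans ?_
        rw [abs_mul, abs_mul]
        gcongr
      gcongr
    · have hx0 : w₀ x = 0 := image_eq_zero_of_notMem_tsupport hx
      simp [hv.eq_zero hsI hx0, hw.eq_zero hsI hx0, hx]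
  · exact (integrable_indicator_iff h0.compact.measurableSet).2
      (integrableOn_const h0.compact.measure_lt_top.ne)
  · refine ae_of_all _ fun x s hs => ?_
    have hsI : s ∈ Ioo 0 T := ⟨hs.1, hs.2.trans hbT⟩
    refine (((hv.hasDerivAt h0 hsI x).sub (hw.hasDerivAt h0 hsI x)).pow 2).congr_deriv ?_
    simp

/-- With `d = v - w`, the difference of the nonlinearities is `d R₁²v + w R₁²d`. The first term
costs `2M`, the second by Young's inequality `M` for `d` and `M` for `R₁²d`, and `R₁²` contracts
`L²`. -/
lemma energy_deriv_le {v : ℝ → Plane → ℝ} (hv : IsSmoothSolution T w₀ v)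
    (hw : IsSmoothSolution T w₀ w) (h0 : IsTest w₀) {t M : ℝ} (ht : t ∈ Ico 0 T) (hM0 : 0 ≤ M)
    (hv_le : ∀ x ∈ tsupport w₀, |rieszSq (v t) x| ≤ M) (hw_le : ∀ x ∈ tsupport w₀, |w t x| ≤ M) :
    ∫ x, 2 * (v t x - w t x) * (v t x * rieszSq (v t) x - w t x * rieszSq (w t) x) ≤
      4 * M * ∫ x, (v t x - w t x) ^ 2 := by
  have hvt := hv.isTest h0 ht
  have hwt := hw.isTest h0 ht
  have hd := hvt.sub hwt
  set d : Plane → ℝ := fun x => v t x - w t x with hd_def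
  have hR : ∀ x, rieszSq d x = rieszSq (v t) x - rieszSq (w t) x := hvt.rieszSq_sub hwt
  have i1 : Integrable fun x => d x ^ 2 := (hd.memLp 2).integrable_sq
  have i2 : Integrable fun x => rieszSq d x ^ 2 := hd.memLp_rieszSq.integrable_sq
  have htest : IsTest fun x => d x *
      (2 * (v t x * rieszSq (v t) x - w t x * rieszSq (w t) x)) :=
    hd.mul_smooth (contDiff_const.mul ((hvt.smooth.mul hvt.contDiff_rieszSq).sub
      (hwt.smooth.mul hwt.contDiff_rieszSq)))
  have i3 : Integrable fun x => 2 * d x * (v t x * rieszSq (v t) x - w t x * rieszSq (w t) x) := by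
    refine htest.integrable.congr (ae_of_all _ fun x => ?_)
    dsimp only
    ring
  have hle : ∀ x, 2 * d x * (v t x * rieszSq (v t) x - w t x * rieszSq (w t) x) ≤
      3 * M * d x ^ 2 + M * rieszSq d x ^ 2 := by
    intro x
    by_cases hx : x ∈ tsupport w₀
    · have h1 := hv_le x hx
      have h2 := hw_le x hx
      have e : 2 * d x * (v t x * rieszSq (v t) x - w t x * rieszSq (w t) x) =
          2 * (rieszSq (v t) x * d x ^ 2) + w t x * (2 * d x * rieszSq d x) := by
        rw [hR, hd_def]
        ring
      have h3 : rieszSq (v t) x * d x ^ 2 ≤ M * d x ^ 2 := by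
        gcongr
        exact (le_abs_self _).trans h1
      have h4 : w t x * (2 * d x * rieszSq d x) ≤ M * (d x ^ 2 + rieszSq d x ^ 2) := by
        refine (le_abs_self _).trans ?_
        rw [abs_mul]
        refine mul_le_mul h2 ?_ (abs_nonneg _) hM0
        rw [abs_le]
        constructor <;> nlinarith [sq_nonneg (d x - rieszSq d x), sq_nonneg (d x + rieszSq d x)]
      linarith
    · have hx0 : w₀ x = 0 := image_eq_zero_of_notMem_tsupport hx
      have : d x = 0 := by simp [hd_def, hv.eq_zero ht hx0, hw.eq_zero ht hx0]
      rw [this]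
      simp only [mul_zero, zero_mul]
      positivity
  calc _ ≤ ∫ x, (3 * M * d x ^ 2 + M * rieszSq d x ^ 2) :=
        integral_mono i3 ((i1.const_mul _).add (i2.const_mul _)) hle
    _ = (3 * M * ∫ x, d x ^ 2) + M * ∫ x, rieszSq d x ^ 2 := by
        rw [integral_add (i1.const_mul _) (i2.const_mul _), integral_const_mul, integral_const_mul]
    _ ≤ (3 * M * ∫ x, d x ^ 2) + M * ∫ x, d x ^ 2 := by
        have := mul_le_mul_of_nonneg_left hd.integral_rieszSq_sq_le hM0
        linarith
    _ = _ := by ring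

/-- Two smooth solutions with the same initial datum coincide. -/
theorem unique {v : ℝ → Plane → ℝ} (hv : IsSmoothSolution T w₀ v)
    (hw : IsSmoothSolution T w₀ w) (h0 : IsTest w₀) {b : ℝ} (hb : b ∈ Ico 0 T) : v b = w b := by
  obtain ⟨M, hM0, hM⟩ := hv.exists_bound h0 hb.2
  obtain ⟨N, hN0, hN⟩ := hw.exists_bound h0 hb.2
  set E : ℝ → ℝ := fun s => ∫ x, (v s x - w s x) ^ 2 with hE
  have hsub : Icc 0 b ⊆ Ico 0 T := fun s hs => ⟨hs.1, hs.2.trans_lt hb.2⟩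
  have hEc : ContinuousOn E (Icc 0 b) := by
    refine continuousOn_integral_of_compact_support (k := tsupport w₀) h0.compact ?_ ?_
    · exact ((hv.continuousOn.sub hw.continuousOn).pow 2).mono (prod_mono hsub subset_rfl)
    · intro s x hs hx
      have hx0 : w₀ x = 0 := image_eq_zero_of_notMem_tsupport hx
      simp [hv.eq_zero (hsub hs) hx0, hw.eq_zero (hsub hs) hx0]
  -- Gronwall's argument: `E` times the integrating factor `exp (-C s)` is nonincreasing and starts
  -- at zero.
  set C := 4 * max M N
  have hder : ∀ s ∈ Ioo 0 b, HasDerivAt (fun s => E s * Real.exp (-(C * s)))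
      ((∫ x, 2 * (v s x - w s x) * (v s x * rieszSq (v s) x - w s x * rieszSq (w s) x)) *
        Real.exp (-(C * s)) + E s * (Real.exp (-(C * s)) * -C)) s := by
    intro s hs
    refine (energy_hasDerivAt hv hw h0 ⟨hs.1, hs.2.trans hb.2⟩).mul ?_
    have : HasDerivAt (fun s => -(C * s)) (-C) s := by
      simpa using ((hasDerivAt_id s).const_mul C).fun_neg
    exact this.exp
  have hanti : AntitoneOn (fun s => E s * Real.exp (-(C * s))) (Icc 0 b) := by
    refine antitoneOn_of_deriv_nonpos (convex_Icc 0 b) (hEc.mul (by fun_prop)) ?_ ?_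
    · rw [interior_Icc]
      exact fun s hs => (hder s hs).differentiableAt.differentiableWithinAt
    · rw [interior_Icc]
      intro s hs
      rw [(hder s hs).deriv]
      have hsI : s ∈ Icc 0 b := Ioo_subset_Icc_self hs
      have := energy_deriv_le hv hw h0 (hsub hsI) (hM0.trans (le_max_left M N))
        (fun x hx => (hM s hsI x hx).2.trans (le_max_left _ _))
        (fun x hx => (hN s hsI x hx).1.trans (le_max_right _ _))
      have h2 := mul_le_mul_of_nonneg_right this (Real.exp_pos (-(C * s))).le
      simp only [hE]
      nlinarith
  have hle := hanti (left_mem_Icc.2 hb.1) (right_mem_Icc.2 hb.1) hb.1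
  have hE0 : E 0 = 0 := by simp [hE, hv.initial, hw.initial]
  simp only [hE0, zero_mul] at hle
  have hEb : E b ≤ 0 := nonpos_of_mul_nonpos_left hle (Real.exp_pos _)
  have hd := (hv.isTest h0 hb).sub (hw.isTest h0 hb)
  have hzero : ∫ x, (v b x - w b x) ^ 2 = 0 :=
    le_antisymm hEb (integral_nonneg fun x => sq_nonneg _)
  have hae := (integral_eq_zero_iff_of_nonneg (fun x => sq_nonneg _)
    (hd.memLp 2).integrable_sq).1 hzero
  have := (Continuous.ae_eq_iff_eq volume (hd.continuous.pow 2) continuous_zero).1 hae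
  ext x
  have hx := congrFun this x
  simp only [Pi.pow_apply, Pi.zero_apply] at hx
  exact sub_eq_zero.1 (pow_eq_zero_iff two_ne_zero |>.1 hx)

end IsSmoothSolution

end

noncomputable section

/-! ### Continuation of solutions -/

namespace IsSmoothSolution

variable {T : ℝ} {w₀ : Plane → ℝ} {w : ℝ → Plane → ℝ}

lemma taylorSol {u : Plane → ℝ} {ρ : ℝ} (hu : IsTest u) (hρ : ρ * wnorm 0 0 u ≤ 1) :
    IsSmoothSolution ρ u (taylorSol u) := by
  refine of_solvesAt (taylorSol_zero u) fun t ht => ?_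
  have ht' : |t| < ρ := by rw [abs_of_nonneg ht.1]; exact ht.2
  refine (solvesAt_taylorSol hu hρ ht').congr ?_ (Filter.Eventually.of_forall fun _ => rfl) rfl
  exact mem_nhdsWithin_of_mem_nhds (Ioo_mem_nhds (abs_lt.1 ht').1 ht.2)

lemma shift (h : IsSmoothSolution T w₀ w) (h0 : IsTest w₀) {c : ℝ} (hc : 0 ≤ c) :
    IsSmoothSolution (T - c) (w c) fun s => w (s + c) := by
  refine of_solvesAt (by simp) fun t ht => ?_
  have hsol : SolvesAt (Ico 0 T) w (t - -c) := by
    rw [sub_neg_eq_add]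
    exact h.solvesAt h0 ⟨add_nonneg ht.1 hc, by linarith [ht.2]⟩
  have := hsol.comp_sub (S' := Ico 0 (T - c)) fun s hs =>
    ⟨by linarith [hs.1], by linarith [hs.2]⟩
  simpa only [sub_neg_eq_add] using this

/-- A solution can be continued past `t₀` for a time controlled by the `L¹` norm of its Fourier
transform at `t₀`. -/
lemma exists_extension (h : IsSmoothSolution T w₀ w) (h0 : IsTest w₀) {t₀ ρ : ℝ}
    (ht₀ : t₀ ∈ Ico 0 T) (hρ : ρ * wnorm 0 0 (w t₀) ≤ 1) :
    ∃ v, IsSmoothSolution (t₀ + ρ) w₀ v := by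
  classical
  rcases le_or_gt (t₀ + ρ) T with hle | hlt
  · exact ⟨w, h.mono h0 hle⟩
  set u := w t₀
  have hu : IsTest u := h.isTest h0 ht₀
  have hloc := taylorSol hu hρ
  -- Uniqueness makes the two pieces agree on the whole overlap `[t₀, T)`, so the glued function is
  -- locally one of them, also around `T`.
  have hagree : ∀ t ∈ Ico t₀ T, w t = _root_.taylorSol u (t - t₀) := by
    intro t ht
    have h1 := h.shift h0 ht₀.1
    have h2 := hloc.mono hu (T' := T - t₀) (by linarith)
    have := h1.unique h2 hu (b := t - t₀) ⟨by linarith [ht.1], by linarith [ht.2]⟩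
    simpa using this
  set v : ℝ → Plane → ℝ := fun t => if t < T then w t else _root_.taylorSol u (t - t₀) with hv
  have hvw : ∀ t < T, v t = w t := fun t ht => by simp [hv, ht]
  have hvt : ∀ t ≥ t₀, v t = _root_.taylorSol u (t - t₀) := by
    intro t ht
    by_cases htT : t < T
    · rw [hvw t htT, hagree t ⟨ht, htT⟩]
    · simp [hv, htT]
  refine ⟨v, of_solvesAt ?_ fun t ht => ?_⟩
  · rw [hvw 0 (ht₀.1.trans_lt ht₀.2), h.initial]
  rcases lt_or_ge t T with htT | htT
  · refine (h.solvesAt h0 ⟨ht.1, htT⟩).congr ?_ ?_ (hvw t htT)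
    · refine Filter.mem_of_superset (Filter.inter_mem self_mem_nhdsWithin
        (mem_nhdsWithin_of_mem_nhds (Iio_mem_nhds htT))) fun s hs => ⟨hs.1.1, hs.2⟩
    · exact mem_nhdsWithin_of_mem_nhds (Filter.mem_of_superset (Iio_mem_nhds htT) hvw)
  · have htt : t₀ < t := ht₀.2.trans_le htT
    have hρ' : |t - t₀| < ρ := by rw [abs_of_pos (by linarith)]; linarith [ht.2]
    have hsol := (solvesAt_taylorSol hu hρ hρ').comp_sub (S' := Ioo (t₀ - ρ) (t₀ + ρ))
      fun s hs => ⟨by linarith [hs.1], by linarith [hs.2]⟩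
    refine hsol.congr ?_ ?_ (hvt t htt.le)
    · refine mem_nhdsWithin_of_mem_nhds (Ioo_mem_nhds ?_ ht.2)
      linarith [abs_lt.1 hρ']
    · exact mem_nhdsWithin_of_mem_nhds (Filter.mem_of_superset (Ioi_mem_nhds htt)
        fun s hs => hvt s (le_of_lt hs))

end IsSmoothSolution

/-! ### A bound for the `L¹` norm of the Fourier transform -/

/-- Three derivatives in `L¹` give decay of the transform like `‖ξ‖⁻³`, which is integrable at
infinity in the plane. -/
lemma exists_wnorm_le {K : Set Plane} (hK : IsCompact K) (M : ℝ) :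
    ∃ C, ∀ f, IsTest f → (∀ x ∉ K, f x = 0) →
      (∀ k ≤ 3, ∀ x ∈ K, ‖iteratedFDeriv ℝ k f x‖ ≤ M) → wnorm 0 0 f ≤ C := by
  set A := M * volume.real K
  have hrp : Integrable (fun ξ : Plane => (1 + ‖ξ‖) ^ (-(3 : ℝ))) :=
    integrable_one_add_norm (by simp; norm_num)
  -- `A` bounds the transform itself; `8 * (4 * A)` bounds `‖ξ‖ ^ 3` times it, with `2 ^ 3` from the
  -- decay estimate and four orders of derivatives; the outer `4` is from `(1 + s) ^ 3 ≤ 4 * (1 + s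
  -- ^ 3)`.
  refine ⟨∫ ξ : Plane, (4 * (A + 8 * (4 * A))) * (1 + ‖ξ‖) ^ (-(3 : ℝ)), fun f hf hsupp hM => ?_⟩
  have hcl : IsClosed K := hK.isClosed
  have hts : tsupport f ⊆ K :=
    closure_minimal (fun x hx => by_contra fun hxK => hx (hsupp x hxK)) hcl
  have hfc := hf.smooth_complex
  have hnorm : ∀ k x, ‖iteratedFDeriv ℝ k (fun x => (f x : ℂ)) x‖ = ‖iteratedFDeriv ℝ k f x‖ :=
    fun k x => LinearIsometry.norm_iteratedFDeriv_comp_left (n := ∞) Complex.ofRealLI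
      hf.smooth.contDiffAt (mod_cast le_top)
  have hIntegrable : ∀ k ≤ 3, ∫ x, ‖iteratedFDeriv ℝ k (fun x => (f x : ℂ)) x‖ ≤ A := by
    intro k hk
    simp only [hnorm]
    rw [← setIntegral_eq_integral_of_forall_compl_eq_zero (s := K)]
    · calc ∫ x in K, ‖iteratedFDeriv ℝ k f x‖ ≤ ∫ x in K, M := by
            refine setIntegral_mono_on ?_ (integrableOn_const hK.measure_lt_top.ne)
              hK.measurableSet fun x hx => hM k hk x hx
            exact ((hf.smooth.of_le (mod_cast le_top)).continuous_iteratedFDeriv'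
              (m := k)).norm.continuousOn.integrableOn_compact hK
        _ = A := by simp [A, mul_comm]
    · intro x hx
      rw [norm_eq_zero]
      exact Function.notMem_support.1 fun h => hx (hts (support_iteratedFDeriv_subset k h))
  have hdecay : ∀ n ≤ 3, ∀ ξ, ‖ξ‖ ^ n * ‖realFourier f ξ‖ ≤
      2 ^ n * ∑ k ∈ Finset.range (n + 1), ∫ x, ‖iteratedFDeriv ℝ k (fun x => (f x : ℂ)) x‖ := by
    intro n hn ξ
    have := Real.pow_mul_norm_iteratedFDeriv_fourier_le (f := fun x => (f x : ℂ)) (K := 0) (N := ⊤)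
      hfc (fun k n _ _ => hf.schwartz.integrable_pow_mul_iteratedFDeriv volume k n) (k := 0) (n := n)
      le_rfl le_top ξ
    simpa [realFourier, Finset.sum_product] using this
  have h0 : ∀ ξ, ‖realFourier f ξ‖ ≤ A := by
    intro ξ
    have := hdecay 0 (by norm_num) ξ
    simp only [pow_zero, one_mul, zero_add, Finset.range_one, Finset.sum_singleton] at this
    exact this.trans (hIntegrable 0 (by norm_num))
  have h3 : ∀ ξ, ‖ξ‖ ^ 3 * ‖realFourier f ξ‖ ≤ 8 * (4 * A) := by
    intro ξ
    refine (hdecay 3 le_rfl ξ).trans ?_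
    have : ∑ k ∈ Finset.range (3 + 1), ∫ x, ‖iteratedFDeriv ℝ k (fun x => (f x : ℂ)) x‖ ≤
        ∑ k ∈ Finset.range (3 + 1), A :=
      Finset.sum_le_sum fun k hk => hIntegrable k (by rw [Finset.mem_range] at hk; omega)
    rw [Finset.sum_const, Finset.card_range, nsmul_eq_mul] at this
    push_cast at this
    linarith
  rw [← integral_norm_realFourier_eq]
  refine integral_mono hf.integrable_realFourier.norm (hrp.const_mul _) fun ξ => ?_
  have hpos : 0 < 1 + ‖ξ‖ := by positivity
  have e : (1 + ‖ξ‖) ^ (-(3 : ℝ)) = ((1 + ‖ξ‖) ^ 3)⁻¹ := by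
    rw [Real.rpow_neg hpos.le]
    norm_cast
  dsimp only
  rw [e, ← div_eq_mul_inv, le_div_iff₀ (by positivity)]
  have hs : (1 + ‖ξ‖) ^ 3 ≤ 4 * (1 + ‖ξ‖ ^ 3) := by
    nlinarith [sq_nonneg (‖ξ‖ - 1), norm_nonneg ξ, mul_nonneg (norm_nonneg ξ) (sq_nonneg (‖ξ‖ - 1))]
  calc ‖realFourier f ξ‖ * (1 + ‖ξ‖) ^ 3 ≤ ‖realFourier f ξ‖ * (4 * (1 + ‖ξ‖ ^ 3)) := by gcongr
    _ = 4 * (‖realFourier f ξ‖ + ‖ξ‖ ^ 3 * ‖realFourier f ξ‖) := by ring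
    _ ≤ _ := mul_le_mul_of_nonneg_left (add_le_add (h0 ξ) (h3 ξ)) (by norm_num)

/-- Spatial derivatives remain jointly continuous up to the final time, hence bounded on compact
sets of `[0, T] × ℝ²`. -/
lemma contDiffOn_iteratedFDeriv_slice {F : Type} [NormedAddCommGroup F] [NormedSpace ℝ F]
    {S : Set ℝ} {W : ℝ × Plane → F} (hW : ContDiffOn ℝ ∞ W (S ×ˢ univ)) (k : ℕ) :
    ContDiffOn ℝ ∞ (fun p : ℝ × Plane => iteratedFDeriv ℝ k (fun y => W (p.1, y)) p.2)
      (S ×ˢ univ) := by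
  induction k with
  | zero =>
    simp only [iteratedFDeriv_zero_eq_comp]
    exact (LinearIsometryEquiv.contDiff _).comp_contDiffOn hW
  | succ k ih =>
    simp only [iteratedFDeriv_succ_eq_comp_left, Function.comp_def]
    have hcurry : ContDiff ℝ ∞ (continuousMultilinearCurryLeftEquiv ℝ
        (fun _ : Fin (k + 1) => Plane) F).symm :=
      LinearIsometryEquiv.contDiff (𝕜 := ℝ) (E := Plane →L[ℝ] (Plane [×k]→L[ℝ] F))
        (F := Plane [×(k + 1)]→L[ℝ] F) _
    refine hcurry.comp_contDiffOn fun p hp => ?_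
    have h1 := ContDiffWithinAt.fderivWithin (𝕜 := ℝ) (s := S ×ˢ (univ : Set Plane)) (x₀ := p)
      (f := fun (q : ℝ × Plane) y => iteratedFDeriv ℝ k (fun y => W (q.1, y)) y) (g := Prod.snd)
      (t := univ) (m := ∞) (n := ∞) ?_ contDiffWithinAt_snd uniqueDiffOn_univ (by simp) hp
      (fun _ _ => mem_univ _)
    · simpa only [fderivWithin_univ] using h1
    · exact (ih (p.1, p.2) ⟨hp.1, mem_univ _⟩).comp (p, p.2)
        (f := fun q : (ℝ × Plane) × Plane => (q.1.1, q.2)) (by fun_prop)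
        fun q hq => ⟨hq.1.1, mem_univ _⟩

/-! ### The maximal solution -/

/-- If the lifespans of the smooth solutions with initial datum `w₀` are bounded, then there is a
maximal smooth solution, and it does not extend smoothly to its final time. -/
theorem exists_maximal_solution {w₀ : Plane → ℝ} (h0 : IsTest w₀) {B : ℝ}
    (hB : ∀ T v, IsSmoothSolution T w₀ v → T ≤ B) :
    ∃ (T : ℝ) (w : ℝ → Plane → ℝ), 0 < T ∧ IsSmoothSolution T w₀ w ∧
      (∀ (T' : ℝ) (v : ℝ → Plane → ℝ), IsSmoothSolution T' w₀ v →
        T' ≤ T ∧ ∀ t ∈ Ico 0 T', v t = w t) ∧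
      ¬ ∃ W : ℝ × Plane → ℝ, ContDiffOn ℝ ∞ W (Icc 0 T ×ˢ univ) ∧
        ∀ t ∈ Ico 0 T, ∀ x, W (t, x) = w t x := by
  classical
  set L : Set ℝ := {T | ∃ v, IsSmoothSolution T w₀ v} with hL
  have hbdd : BddAbove L := ⟨B, fun T hT => hB T _ hT.choose_spec⟩
  have hn0 : 0 ≤ wnorm 0 0 w₀ := wnorm_nonneg 0 le_rfl w₀
  have hloc : (1 + wnorm 0 0 w₀)⁻¹ ∈ L := ⟨_, IsSmoothSolution.taylorSol h0 (by
    rw [inv_mul_le_iff₀ (by positivity)]; linarith)⟩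
  set T := sSup L
  have hTle : ∀ T' ∈ L, T' ≤ T := fun T' hT' => le_csSup hbdd hT'
  have hTpos : 0 < T := lt_of_lt_of_le (by positivity) (hTle _ hloc)
  have hex : ∀ t < T, ∃ T' v, t < T' ∧ IsSmoothSolution T' w₀ v := by
    intro t ht
    obtain ⟨T', ⟨v, hv⟩, htT'⟩ := exists_lt_of_lt_csSup ⟨_, hloc⟩ ht
    exact ⟨T', v, htT', hv⟩
  choose! τ V hτ hV using hex
  -- `V t` is a chosen solution that lives past `t`; by uniqueness the diagonal agrees with every
  -- solution.
  set w : ℝ → Plane → ℝ := fun t => V t t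
  have hagree : ∀ T' v, IsSmoothSolution T' w₀ v → ∀ t ∈ Ico 0 T', v t = w t := by
    intro T' v hv t ht
    have htT : t < T := ht.2.trans_le (hTle T' ⟨v, hv⟩)
    exact (hv.mono h0 (min_le_left T' (τ t))).unique
      ((hV t htT).mono h0 (min_le_right _ _)) h0 ⟨ht.1, lt_min ht.2 (hτ t htT)⟩
  have hw : IsSmoothSolution T w₀ w := by
    refine IsSmoothSolution.of_solvesAt (hV 0 hTpos).initial fun t ht => ?_
    have hVt := hV t ht.2
    have hmem : Ico 0 (τ t) ∈ nhdsWithin t (Ico 0 T) :=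
      Filter.mem_of_superset (Filter.inter_mem self_mem_nhdsWithin
        (mem_nhdsWithin_of_mem_nhds (Iio_mem_nhds (hτ t ht.2)))) fun s hs => ⟨hs.1.1, hs.2⟩
    refine (hVt.solvesAt h0 ⟨ht.1, hτ t ht.2⟩).congr hmem ?_ rfl
    filter_upwards [hmem] with s hs
    exact (hagree _ _ hVt s hs).symm
  refine ⟨T, w, hTpos, hw, fun T' v hv => ⟨hTle T' ⟨v, hv⟩, hagree T' v hv⟩, ?_⟩
  rintro ⟨W, hW, hWw⟩
  have hK : IsCompact (tsupport w₀) := h0.compact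
  have hbound : ∀ k : ℕ, ∃ M, ∀ p ∈ Icc 0 T ×ˢ tsupport w₀,
      ‖iteratedFDeriv ℝ k (fun y => W (p.1, y)) p.2‖ ≤ M := fun k =>
    (isCompact_Icc.prod hK).exists_bound_of_continuousOn
      ((contDiffOn_iteratedFDeriv_slice hW k).continuousOn.mono (prod_mono subset_rfl (subset_univ _)))
  choose M hM using hbound
  obtain ⟨C, hC⟩ := exists_wnorm_le hK (∑ k ∈ Finset.range 4, |M k|)
  have hwC : ∀ t ∈ Ico 0 T, wnorm 0 0 (w t) ≤ C := by
    intro t ht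
    refine hC _ (hw.isTest h0 ht) (fun x hx => hw.eq_zero ht (image_eq_zero_of_notMem_tsupport hx))
      fun k hk x hx => ?_
    have e : w t = fun y => W (t, y) := funext fun y => (hWw t ht y).symm
    rw [e]
    refine (hM k (t, x) ⟨Ico_subset_Icc_self ht, hx⟩).trans ((le_abs_self _).trans ?_)
    exact Finset.single_le_sum (f := fun k => |M k|) (fun _ _ => abs_nonneg _)
      (Finset.mem_range.2 (by omega))
  set D := max C 0 + 1
  have hD : 0 < D := by positivity
  -- From every time before `T` the solution continues for a time `D⁻¹`; starting closer than that
  -- to `T` gives a solution beyond the supremum of all lifespans.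
  obtain ⟨t₀, ht₀, ht₀T⟩ := exists_between (max_lt hTpos (sub_lt_self T (inv_pos.2 hD)))
  have ht₀0 : 0 ≤ t₀ := (le_max_left _ _).trans ht₀.le
  have ht₀D : T - D⁻¹ < t₀ := (le_max_right _ _).trans_lt ht₀
  have hρ : D⁻¹ * wnorm 0 0 (w t₀) ≤ 1 := by
    rw [inv_mul_le_iff₀ hD, mul_one]
    exact (hwC t₀ ⟨ht₀0, ht₀T⟩).trans ((le_max_left C 0).trans (by simp [D]))
  have := hTle _ (hw.exists_extension h0 ⟨ht₀0, ht₀T⟩ hρ)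
  linarith

end

noncomputable section

/-! ### Partial derivatives and `R₁²` -/

/-- The partial derivative in the direction of the `i`-th coordinate. -/
def partialDeriv (i : Fin 2) (f : Plane → ℝ) (x : Plane) : ℝ :=
  fderiv ℝ f x (EuclideanSpace.single i 1)

namespace IsTest

variable {f g : Plane → ℝ}

lemma partialDeriv (hf : IsTest f) (i : Fin 2) : IsTest (partialDeriv i f) where
  smooth := (hf.smooth.fderiv_right (m := ∞) (by simp)).clm_apply contDiff_const
  compact := (hf.compact.fderiv (𝕜 := ℝ)).comp_left
    (g := fun L : Plane →L[ℝ] ℝ => L (EuclideanSpace.single i 1)) rfl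

open LineDeriv in
lemma realFourier_partialDeriv (hf : IsTest f) (i : Fin 2) (ξ : Plane) :
    realFourier (_root_.partialDeriv i f) ξ =
      2 * Real.pi * Complex.I * ((ξ i : ℝ) : ℂ) * realFourier f ξ := by
  have e : (hf.partialDeriv i).schwartz =
      ∂_{(EuclideanSpace.single i (1 : ℝ) : Plane)} hf.schwartz := by
    ext x
    rw [SchwartzMap.lineDerivOp_apply_eq_fderiv]
    have h1 : HasFDerivAt (hf.schwartz : Plane → ℂ) (Complex.ofRealCLM.comp (fderiv ℝ f x)) x :=
      Complex.ofRealCLM.hasFDerivAt.comp x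
        ((hf.smooth.differentiable (by simp)) x).hasFDerivAt
    rw [h1.fderiv]
    rfl
  have key := congrArg (fun h : SchwartzMap Plane ℂ => h ξ)
    (SchwartzMap.fourier_lineDerivOp_eq hf.schwartz (EuclideanSpace.single i (1 : ℝ) : Plane))
  have hg : (fun x : Plane => inner ℝ x (EuclideanSpace.single i (1 : ℝ))).HasTemperateGrowth := by
    fun_prop
  simp only [smul_apply, SchwartzMap.smulLeftCLM_apply_apply hg] at key
  rw [(hf.partialDeriv i).realFourier_eq, hf.realFourier_eq, e, key]
  simp [EuclideanSpace.inner_single_right]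
  ring

/-- On the Fourier side `symbolSq ξ * ‖ξ‖ ^ 2 = -(ξ 0) ^ 2`. Through this identity `R₁²` of a radial
density is found without any singular integral. -/
lemma rieszSq_laplacian (hf : IsTest f) (x : Plane) :
    rieszSq (fun x => _root_.partialDeriv 0 (_root_.partialDeriv 0 f) x +
      _root_.partialDeriv 1 (_root_.partialDeriv 1 f) x) x =
      -_root_.partialDeriv 0 (_root_.partialDeriv 0 f) x := by
  have h0 := (hf.partialDeriv 0).partialDeriv 0
  have h1 := (hf.partialDeriv 1).partialDeriv 1
  have h2 := h0.const_mul (-1)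
  have e : ((rieszSq (fun x => _root_.partialDeriv 0 (_root_.partialDeriv 0 f) x +
      _root_.partialDeriv 1 (_root_.partialDeriv 1 f) x) x : ℝ) : ℂ) =
      ((-1 * _root_.partialDeriv 0 (_root_.partialDeriv 0 f) x : ℝ) : ℂ) := by
    rw [ofReal_rieszSq, ← h2.fourierInv_realFourier]
    refine congrArg (fun F : Plane → ℂ => 𝓕⁻ F x) (funext fun ξ => ?_)
    rw [h0.realFourier_add h1, realFourier_const_mul, (hf.partialDeriv 0).realFourier_partialDeriv,
      hf.realFourier_partialDeriv, (hf.partialDeriv 1).realFourier_partialDeriv,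
      hf.realFourier_partialDeriv]
    by_cases hξ : ξ = 0
    · simp [hξ]
    have hn : (‖ξ‖ ^ 2 : ℝ) ≠ 0 := by positivity
    have hs : symbolSq ξ * ((ξ 0) ^ 2 + (ξ 1) ^ 2) = -(ξ 0) ^ 2 := by
      have := EuclideanSpace.real_norm_sq_eq ξ
      rw [Fin.sum_univ_two] at this
      rw [← this, symbolSq, div_mul_cancel₀ _ hn]
    have hs' : (symbolSq ξ : ℂ) * (((ξ 0 : ℝ) : ℂ) ^ 2 + ((ξ 1 : ℝ) : ℂ) ^ 2) =
        -((ξ 0 : ℝ) : ℂ) ^ 2 := by exact_mod_cast hs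
    push_cast
    linear_combination (2 * Real.pi * Complex.I) ^ 2 * realFourier f ξ * hs'
  have := Complex.ofReal_injective e
  linarith

end IsTest

/-! ### Radial test functions -/

lemma plane_norm_sub_sq (x p : Plane) : ‖x - p‖ ^ 2 = (x 0 - p 0) ^ 2 + (x 1 - p 1) ^ 2 := by
  rw [EuclideanSpace.real_norm_sq_eq, Fin.sum_univ_two]
  rfl

lemma hasFDerivAt_norm_sub_sq (x p : Plane) :
    HasFDerivAt (fun x : Plane => ‖x - p‖ ^ 2) (2 • (innerSL ℝ (x - p))) x := by
  have := ((hasFDerivAt_id x).sub_const p).norm_sq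
  simpa using this

lemma contDiff_norm_sub_sq (p : Plane) : ContDiff ℝ ∞ fun x : Plane => ‖x - p‖ ^ 2 :=
  (contDiff_id.sub contDiff_const).norm_sq ℝ

lemma partialDeriv_radial {L : ℝ → ℝ} {l : ℝ} (p x : Plane) (i : Fin 2)
    (hL : HasDerivAt L l (‖x - p‖ ^ 2)) :
    partialDeriv i (fun x => L (‖x - p‖ ^ 2)) x = 2 * (x i - p i) * l := by
  have h := hL.comp_hasFDerivAt x (hasFDerivAt_norm_sub_sq x p)
  rw [partialDeriv, show (fun x => L (‖x - p‖ ^ 2)) = L ∘ fun x => ‖x - p‖ ^ 2 from rfl, h.fderiv]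
  simp [EuclideanSpace.inner_single_right]
  ring

lemma partialDeriv_mul_radial {h : ℝ → ℝ} {h' : ℝ} (p x : Plane) (i : Fin 2)
    (hh : HasDerivAt h h' (‖x - p‖ ^ 2)) :
    partialDeriv i (fun x => 2 * (x i - p i) * h (‖x - p‖ ^ 2)) x =
      2 * h (‖x - p‖ ^ 2) + 4 * (x i - p i) ^ 2 * h' := by
  have h1 := hh.comp_hasFDerivAt x (hasFDerivAt_norm_sub_sq x p)
  have h2 : HasFDerivAt (fun x : Plane => 2 * (x i - p i))
      ((2 : ℝ) • (EuclideanSpace.proj i : Plane →L[ℝ] ℝ)) x :=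
    (((EuclideanSpace.proj i : Plane →L[ℝ] ℝ).hasFDerivAt).sub_const (p i)).const_mul 2
  have h3 := h2.mul h1
  have h4 : HasFDerivAt (fun x : Plane => 2 * (x i - p i) * h (‖x - p‖ ^ 2)) _ x := h3
  rw [partialDeriv, h4.fderiv]
  simp [EuclideanSpace.inner_single_right]
  ring

/-- Duality for the logarithmic potential of a radial density, cut off at a large distance. -/
lemma integral_radial_mul_rieszSq_of_eq_zero {h : ℝ → ℝ} (hh : ContDiff ℝ ∞ h) {c : ℝ}
    (hc : ∀ s ≥ c, h s = 0) (p : Plane) {w : Plane → ℝ} (hw : IsTest w) :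
    ∫ x, 4 * (h (‖x - p‖ ^ 2) + ‖x - p‖ ^ 2 * deriv h (‖x - p‖ ^ 2)) * rieszSq w x =
      -∫ x, (2 * h (‖x - p‖ ^ 2) + 4 * (x 0 - p 0) ^ 2 * deriv h (‖x - p‖ ^ 2)) * w x := by
  -- The test function is `Ψ = L (‖x - p‖ ^ 2)`, compactly supported because `L` vanishes beyond
  -- `c`. Its Laplacian is `4 (h + s h')` and its second horizontal derivative is `2 h + 4 (x 0 - p
  -- 0) ^ 2 h'`, so symmetry of `R₁²` gives the claim.
  set L : ℝ → ℝ := fun s => ∫ u in c..s, h u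
  have hL : ∀ s, HasDerivAt L (h s) s := fun s =>
    (hh.continuous.integral_hasStrictDerivAt c s).hasDerivAt
  have hLd : deriv L = h := funext fun s => (hL s).deriv
  have hLs : ContDiff ℝ ∞ L := by
    rw [contDiff_infty_iff_deriv, hLd]
    exact ⟨fun s => (hL s).differentiableAt, hh⟩
  have hL0 : ∀ s ≥ c, L s = 0 := by
    intro s hs
    refine (intervalIntegral.integral_congr (g := fun _ => (0 : ℝ)) fun u hu => ?_).trans (by simp)
    rw [uIcc_of_le hs] at hu
    exact hc u hu.1
  have hΨ : IsTest fun x => L (‖x - p‖ ^ 2) := by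
    refine ⟨hLs.comp (contDiff_norm_sub_sq p), ?_⟩
    refine HasCompactSupport.of_support_subset_isCompact
      (isCompact_closedBall p (Real.sqrt |c|)) fun x hx => ?_
    rw [Metric.mem_closedBall, dist_eq_norm]
    by_contra hlt
    push Not at hlt
    refine hx (hL0 _ ?_)
    have h1 : Real.sqrt |c| ^ 2 ≤ ‖x - p‖ ^ 2 :=
      pow_le_pow_left₀ (Real.sqrt_nonneg _) hlt.le 2
    rw [Real.sq_sqrt (abs_nonneg c)] at h1
    exact (le_abs_self c).trans h1
  have hd : ∀ i : Fin 2, partialDeriv i (partialDeriv i fun x => L (‖x - p‖ ^ 2)) =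
      fun x => 2 * h (‖x - p‖ ^ 2) + 4 * (x i - p i) ^ 2 * deriv h (‖x - p‖ ^ 2) := by
    intro i
    have e : (partialDeriv i fun x => L (‖x - p‖ ^ 2)) =
        fun x => 2 * (x i - p i) * h (‖x - p‖ ^ 2) :=
      funext fun x => partialDeriv_radial p x i (hL _)
    rw [e]
    exact funext fun x => partialDeriv_mul_radial p x i
      ((hh.differentiable (by simp)) _).hasDerivAt
  have key := ((hΨ.partialDeriv 0).partialDeriv 0).add ((hΨ.partialDeriv 1).partialDeriv 1)
    |>.integral_mul_rieszSq hw
  simp only [hΨ.rieszSq_laplacian] at key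
  simp only [hd] at key
  rw [← integral_neg]
  refine Eq.trans (integral_congr_ae (ae_of_all _ fun x => ?_))
    (key.trans (integral_congr_ae (ae_of_all _ fun x => ?_)))
  · dsimp only
    rw [plane_norm_sub_sq]
    ring
  · dsimp only
    ring

/-- A smooth cutoff, equal to `1` on `(-∞, 1]` and to `0` on `[2, ∞)`. -/
def cutoff (s : ℝ) : ℝ := 1 - Real.smoothTransition (s - 1)

lemma contDiff_cutoff : ContDiff ℝ ∞ cutoff :=
  contDiff_const.sub (Real.smoothTransition.contDiff.comp (contDiff_id.sub contDiff_const))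

lemma cutoff_of_le {s : ℝ} (hs : s ≤ 1) : cutoff s = 1 := by
  rw [cutoff, Real.smoothTransition.zero_of_nonpos (by linarith), sub_zero]

lemma cutoff_of_ge {s : ℝ} (hs : 2 ≤ s) : cutoff s = 0 := by
  rw [cutoff, Real.smoothTransition.one_of_one_le (by linarith), sub_self]

lemma deriv_cutoff_of_lt {s : ℝ} (hs : s < 1) : deriv cutoff s = 0 := by
  have : cutoff =ᶠ[nhds s] fun _ => 1 :=
    Filter.mem_of_superset (Iio_mem_nhds hs) fun r hr => cutoff_of_le (le_of_lt hr)
  rw [this.deriv_eq, deriv_const]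

lemma deriv_cutoff_of_gt {s : ℝ} (hs : 2 < s) : deriv cutoff s = 0 := by
  have : cutoff =ᶠ[nhds s] fun _ => 0 :=
    Filter.mem_of_superset (Ioi_mem_nhds hs) fun r hr => cutoff_of_ge (le_of_lt hr)
  rw [this.deriv_eq, deriv_const]

lemma exists_abs_deriv_cutoff_le : ∃ C, 0 ≤ C ∧ ∀ s, |deriv cutoff s| ≤ C := by
  have hcont : Continuous (deriv cutoff) := contDiff_cutoff.continuous_deriv (by simp)
  obtain ⟨C, hC⟩ := isCompact_Icc (a := (1 : ℝ)) (b := 2) |>.exists_bound_of_continuousOn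
    hcont.continuousOn
  refine ⟨max C 0, le_max_right _ _, fun s => ?_⟩
  rcases lt_or_ge s 1 with h1 | h1
  · simp [deriv_cutoff_of_lt h1]
  rcases lt_or_ge 2 s with h2 | h2
  · simp [deriv_cutoff_of_gt h2]
  · exact (hC s ⟨h1, h2⟩).trans (le_max_left _ _)

/-- Duality for the logarithmic potential of a compactly supported radial density. -/
lemma integral_radial_mul_rieszSq {h : ℝ → ℝ} (hh : ContDiff ℝ ∞ h) {a : ℝ} (ha : 0 < a)
    (hinv : ∀ s ≥ a, s * h s = 1) (p : Plane) {w : Plane → ℝ} (hw : IsTest w) :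
    ∫ x, 4 * (h (‖x - p‖ ^ 2) + ‖x - p‖ ^ 2 * deriv h (‖x - p‖ ^ 2)) * rieszSq w x =
      -∫ x, (2 * h (‖x - p‖ ^ 2) + 4 * (x 0 - p 0) ^ 2 * deriv h (‖x - p‖ ^ 2)) * w x := by
  have hdh : Continuous (deriv h) := hh.continuous_deriv (by simp)
  have hh' := hh.continuous
  have hdiff : Differentiable ℝ h := hh.differentiable (by simp)
  -- Beyond `a` one has `h s = 1 / s`, so the primitive is a logarithm, which is harmonic in the
  -- plane.
  have hzero : ∀ s > a, h s + s * deriv h s = 0 := by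
    intro s hs
    have h1 : HasDerivAt (fun s => s * h s) (1 * h s + s * deriv h s) s :=
      (hasDerivAt_id s).mul (hdiff s).hasDerivAt
    have h2 : (fun s => s * h s) =ᶠ[nhds s] fun _ => 1 :=
      Filter.mem_of_superset (Ioi_mem_nhds hs) fun r hr => hinv r (le_of_lt hr)
    have h3 := h1.deriv
    rw [h2.deriv_eq, deriv_const] at h3
    linarith
  obtain ⟨C, hC0, hC⟩ := exists_abs_deriv_cutoff_le
  obtain ⟨ρ, hρ⟩ := hw.compact.isBounded.subset_closedBall p
  have hg2 : Integrable fun x => rieszSq w x ^ 2 := hw.memLp_rieszSq.integrable_sq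
  set V := volume.real (Metric.ball (0 : Plane) 1)
  set I := (∫ x, 4 * (h (‖x - p‖ ^ 2) + ‖x - p‖ ^ 2 * deriv h (‖x - p‖ ^ 2)) * rieszSq w x) +
      ∫ x, (2 * h (‖x - p‖ ^ 2) + 4 * (x 0 - p 0) ^ 2 * deriv h (‖x - p‖ ^ 2)) * w x with hI
  set Q := 8 * C ^ 2 * V + 2 * ∫ x, rieszSq w x ^ 2
  have hgc : Continuous (rieszSq w) := hw.contDiff_rieszSq.continuous
  -- Multiplying `h` by a cutoff at distance `R` adds to the density only a term of size `R⁻²` on an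
  -- annulus of area of order `R²`. Its `L²` norm is of order `R⁻¹`, and `rieszSq w` is in `L²`.
  have main : ∀ R : ℝ, 1 ≤ R → a ≤ R ^ 2 → |ρ| < R → |I| ≤ Q / R := by
    intro R hR haR hρR
    have hR0 : 0 < R := by linarith
    have hR2 : 0 < R ^ 2 := by positivity
    set θ : ℝ → ℝ := fun s => cutoff (s / R ^ 2) with hθ
    have hθs : ContDiff ℝ ∞ θ := contDiff_cutoff.comp (contDiff_id.div_const _)
    have hθd : ∀ s, HasDerivAt θ (deriv cutoff (s / R ^ 2) / R ^ 2) s := by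
      intro s
      have h1 := ((contDiff_cutoff.differentiable (by simp)) (s / R ^ 2)).hasDerivAt
      have := h1.comp s ((hasDerivAt_id s).div_const (R ^ 2))
      refine this.congr_deriv ?_
      ring
    have hprod : ∀ s, deriv (fun s => h s * θ s) s =
        deriv h s * θ s + h s * (deriv cutoff (s / R ^ 2) / R ^ 2) :=
      fun s => ((hdiff s).hasDerivAt.mul (hθd s)).deriv
    have hsh : ∀ s, h s * θ s + s * deriv (fun s => h s * θ s) s =
        (h s + s * deriv h s) + deriv cutoff (s / R ^ 2) / R ^ 2 := by
      intro s
      rw [hprod]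
      rcases le_or_gt s (R ^ 2) with hs | hs
      · have h1 : θ s = 1 := cutoff_of_le ((div_le_one hR2).2 hs)
        rw [h1]
        rcases hs.lt_or_eq with hs | hs
        · rw [deriv_cutoff_of_lt ((div_lt_one hR2).2 hs)]
          ring
        · linear_combination (deriv cutoff (s / R ^ 2) / R ^ 2) * hinv s (by rw [hs]; exact haR)
      · have h1 := hzero s (haR.trans_lt hs)
        linear_combination (θ s - 1) * h1 +
          (deriv cutoff (s / R ^ 2) / R ^ 2) * hinv s (haR.trans hs.le)
    have key := integral_radial_mul_rieszSq_of_eq_zero (hh.mul hθs) (c := 2 * R ^ 2)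
      (fun s hs => by
        have : θ s = 0 := cutoff_of_ge ((le_div_iff₀ hR2).2 hs)
        simp [this]) p hw
    simp only [hsh] at key
    have hright : ∫ x, (2 * (h (‖x - p‖ ^ 2) * θ (‖x - p‖ ^ 2)) + 4 * (x 0 - p 0) ^ 2 *
          deriv (fun s => h s * θ s) (‖x - p‖ ^ 2)) * w x =
        ∫ x, (2 * h (‖x - p‖ ^ 2) + 4 * (x 0 - p 0) ^ 2 * deriv h (‖x - p‖ ^ 2)) * w x := by
      refine integral_congr_ae (ae_of_all _ fun x => ?_)
      dsimp only
      by_cases hx : x ∈ tsupport w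
      · have h1 : ‖x - p‖ ≤ |ρ| := by
          have := hρ hx
          rw [Metric.mem_closedBall, dist_eq_norm] at this
          exact this.trans (le_abs_self ρ)
        have h2 : ‖x - p‖ ^ 2 < R ^ 2 :=
          pow_lt_pow_left₀ (h1.trans_lt hρR) (norm_nonneg _) two_ne_zero
        have h3 : ‖x - p‖ ^ 2 / R ^ 2 < 1 := (div_lt_one hR2).2 h2
        rw [hprod, deriv_cutoff_of_lt h3, show θ (‖x - p‖ ^ 2) = 1 from cutoff_of_le h3.le]
        ring
      · rw [image_eq_zero_of_notMem_tsupport hx]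
        ring
    have hcs : ∀ (F : ℝ → ℝ) (b : ℝ), (∀ s > b, F s = 0) →
        HasCompactSupport fun x : Plane => F (‖x - p‖ ^ 2) := by
      intro F b hF
      refine HasCompactSupport.of_support_subset_isCompact
        (isCompact_closedBall p (Real.sqrt |b|)) fun x hx => ?_
      rw [Metric.mem_closedBall, dist_eq_norm]
      by_contra hlt
      push Not at hlt
      refine hx (hF _ ?_)
      have h1 : Real.sqrt |b| ^ 2 < ‖x - p‖ ^ 2 :=
        pow_lt_pow_left₀ hlt (Real.sqrt_nonneg _) two_ne_zero
      rw [Real.sq_sqrt (abs_nonneg b)] at h1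
      exact (le_abs_self b).trans_lt h1
    have hdc : Continuous (deriv cutoff) := contDiff_cutoff.continuous_deriv (by simp)
    have i1 : Integrable fun x => 4 * (h (‖x - p‖ ^ 2) + ‖x - p‖ ^ 2 * deriv h (‖x - p‖ ^ 2)) *
        rieszSq w x := by
      refine Continuous.integrable_of_hasCompactSupport (by fun_prop) ?_
      exact ((hcs (fun s => h s + s * deriv h s) a hzero).mul_left).mul_right
    have hcs2 : HasCompactSupport fun x : Plane => deriv cutoff (‖x - p‖ ^ 2 / R ^ 2) / R ^ 2 := by
      refine hcs (fun s => deriv cutoff (s / R ^ 2) / R ^ 2) (2 * R ^ 2) fun s hs => ?_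
      rw [deriv_cutoff_of_gt ((lt_div_iff₀ hR2).2 hs), zero_div]
    have i2 : Integrable fun x => 4 * (deriv cutoff (‖x - p‖ ^ 2 / R ^ 2) / R ^ 2) *
        rieszSq w x :=
      Continuous.integrable_of_hasCompactSupport (by fun_prop) hcs2.mul_left.mul_right
    have hIeq : I = -∫ x, 4 * (deriv cutoff (‖x - p‖ ^ 2 / R ^ 2) / R ^ 2) * rieszSq w x := by
      rw [hI, ← hright, ← neg_eq_iff_eq_neg.2 key]
      have hsplit := integral_add i1 i2
      simp only [← add_mul, ← mul_add] at hsplit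
      rw [hsplit]
      ring
    rw [hIeq, abs_neg]
    have i3 : Integrable ((Metric.closedBall p (2 * R)).indicator fun _ : Plane =>
        2 * R * (C / R ^ 2) ^ 2) :=
      (integrable_indicator_iff measurableSet_closedBall).2
        (integrableOn_const (isCompact_closedBall p (2 * R)).measure_lt_top.ne)
    have hpt : ∀ x, |4 * (deriv cutoff (‖x - p‖ ^ 2 / R ^ 2) / R ^ 2) * rieszSq w x| ≤
        (Metric.closedBall p (2 * R)).indicator (fun _ => 2 * R * (C / R ^ 2) ^ 2) x +
          2 / R * rieszSq w x ^ 2 := by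
      intro x
      set D := deriv cutoff (‖x - p‖ ^ 2 / R ^ 2) / R ^ 2 with hD
      -- Young's inequality with weight `R`, which makes both resulting integrals of order `1 / R`.
      have h1 : |4 * D * rieszSq w x| ≤ 2 * R * D ^ 2 + 2 / R * rieszSq w x ^ 2 := by
        have e1 : 2 * R * D ^ 2 + 2 / R * rieszSq w x ^ 2 - 4 * D * rieszSq w x =
            2 / R * (R * D - rieszSq w x) ^ 2 := by field_simp; ring
        have e2 : 2 * R * D ^ 2 + 2 / R * rieszSq w x ^ 2 + 4 * D * rieszSq w x =
            2 / R * (R * D + rieszSq w x) ^ 2 := by field_simp; ring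
        have n1 : 0 ≤ 2 / R * (R * D - rieszSq w x) ^ 2 := by positivity
        have n2 : 0 ≤ 2 / R * (R * D + rieszSq w x) ^ 2 := by positivity
        rw [abs_le]
        constructor <;> linarith
      refine h1.trans (add_le_add_left ?_ _)
      by_cases hx : x ∈ Metric.closedBall p (2 * R)
      · rw [indicator_of_mem hx]
        have : |D| ≤ C / R ^ 2 := by
          rw [hD, abs_div, abs_of_pos hR2]
          gcongr
          exact hC _
        have h2 : D ^ 2 ≤ (C / R ^ 2) ^ 2 := by
          rw [← sq_abs D]
          gcongr
        gcongr
      · rw [indicator_of_notMem hx]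
        rw [Metric.mem_closedBall, dist_eq_norm, not_le] at hx
        have h2 : (2 * R) ^ 2 < ‖x - p‖ ^ 2 := pow_lt_pow_left₀ hx (by positivity) two_ne_zero
        have h3 : D = 0 := by
          rw [hD, deriv_cutoff_of_gt ((lt_div_iff₀ hR2).2 (by nlinarith)), zero_div]
        simp [h3]
    calc |∫ x, 4 * (deriv cutoff (‖x - p‖ ^ 2 / R ^ 2) / R ^ 2) * rieszSq w x|
        ≤ ∫ x, |4 * (deriv cutoff (‖x - p‖ ^ 2 / R ^ 2) / R ^ 2) * rieszSq w x| :=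
          abs_integral_le_integral_abs
      _ ≤ ∫ x, ((Metric.closedBall p (2 * R)).indicator (fun _ => 2 * R * (C / R ^ 2) ^ 2) x +
          2 / R * rieszSq w x ^ 2) := integral_mono i2.abs (i3.add (hg2.const_mul _)) hpt
      _ = 2 * R * (C / R ^ 2) ^ 2 * ((2 * R) ^ 2 * V) + 2 / R * ∫ x, rieszSq w x ^ 2 := by
          rw [integral_add i3 (hg2.const_mul _), integral_const_mul,
            integral_indicator measurableSet_closedBall, setIntegral_const]
          rw [Measure.addHaar_real_closedBall _ _ (by positivity)]
          simp [V, mul_comm]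
      _ ≤ Q / R := by
          have hV : 0 ≤ V := measureReal_nonneg
          have e : 2 * R * (C / R ^ 2) ^ 2 * ((2 * R) ^ 2 * V) = 8 * C ^ 2 * V / R := by
            field_simp; ring
          rw [e, le_div_iff₀ hR0, add_mul, div_mul_cancel₀ _ hR0.ne']
          simp only [Q]
          have e2 : 2 / R * (∫ x, rieszSq w x ^ 2) * R = 2 * ∫ x, rieszSq w x ^ 2 := by
            field_simp
          rw [e2]

  have hlim : Filter.Tendsto (fun R : ℝ => Q / R) Filter.atTop (nhds 0) :=
    Filter.Tendsto.div_atTop tendsto_const_nhds Filter.tendsto_id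
  have hle : |I| ≤ 0 := by
    refine ge_of_tendsto hlim ?_
    filter_upwards [Filter.eventually_ge_atTop 1, Filter.eventually_ge_atTop a,
      Filter.eventually_gt_atTop |ρ|] with R h1 h2 h3
    exact main R h1 (by nlinarith) h3
  have hI0 : I = 0 := abs_nonpos_iff.1 hle
  rw [hI] at hI0
  linarith

end

noncomputable section

/-! ### Radial densities and their `R₁²`-potentials -/

/-- A smooth monotone step, equal to `0` on `(-∞, 1/2]` and to `1` on `[1, ∞)`. -/
def smoothStep (s : ℝ) : ℝ := Real.smoothTransition (2 * s - 1)

lemma contDiff_smoothStep : ContDiff ℝ ∞ smoothStep :=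
  Real.smoothTransition.contDiff.comp ((contDiff_const.mul contDiff_id).sub contDiff_const)

lemma smoothStep_of_le {s : ℝ} (hs : s ≤ 1 / 2) : smoothStep s = 0 :=
  Real.smoothTransition.zero_of_nonpos (by linarith)

lemma smoothStep_of_ge {s : ℝ} (hs : 1 ≤ s) : smoothStep s = 1 :=
  Real.smoothTransition.one_of_one_le (by linarith)

lemma monotone_smoothStep : Monotone smoothStep := fun _ _ h =>
  Real.smoothTransition.monotone (by linarith)

lemma deriv_smoothStep_nonneg (s : ℝ) : 0 ≤ deriv smoothStep s := monotone_smoothStep.deriv_nonneg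

lemma continuous_deriv_smoothStep : Continuous (deriv smoothStep) :=
  contDiff_smoothStep.continuous_deriv (by simp)

lemma deriv_smoothStep_of_gt {s : ℝ} (hs : 1 < s) : deriv smoothStep s = 0 := by
  have : smoothStep =ᶠ[nhds s] fun _ => 1 := by
    filter_upwards [Ioi_mem_nhds hs] with y hy using smoothStep_of_ge (le_of_lt hy)
  rw [this.deriv_eq, deriv_const]

lemma exists_deriv_smoothStep_le : ∃ C, 0 ≤ C ∧ ∀ s, 0 ≤ s → deriv smoothStep s ≤ C := by
  obtain ⟨C, hC⟩ := isCompact_Icc.exists_bound_of_continuousOn (s := Icc (0 : ℝ) 1)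
    continuous_deriv_smoothStep.continuousOn
  have hC0 : 0 ≤ C := (norm_nonneg _).trans (hC 0 ⟨le_rfl, zero_le_one⟩)
  refine ⟨C, hC0, fun s hs => ?_⟩
  rcases le_or_gt s 1 with h | h
  · exact (le_abs_self _).trans (hC s ⟨hs, h⟩)
  · rw [deriv_smoothStep_of_gt h]
    exact hC0

/-- The smooth function `smoothStep s / s`. -/
def stepQuotient (s : ℝ) : ℝ := smoothStep s / s

lemma contDiff_stepQuotient : ContDiff ℝ ∞ stepQuotient := by
  refine contDiff_iff_contDiffAt.2 fun s => ?_
  rcases lt_or_ge s (1 / 2) with h | h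
  · have : stepQuotient =ᶠ[nhds s] fun _ => 0 := by
      filter_upwards [Iio_mem_nhds h] with y hy
      rw [stepQuotient, smoothStep_of_le (le_of_lt hy), zero_div]
    exact contDiffAt_const.congr_of_eventuallyEq this
  · exact contDiff_smoothStep.contDiffAt.div contDiffAt_id (ne_of_gt (by linarith))

lemma mul_stepQuotient (s : ℝ) : s * stepQuotient s = smoothStep s := by
  rcases eq_or_ne s 0 with rfl | h
  · rw [zero_mul, smoothStep_of_le (by norm_num)]
  · rw [stepQuotient, mul_div_cancel₀ _ h]

lemma hasDerivAt_stepQuotient (s : ℝ) : HasDerivAt stepQuotient (deriv stepQuotient s) s :=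
  (contDiff_stepQuotient.differentiable (by simp) s).hasDerivAt

/-- With `h` a rescaled `stepQuotient`, the density `h + s h'` of the duality formula becomes the
nonnegative compactly supported bump in `density`. -/
lemma stepQuotient_add_mul_deriv (s : ℝ) :
    stepQuotient s + s * deriv stepQuotient s = deriv smoothStep s := by
  have h := (hasDerivAt_id s).mul (hasDerivAt_stepQuotient s)
  have e : id * stepQuotient = smoothStep := funext mul_stepQuotient
  rw [e] at h
  rw [h.deriv]
  simp

lemma abs_stepQuotient_le {s : ℝ} (hs : 0 ≤ s) : |stepQuotient s| ≤ 3 / (1 + s) := by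
  rcases le_or_gt s (1 / 2) with h | h
  · rw [stepQuotient, smoothStep_of_le h]
    simp only [zero_div, abs_zero]
    positivity
  · have h0 : 0 ≤ smoothStep s := Real.smoothTransition.nonneg _
    have h1 : smoothStep s ≤ 1 := Real.smoothTransition.le_one _
    rw [stepQuotient, abs_of_nonneg (by positivity), div_le_div_iff₀ (by linarith) (by linarith)]
    nlinarith

lemma deriv_stepQuotient_of_gt {s : ℝ} (hs : 1 < s) : deriv stepQuotient s = -1 / s ^ 2 := by
  have h := stepQuotient_add_mul_deriv s
  have h2 := mul_stepQuotient s
  rw [deriv_smoothStep_of_gt hs] at h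
  rw [smoothStep_of_ge hs.le] at h2
  have : s ≠ 0 := by linarith
  rw [eq_div_iff (by positivity)]
  linear_combination s * h - h2

lemma exists_abs_deriv_stepQuotient_le :
    ∃ C, 0 ≤ C ∧ ∀ s, 0 ≤ s → |deriv stepQuotient s| ≤ C / (1 + s) ^ 2 := by
  obtain ⟨K, hK⟩ := isCompact_Icc.exists_bound_of_continuousOn (s := Icc (0 : ℝ) 1)
    (contDiff_stepQuotient.continuous_deriv (by simp)).continuousOn
  have hK0 : 0 ≤ K := (norm_nonneg _).trans (hK 0 ⟨le_rfl, zero_le_one⟩)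
  refine ⟨4 * K + 4, by positivity, fun s hs => ?_⟩
  rw [le_div_iff₀ (by positivity)]
  rcases le_or_gt s 1 with h | h
  · have h1 : |deriv stepQuotient s| ≤ K := hK s ⟨hs, h⟩
    have h2 : (1 + s) ^ 2 ≤ 4 := by nlinarith
    calc |deriv stepQuotient s| * (1 + s) ^ 2 ≤ K * 4 := by gcongr
      _ ≤ 4 * K + 4 := by linarith
  · rw [deriv_stepQuotient_of_gt h, abs_div, abs_neg, abs_one, abs_of_nonneg (by positivity),
      div_mul_eq_mul_div, div_le_iff₀ (by positivity)]
    nlinarith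

/-- A smooth radial bump around `p`, supported in the ball of radius `r`, of total mass independent
of `p` and `r`. -/
def density (p : Plane) (r : ℝ) (x : Plane) : ℝ :=
  2 * deriv smoothStep (‖x - p‖ ^ 2 / r ^ 2) / r ^ 2

/-- The function `R₁² (density p r)`. -/
def potential (p : Plane) (r : ℝ) (x : Plane) : ℝ :=
  -(stepQuotient (‖x - p‖ ^ 2 / r ^ 2) / r ^ 2) -
    2 * (x 0 - p 0) ^ 2 * (deriv stepQuotient (‖x - p‖ ^ 2 / r ^ 2) / r ^ 4)

variable {p : Plane} {r : ℝ}

lemma continuous_density (p : Plane) (r : ℝ) : Continuous (density p r) := by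
  unfold density
  have := continuous_deriv_smoothStep
  fun_prop

lemma continuous_potential (p : Plane) (r : ℝ) : Continuous (potential p r) := by
  unfold potential
  have := contDiff_stepQuotient.continuous
  have := contDiff_stepQuotient.continuous_deriv (by simp)
  fun_prop

lemma density_nonneg (p : Plane) (r : ℝ) (x : Plane) : 0 ≤ density p r x := by
  have := deriv_smoothStep_nonneg (‖x - p‖ ^ 2 / r ^ 2)
  unfold density
  positivity

lemma density_of_lt (hr : 0 < r) {x : Plane} (hx : r < ‖x - p‖) : density p r x = 0 := by
  have : 1 < ‖x - p‖ ^ 2 / r ^ 2 := by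
    rw [one_lt_div (by positivity)]
    gcongr
  rw [density, deriv_smoothStep_of_gt this]
  simp

lemma hasCompactSupport_density (hr : 0 < r) (p : Plane) : HasCompactSupport (density p r) :=
  HasCompactSupport.intro (isCompact_closedBall p r) fun x hx =>
    density_of_lt hr (by simpa [dist_eq_norm] using hx)

lemma integrable_density (hr : 0 < r) (p : Plane) : Integrable (density p r) :=
  (continuous_density p r).integrable_of_hasCompactSupport (hasCompactSupport_density hr p)

lemma exists_density_le :
    ∃ C, 0 ≤ C ∧ ∀ p r x, 0 < r → density p r x ≤ C / (r ^ 2 + ‖x - p‖ ^ 2) := by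
  obtain ⟨C, hC, h⟩ := exists_deriv_smoothStep_le
  refine ⟨4 * C, by positivity, fun p r x hr => ?_⟩
  rcases le_or_gt ‖x - p‖ r with hx | hx
  · have h1 := h (‖x - p‖ ^ 2 / r ^ 2) (by positivity)
    have h2 : ‖x - p‖ ^ 2 ≤ r ^ 2 := by gcongr
    calc density p r x ≤ 2 * C / r ^ 2 := by unfold density; gcongr
      _ = 4 * C / (r ^ 2 + r ^ 2) := by field_simp; ring
      _ ≤ 4 * C / (r ^ 2 + ‖x - p‖ ^ 2) := by gcongr
  · rw [density_of_lt hr hx]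
    positivity

/-- The total mass of `density`. -/
def densityMass : ℝ := ∫ x, density 0 1 x

/-- The factor `r⁻²` in the density cancels the Jacobian of the dilation in the plane. -/
lemma integral_density (hr : 0 < r) (p : Plane) : ∫ x, density p r x = densityMass := by
  have e : ∀ x : Plane, density p r (x + p) = (r ^ 2)⁻¹ * density 0 1 (r⁻¹ • x) := fun x => by
    simp only [density, add_sub_cancel_right, sub_zero, norm_smul, norm_inv, Real.norm_eq_abs,
      abs_of_pos hr]
    rw [show (r⁻¹ * ‖x‖) ^ 2 / 1 ^ 2 = ‖x‖ ^ 2 / r ^ 2 by field_simp]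
    field_simp
  rw [← integral_add_right_eq_self _ p]
  simp_rw [e]
  rw [integral_const_mul, Measure.integral_comp_inv_smul_of_nonneg _ _ hr.le, densityMass]
  simp [finrank_euclideanSpace]
  field_simp

lemma densityMass_pos : 0 < densityMass := by
  obtain ⟨c, hc, h⟩ := exists_deriv_eq_slope smoothStep (a := 1 / 2) (b := 1) (by norm_num)
    contDiff_smoothStep.continuous.continuousOn
    (contDiff_smoothStep.differentiable (by simp)).differentiableOn
  rw [smoothStep_of_le le_rfl, smoothStep_of_ge le_rfl] at h
  refine (continuous_density 0 1).integral_pos_of_hasCompactSupport_nonneg_nonzero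
    (hasCompactSupport_density one_pos 0) (density_nonneg 0 1)
    (x := EuclideanSpace.single 0 (Real.sqrt c)) ?_
  have hc0 : 0 ≤ c := by linarith [hc.1]
  have : ‖(EuclideanSpace.single 0 (Real.sqrt c) : Plane) - 0‖ ^ 2 / 1 ^ 2 = c := by
    simp [Real.sq_sqrt hc0]
  rw [density, this, h]
  norm_num

/-- The duality for `h s = stepQuotient (s / r ^ 2) / r ^ 2`, divided by two: there the density `4
(h + s h')` is twice `density`. -/
lemma integral_density_mul_rieszSq (hr : 0 < r) (p : Plane) {w : Plane → ℝ} (hw : IsTest w) :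
    ∫ x, density p r x * rieszSq w x = ∫ x, potential p r x * w x := by
  have hd : ∀ s, HasDerivAt (fun s => stepQuotient (s / r ^ 2) / r ^ 2)
      (deriv stepQuotient (s / r ^ 2) / r ^ 4) s := fun s => by
    have := ((hasDerivAt_stepQuotient (s / r ^ 2)).comp s
      ((hasDerivAt_id s).div_const (r ^ 2))).div_const (r ^ 2)
    refine this.congr_deriv ?_
    field_simp
  have key := integral_radial_mul_rieszSq (h := fun s => stepQuotient (s / r ^ 2) / r ^ 2)
    ((contDiff_stepQuotient.comp (contDiff_id.div_const _)).div_const _) (a := r ^ 2)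
    (by positivity) (fun s hs => ?_) p hw
  · simp only [(hd _).deriv] at key
    have e1 : ∀ x : Plane, density p r x * rieszSq w x =
        1 / 2 * (4 * (stepQuotient (‖x - p‖ ^ 2 / r ^ 2) / r ^ 2 +
          ‖x - p‖ ^ 2 * (deriv stepQuotient (‖x - p‖ ^ 2 / r ^ 2) / r ^ 4)) * rieszSq w x) :=
      fun x => by
        rw [density, ← stepQuotient_add_mul_deriv]
        field_simp
        ring
    have e2 : ∀ x : Plane, potential p r x * w x =
        -(1 / 2) * ((2 * (stepQuotient (‖x - p‖ ^ 2 / r ^ 2) / r ^ 2) +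
          4 * (x 0 - p 0) ^ 2 * (deriv stepQuotient (‖x - p‖ ^ 2 / r ^ 2) / r ^ 4)) * w x) :=
      fun x => by
        rw [potential]
        ring
    simp_rw [e1, e2]
    rw [integral_const_mul, integral_const_mul, key]
    ring
  · have h1 : 1 ≤ s / r ^ 2 := (one_le_div (by positivity)).2 hs
    have h2 := mul_stepQuotient (s / r ^ 2)
    rw [smoothStep_of_ge h1] at h2
    rw [← h2]
    ring

/-- Outside its support a radial density acts like a point mass. What remains is the kernel of `R₁²`
up to a constant, nonnegative in the cone around the horizontal direction. -/
lemma potential_of_lt (hr : 0 < r) {x : Plane} (hx : r < ‖x - p‖) :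
    potential p r x = ((x 0 - p 0) ^ 2 - (x 1 - p 1) ^ 2) / ‖x - p‖ ^ 4 := by
  have h1 : 1 < ‖x - p‖ ^ 2 / r ^ 2 := by
    rw [one_lt_div (by positivity)]
    gcongr
  have h0 : 0 < ‖x - p‖ := hr.trans hx
  rw [potential, deriv_stepQuotient_of_gt h1, stepQuotient, smoothStep_of_ge h1.le,
    eq_sub_of_add_eq' (plane_norm_sub_sq x p).symm]
  field_simp
  ring

lemma exists_abs_potential_le :
    ∃ C, 0 ≤ C ∧ ∀ p r x, 0 < r → |potential p r x| ≤ C / (r ^ 2 + ‖x - p‖ ^ 2) := by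
  obtain ⟨C, hC, h⟩ := exists_abs_deriv_stepQuotient_le
  refine ⟨3 + 2 * C, by positivity, fun p r x hr => ?_⟩
  set s := ‖x - p‖ ^ 2 / r ^ 2 with hs
  have hs0 : 0 ≤ s := by positivity
  have e : ‖x - p‖ ^ 2 = s * r ^ 2 := by rw [hs]; field_simp
  have h0 : (x 0 - p 0) ^ 2 ≤ s * r ^ 2 := by
    rw [← e, plane_norm_sub_sq]
    nlinarith [sq_nonneg (x 1 - p 1)]
  have h1 : |stepQuotient s / r ^ 2| ≤ 3 / (1 + s) / r ^ 2 := by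
    rw [abs_div, abs_of_pos (by positivity : 0 < r ^ 2)]
    gcongr
    exact abs_stepQuotient_le hs0
  have h2 : |2 * (x 0 - p 0) ^ 2 * (deriv stepQuotient s / r ^ 4)| ≤
      2 * (s * r ^ 2) * (C / (1 + s) ^ 2 / r ^ 4) := by
    rw [abs_mul, abs_of_nonneg (by positivity : 0 ≤ 2 * (x 0 - p 0) ^ 2), abs_div,
      abs_of_pos (by positivity : 0 < r ^ 4)]
    gcongr
    exact h s hs0
  have h3 : 2 * (s * r ^ 2) * (C / (1 + s) ^ 2 / r ^ 4) ≤ 2 * C / (1 + s) / r ^ 2 := by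
    rw [show 2 * (s * r ^ 2) * (C / (1 + s) ^ 2 / r ^ 4) = 2 * C / (1 + s) / r ^ 2 * (s / (1 + s)) by
      field_simp]
    exact mul_le_of_le_one_right (by positivity) ((div_le_one (by positivity)).2 (by linarith))
  calc |potential p r x| ≤ |stepQuotient s / r ^ 2| +
        |2 * (x 0 - p 0) ^ 2 * (deriv stepQuotient s / r ^ 4)| := by
        rw [potential, ← hs]
        exact (abs_sub _ _).trans_eq (by rw [abs_neg])
    _ ≤ 3 / (1 + s) / r ^ 2 + 2 * C / (1 + s) / r ^ 2 := by linarith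
    _ = (3 + 2 * C) / (r ^ 2 + ‖x - p‖ ^ 2) := by
        rw [e]
        field_simp

end

noncomputable section

/-! ### The initial datum -/

/-- The dyadic scale `2⁻ʲ`. -/
def scale (j : ℕ) : ℝ := (1 / 2) ^ j

/-- The centre `(2⁻ʲ, 0)` of the `j`-th bump. -/
def bumpCenter (j : ℕ) : Plane := EuclideanSpace.single 0 (scale j)

/-- The radius of the plateau of the `j`-th bump. -/
def bumpRadius (j : ℕ) : ℝ := scale j / 20

/-- The smooth radial plateau function of unit size. -/
def unitBump (y : Plane) : ℝ := cutoff (‖y‖ ^ 2)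

/-- The `j`-th bump, of height `1 / j!`. -/
def bump (j : ℕ) (x : Plane) : ℝ :=
  (j.factorial : ℝ)⁻¹ * unitBump ((bumpRadius j)⁻¹ • (x - bumpCenter j))

/-- The initial datum: a sum of bumps accumulating at the origin along the horizontal axis. -/
def initialDatum (x : Plane) : ℝ := ∑' j, bump j x

variable {j k : ℕ} {x : Plane}

lemma scale_pos (j : ℕ) : 0 < scale j := by unfold scale; positivity

lemma scale_le_one (j : ℕ) : scale j ≤ 1 := pow_le_one₀ (by norm_num) (by norm_num)

lemma two_mul_scale_le (h : j < k) : 2 * scale k ≤ scale j := by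
  have h1 : scale k ≤ scale (j + 1) :=
    pow_le_pow_of_le_one (by norm_num) (by norm_num) (Nat.succ_le_of_lt h)
  have h2 : scale (j + 1) = scale j * (1 / 2) := pow_succ _ _
  linarith

lemma bumpRadius_pos (j : ℕ) : 0 < bumpRadius j := div_pos (scale_pos j) (by norm_num)

lemma norm_sub_bumpCenter_sq (j : ℕ) (x : Plane) :
    ‖x - bumpCenter j‖ ^ 2 = (x 0 - scale j) ^ 2 + x 1 ^ 2 := by
  rw [plane_norm_sub_sq]
  simp [bumpCenter]

/-- Membership in the ball which contains the support of the `k`-th bump. -/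
def NearBump (k : ℕ) (x : Plane) : Prop := ‖x - bumpCenter k‖ < 2 * bumpRadius k

lemma NearBump.abs_coord_lt (h : NearBump k x) :
    |x 0 - scale k| < scale k / 10 ∧ |x 1| < scale k / 10 := by
  have hs := scale_pos k
  have h1 : ‖x - bumpCenter k‖ ^ 2 < (scale k / 10) ^ 2 := by
    refine pow_lt_pow_left₀ (h.trans_eq ?_) (norm_nonneg _) two_ne_zero
    rw [bumpRadius]; ring
  rw [norm_sub_bumpCenter_sq] at h1
  exact ⟨abs_lt_of_sq_lt_sq (by nlinarith [sq_nonneg (x 1)]) (by positivity),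
    abs_lt_of_sq_lt_sq (by nlinarith [sq_nonneg (x 0 - scale k)]) (by positivity)⟩

lemma abs_sub_scale_le (j : ℕ) (x : Plane) : |x 0 - scale j| ≤ ‖x - bumpCenter j‖ := by
  refine abs_le_of_sq_le_sq ?_ (norm_nonneg _)
  rw [norm_sub_bumpCenter_sq]
  nlinarith [sq_nonneg (x 1)]

/-- Centres are separated dyadically while the balls have radius a tenth of their scale. Thus at
most one bump is active at a point. -/
lemma NearBump.two_mul_bumpRadius_lt (h : NearBump k x) (hj : j ≠ k) :
    2 * bumpRadius j < ‖x - bumpCenter j‖ := by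
  refine lt_of_lt_of_le ?_ (abs_sub_scale_le j x)
  have h0 := abs_lt.1 h.abs_coord_lt.1
  have hk := scale_pos k
  have hj' := scale_pos j
  rw [bumpRadius, lt_abs]
  rcases lt_or_gt_of_ne hj with h1 | h1
  · have := two_mul_scale_le h1
    right; linarith
  · have := two_mul_scale_le h1
    left; linarith

lemma NearBump.bumpRadius_lt (h : NearBump k x) (hj : j ≠ k) :
    bumpRadius j < ‖x - bumpCenter j‖ := by
  linarith [h.two_mul_bumpRadius_lt hj, bumpRadius_pos j]

lemma contDiff_unitBump : ContDiff ℝ ∞ unitBump := contDiff_cutoff.comp (contDiff_norm_sq ℝ)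

lemma unitBump_nonneg (y : Plane) : 0 ≤ unitBump y :=
  sub_nonneg.2 (Real.smoothTransition.le_one _)

lemma unitBump_le_one (y : Plane) : unitBump y ≤ 1 :=
  sub_le_self _ (Real.smoothTransition.nonneg _)

lemma unitBump_of_le {y : Plane} (hy : ‖y‖ ≤ 1) : unitBump y = 1 :=
  cutoff_of_le (pow_le_one₀ (norm_nonneg _) hy)

lemma unitBump_of_ge {y : Plane} (hy : 2 ≤ ‖y‖) : unitBump y = 0 :=
  cutoff_of_ge (by nlinarith)

lemma hasCompactSupport_unitBump : HasCompactSupport unitBump :=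
  HasCompactSupport.intro (isCompact_closedBall 0 2) fun y hy =>
    unitBump_of_ge (by simp at hy; exact hy.le)

lemma contDiff_bump (j : ℕ) : ContDiff ℝ ∞ (bump j) :=
  contDiff_const.mul (contDiff_unitBump.comp ((contDiff_id.sub contDiff_const).const_smul _))

lemma bump_nonneg (j : ℕ) (x : Plane) : 0 ≤ bump j x :=
  mul_nonneg (by positivity) (unitBump_nonneg _)

lemma norm_bump_arg (j : ℕ) (x : Plane) :
    ‖(bumpRadius j)⁻¹ • (x - bumpCenter j)‖ = ‖x - bumpCenter j‖ / bumpRadius j := by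
  rw [norm_smul, norm_inv, Real.norm_of_nonneg (bumpRadius_pos j).le, inv_mul_eq_div]

lemma bump_of_le (h : ‖x - bumpCenter j‖ ≤ bumpRadius j) :
    bump j x = (j.factorial : ℝ)⁻¹ := by
  rw [bump, unitBump_of_le, mul_one]
  rw [norm_bump_arg]
  exact div_le_one_of_le₀ h (bumpRadius_pos j).le

lemma bump_of_ge (h : 2 * bumpRadius j ≤ ‖x - bumpCenter j‖) : bump j x = 0 := by
  rw [bump, unitBump_of_ge, mul_zero]
  rw [norm_bump_arg]
  exact (le_div_iff₀ (bumpRadius_pos j)).2 h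

lemma initialDatum_of_nearBump (h : NearBump k x) : initialDatum x = bump k x :=
  tsum_eq_single k fun _ hj => bump_of_ge (h.two_mul_bumpRadius_lt hj).le

lemma initialDatum_nonneg (x : Plane) : 0 ≤ initialDatum x := tsum_nonneg fun j => bump_nonneg j x

lemma exists_nearBump (h : initialDatum x ≠ 0) : ∃ k, NearBump k x := by
  by_contra! hx
  refine h ?_
  simp only [initialDatum, bump_of_ge (not_lt.1 (hx _)), tsum_zero]

lemma initialDatum_of_le (h : ‖x - bumpCenter j‖ ≤ bumpRadius j) :
    initialDatum x = (j.factorial : ℝ)⁻¹ := by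
  rw [initialDatum_of_nearBump (k := j), bump_of_le h]
  exact h.trans_lt (by linarith [bumpRadius_pos j])

lemma iteratedFDeriv_bump (n j : ℕ) (x : Plane) :
    iteratedFDeriv ℝ n (bump j) x = (j.factorial : ℝ)⁻¹ • (bumpRadius j)⁻¹ ^ n •
      iteratedFDeriv ℝ n unitBump ((bumpRadius j)⁻¹ • (x - bumpCenter j)) := by
  have hu : ContDiff ℝ n unitBump := contDiff_unitBump.of_le (by exact_mod_cast le_top)
  have h1 : bump j = fun x => (j.factorial : ℝ)⁻¹ •
      (fun z => unitBump ((bumpRadius j)⁻¹ • z)) (x - bumpCenter j) := rfl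
  have h2 : ContDiff ℝ n fun x =>
      (fun z => unitBump ((bumpRadius j)⁻¹ • z)) (x - bumpCenter j) :=
    hu.comp ((contDiff_id.sub contDiff_const).const_smul _)
  rw [h1, iteratedFDeriv_const_smul_apply' h2.contDiffAt,
    iteratedFDeriv_comp_sub (f := fun z => unitBump ((bumpRadius j)⁻¹ • z)),
    iteratedFDeriv_comp_const_smul _ hu]

lemma exists_norm_iteratedFDeriv_unitBump_le (n : ℕ) :
    ∃ C, ∀ y, ‖iteratedFDeriv ℝ n unitBump y‖ ≤ C :=
  (hasCompactSupport_unitBump.iteratedFDeriv n).exists_bound_of_continuous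
    (contDiff_unitBump.continuous_iteratedFDeriv (by exact_mod_cast le_top))

/-- The `n`-th derivative of the rescaled bump grows like `(20 * 2 ^ j) ^ n`, and the height `1 /
j!` beats every such geometric growth in `j`. -/
lemma contDiff_initialDatum : ContDiff ℝ ∞ initialDatum := by
  choose C hC using exists_norm_iteratedFDeriv_unitBump_le
  have hb : ∀ (n j : ℕ) (x : Plane), ‖iteratedFDeriv ℝ n (bump j) x‖ ≤
      C n * 20 ^ n * ((2 ^ n) ^ j / j.factorial) := fun n j x => by
    have e2 : (bumpRadius j)⁻¹ = 20 * 2 ^ j := by simp [bumpRadius, scale]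
    rw [iteratedFDeriv_bump, norm_smul, norm_smul, norm_inv, norm_pow, e2,
      Real.norm_of_nonneg (by positivity), Real.norm_of_nonneg (by positivity)]
    calc (j.factorial : ℝ)⁻¹ * ((20 * 2 ^ j) ^ n * ‖iteratedFDeriv ℝ n unitBump _‖)
        ≤ (j.factorial : ℝ)⁻¹ * ((20 * 2 ^ j) ^ n * C n) := by gcongr; exact hC n _
      _ = C n * 20 ^ n * ((2 ^ n) ^ j / j.factorial) := by
        rw [mul_pow, ← pow_mul, ← pow_mul, mul_comm j n]; ring
  exact contDiff_tsum contDiff_bump (fun n _ => (Real.summable_pow_div_factorial _).mul_left _)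
    fun n j x _ => hb n j x

lemma NearBump.norm_le (h : NearBump k x) : ‖x‖ ≤ 2 := by
  have h1 : ‖bumpCenter k‖ = scale k := by
    simp [bumpCenter, abs_of_pos (scale_pos k)]
  have h2 : ‖x‖ ≤ ‖x - bumpCenter k‖ + ‖bumpCenter k‖ := by
    simpa using norm_add_le (x - bumpCenter k) (bumpCenter k)
  have h3 : ‖x - bumpCenter k‖ < 2 * (scale k / 20) := h
  linarith [scale_le_one k]

lemma isTest_initialDatum : IsTest initialDatum where
  smooth := contDiff_initialDatum
  compact := HasCompactSupport.intro (isCompact_closedBall 0 2) fun x hx => by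
    by_contra h
    obtain ⟨k, hk⟩ := exists_nearBump h
    exact hx (by simpa using hk.norm_le)

/-- Quadratic vanishing at the origin compensates the bound `C / ‖x‖ ^ 2` on the kernels, which is
uniform in the scale. It follows from `4 ^ k / k! ≤ exp 4`. -/
lemma exists_initialDatum_le : ∃ C, 0 ≤ C ∧ ∀ x, initialDatum x ≤ C * ‖x‖ ^ 2 := by
  refine ⟨2 * Real.exp 4, by positivity, fun x => ?_⟩
  by_cases hx : initialDatum x = 0
  · rw [hx]; positivity
  obtain ⟨k, hk⟩ := exists_nearBump hx
  have hs := scale_pos k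
  have h0 := abs_lt.1 hk.abs_coord_lt.1
  have h1 : 81 / 100 * scale k ^ 2 ≤ ‖x‖ ^ 2 := by
    have := plane_norm_sub_sq x 0
    simp only [sub_zero, PiLp.zero_apply] at this
    rw [this]
    nlinarith [sq_nonneg (x 1)]
  have h2 : ((k.factorial : ℝ))⁻¹ ≤ Real.exp 4 * scale k ^ 2 := by
    have := Real.pow_div_factorial_le_exp 4 (by norm_num) k
    have e : scale k ^ 2 = (4 ^ k)⁻¹ := by
      rw [scale, ← pow_mul, mul_comm, pow_mul, ← inv_pow]; norm_num
    rw [e, ← div_eq_mul_inv, le_div_iff₀ (by positivity), inv_mul_eq_div]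
    exact this
  calc initialDatum x = bump k x := initialDatum_of_nearBump hk
    _ ≤ (k.factorial : ℝ)⁻¹ * 1 := by
      unfold bump
      gcongr
      exact unitBump_le_one _
    _ ≤ Real.exp 4 * scale k ^ 2 := by rw [mul_one]; exact h2
    _ ≤ 2 * Real.exp 4 * ‖x‖ ^ 2 := by nlinarith [Real.exp_pos 4]

/-! ### The weighted family of densities -/

/-- The density attached to the `j`-th bump. -/
def bumpDensity (j : ℕ) (x : Plane) : ℝ := density (bumpCenter j) (bumpRadius j) x

/-- The potential of the density attached to the `j`-th bump. -/
def bumpPotential (j : ℕ) (x : Plane) : ℝ := potential (bumpCenter j) (bumpRadius j) x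

lemma bumpDensity_nonneg (j : ℕ) (x : Plane) : 0 ≤ bumpDensity j x := density_nonneg _ _ _

lemma bumpDensity_of_lt (h : bumpRadius j < ‖x - bumpCenter j‖) : bumpDensity j x = 0 :=
  density_of_lt (bumpRadius_pos j) h

lemma bumpPotential_of_lt (h : bumpRadius j < ‖x - bumpCenter j‖) :
    bumpPotential j x = ((x 0 - scale j) ^ 2 - x 1 ^ 2) / ‖x - bumpCenter j‖ ^ 4 := by
  rw [bumpPotential, potential_of_lt (bumpRadius_pos j) h]
  simp [bumpCenter]

/-- The horizontal distance to a coarser centre is at least `9/10` of `scale k`, the vertical one at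
most `1/10`: the point lies in the positive cone. -/
lemma NearBump.bumpPotential_nonneg (h : NearBump k x) (hj : j < k) : 0 ≤ bumpPotential j x := by
  rw [bumpPotential_of_lt (h.bumpRadius_lt hj.ne)]
  refine div_nonneg ?_ (by positivity)
  have h0 := abs_lt.1 h.abs_coord_lt.1
  have h1 := abs_lt.1 h.abs_coord_lt.2
  have hs := two_mul_scale_le hj
  have := scale_pos k
  nlinarith

/-- All finer centres are at horizontal distance between `4/10` and `11/10` of `scale k`, hence a
lower bound independent of `j`. -/
lemma NearBump.le_bumpPotential (h : NearBump k x) (hj : k < j) :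
    1 / 10 / scale k ^ 2 ≤ bumpPotential j x := by
  have hr := h.bumpRadius_lt hj.ne'
  rw [bumpPotential_of_lt hr]
  have h0 := abs_lt.1 h.abs_coord_lt.1
  have h1 := abs_lt.1 h.abs_coord_lt.2
  have hs := two_mul_scale_le hj
  have hk := scale_pos k
  have hj' := scale_pos j
  have hn : 0 < ‖x - bumpCenter j‖ := (bumpRadius_pos j).trans hr
  have e : ‖x - bumpCenter j‖ ^ 4 = ((x 0 - scale j) ^ 2 + x 1 ^ 2) ^ 2 := by
    rw [← norm_sub_bumpCenter_sq]; ring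
  have a1 : x 1 ^ 2 ≤ 1 / 100 * scale k ^ 2 := by nlinarith
  have a2 : 16 / 100 * scale k ^ 2 ≤ (x 0 - scale j) ^ 2 := by nlinarith
  have a3 : (x 0 - scale j) ^ 2 ≤ 121 / 100 * scale k ^ 2 := by nlinarith
  have a4 : ((x 0 - scale j) ^ 2 + x 1 ^ 2) ^ 2 ≤ (122 / 100 * scale k ^ 2) ^ 2 := by
    refine pow_le_pow_left₀ (by positivity) (by linarith) 2
  rw [div_le_div_iff₀ (by positivity) (by positivity), e]
  have a5 : 15 / 100 * scale k ^ 2 * scale k ^ 2 ≤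
      ((x 0 - scale j) ^ 2 - x 1 ^ 2) * scale k ^ 2 := by
    gcongr
    linarith
  nlinarith [sq_nonneg (scale k ^ 2)]

lemma exists_bumpKernel_le : ∃ C, 0 ≤ C ∧ ∀ j x,
    |bumpPotential j x| + bumpDensity j x ≤ C / (scale j ^ 2 + ‖x - bumpCenter j‖ ^ 2) := by
  obtain ⟨C, hC, h⟩ := exists_abs_potential_le
  obtain ⟨D, hD, h'⟩ := exists_density_le
  refine ⟨400 * (C + D), by positivity, fun j x => ?_⟩
  have hr := bumpRadius_pos j
  have hs := scale_pos j
  have e : scale j ^ 2 = 400 * bumpRadius j ^ 2 := by rw [bumpRadius]; ring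
  calc |bumpPotential j x| + bumpDensity j x
      ≤ C / (bumpRadius j ^ 2 + ‖x - bumpCenter j‖ ^ 2) +
        D / (bumpRadius j ^ 2 + ‖x - bumpCenter j‖ ^ 2) := add_le_add (h _ _ _ hr) (h' _ _ _ hr)
    _ = 400 * (C + D) / (400 * (bumpRadius j ^ 2 + ‖x - bumpCenter j‖ ^ 2)) := by
      field_simp
    _ ≤ 400 * (C + D) / (scale j ^ 2 + ‖x - bumpCenter j‖ ^ 2) := by
      gcongr
      rw [e]
      nlinarith [sq_nonneg ‖x - bumpCenter j‖]

lemma exists_bumpKernel_le_div_norm : ∃ C, 0 ≤ C ∧ ∀ j x, x ≠ 0 →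
    |bumpPotential j x| + bumpDensity j x ≤ C / ‖x‖ ^ 2 := by
  obtain ⟨C, hC, h⟩ := exists_bumpKernel_le
  refine ⟨2 * C, by positivity, fun j x hx => (h j x).trans ?_⟩
  have hs := scale_pos j
  have hx' : 0 < ‖x‖ := norm_pos_iff.2 hx
  have h1 : ‖bumpCenter j‖ = scale j := by
    simp [bumpCenter, abs_of_pos (scale_pos j)]
  have h2 : ‖x‖ ≤ ‖x - bumpCenter j‖ + scale j := by
    rw [← h1]
    simpa using norm_add_le (x - bumpCenter j) (bumpCenter j)
  rw [div_le_div_iff₀ (by positivity) (by positivity)]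
  have h3 : ‖x‖ ^ 2 ≤ 2 * (scale j ^ 2 + ‖x - bumpCenter j‖ ^ 2) := by
    nlinarith [sq_nonneg (‖x - bumpCenter j‖ - scale j)]
  calc C * ‖x‖ ^ 2 ≤ C * (2 * (scale j ^ 2 + ‖x - bumpCenter j‖ ^ 2)) := by gcongr
    _ = _ := by ring

lemma summable_bumpKernel {q : ℝ} (hq : q ∈ Ioo (0 : ℝ) 1) (hx : x ≠ 0) :
    Summable (fun j => q ^ j * bumpPotential j x) ∧ Summable fun j => q ^ j * bumpDensity j x := by
  obtain ⟨C, hC, h⟩ := exists_bumpKernel_le_div_norm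
  have hs : Summable fun j => q ^ j * (C / ‖x‖ ^ 2) :=
    (summable_geometric_of_lt_one hq.1.le hq.2).mul_right _
  have hq0 := hq.1
  constructor <;> refine hs.of_norm_bounded fun j => ?_ <;>
    rw [norm_mul, norm_pow, Real.norm_of_nonneg hq0.le] <;> gcongr
  · exact (le_add_of_nonneg_right (bumpDensity_nonneg j x)).trans (h j x hx)
  · rw [Real.norm_of_nonneg (bumpDensity_nonneg j x)]
    exact (le_add_of_nonneg_left (abs_nonneg _)).trans (h j x hx)

lemma ne_zero_of_initialDatum_ne_zero (h : initialDatum x ≠ 0) : x ≠ 0 := by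
  rintro rfl
  obtain ⟨C, -, hC⟩ := exists_initialDatum_le
  refine h (le_antisymm ?_ (initialDatum_nonneg 0))
  simpa using hC 0

/-- The weighted sum of the potentials dominates that of the densities on the support of the
initial datum. -/
lemma exists_tsum_density_le_tsum_potential : ∃ q ∈ Ioo (0 : ℝ) 1, ∀ x, initialDatum x ≠ 0 →
    ∑' j, q ^ j * bumpDensity j x ≤ ∑' j, q ^ j * bumpPotential j x := by
  obtain ⟨C, hC, h⟩ := exists_bumpKernel_le
  -- The total weight of the finer bumps relative to `q ^ k` is `q / (1 - q)`, and each contributes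
  -- `1/10` in units of `1 / scale k ^ 2`; the sum `C + 1/10` exceeds the possible loss `C` of the
  -- bump itself.
  obtain ⟨q, hq, hqC⟩ : ∃ q ∈ Ioo (0 : ℝ) 1, q * (1 - q)⁻¹ = 10 * C + 1 := by
    refine ⟨(10 * C + 1) / (10 * C + 2), ⟨by positivity, ?_⟩, ?_⟩
    · rw [div_lt_one (by positivity)]; linarith
    · rw [show 1 - (10 * C + 1) / (10 * C + 2) = 1 / (10 * C + 2) by field_simp; ring]
      field_simp
  refine ⟨q, hq, fun x hx => ?_⟩
  obtain ⟨hp, hd⟩ := summable_bumpKernel hq (ne_zero_of_initialDatum_ne_zero hx)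
  obtain ⟨k, hk⟩ := exists_nearBump hx
  have hq0 := hq.1
  have hs := scale_pos k
  have hF := hp.sub hd
  rw [← sub_nonneg, ← hp.tsum_sub hd, ← hF.sum_add_tsum_nat_add (k + 1), Finset.sum_range_succ]
  have h1 : 0 ≤ ∑ i ∈ Finset.range k, (q ^ i * bumpPotential i x - q ^ i * bumpDensity i x) := by
    refine Finset.sum_nonneg fun i hi => ?_
    have hi' := Finset.mem_range.1 hi
    rw [bumpDensity_of_lt (hk.bumpRadius_lt hi'.ne), mul_zero, sub_zero]
    exact mul_nonneg (by positivity) (hk.bumpPotential_nonneg hi')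
  have h2 : -(q ^ k * (C / scale k ^ 2)) ≤ q ^ k * bumpPotential k x - q ^ k * bumpDensity k x := by
    have a : C / (scale k ^ 2 + ‖x - bumpCenter k‖ ^ 2) ≤ C / scale k ^ 2 := by
      gcongr
      nlinarith [sq_nonneg ‖x - bumpCenter k‖]
    have b : -(C / scale k ^ 2) ≤ bumpPotential k x - bumpDensity k x := by
      linarith [h k x, neg_abs_le (bumpPotential k x)]
    calc -(q ^ k * (C / scale k ^ 2)) = q ^ k * -(C / scale k ^ 2) := by ring
      _ ≤ q ^ k * (bumpPotential k x - bumpDensity k x) := by gcongr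
      _ = _ := by ring
  have h3 : q ^ k * ((10 * C + 1) * (1 / 10 / scale k ^ 2)) ≤ ∑' i, (q ^ (i + (k + 1)) *
      bumpPotential (i + (k + 1)) x - q ^ (i + (k + 1)) * bumpDensity (i + (k + 1)) x) := by
    have g := (summable_geometric_of_lt_one hq0.le hq.2).mul_right
      (q ^ (k + 1) * (1 / 10 / scale k ^ 2))
    have e : q ^ k * ((10 * C + 1) * (1 / 10 / scale k ^ 2)) =
        ∑' i : ℕ, q ^ i * (q ^ (k + 1) * (1 / 10 / scale k ^ 2)) := by
      rw [tsum_mul_right, tsum_geometric_of_lt_one hq0.le hq.2, ← hqC]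
      ring
    rw [e]
    refine g.tsum_le_tsum (fun i => ?_) ((summable_nat_add_iff (k + 1)).2 hF)
    rw [bumpDensity_of_lt (hk.bumpRadius_lt (by omega)), mul_zero, sub_zero, ← mul_assoc, ← pow_add]
    gcongr
    exact hk.le_bumpPotential (by omega)
  have h4 : q ^ k * (C / scale k ^ 2) ≤ q ^ k * ((10 * C + 1) * (1 / 10 / scale k ^ 2)) := by
    gcongr
    rw [show (10 * C + 1) * (1 / 10 / scale k ^ 2) = (C + 1 / 10) / scale k ^ 2 by ring]
    gcongr
    linarith
  linarith

end

noncomputable section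

/-! ### Finite lifespan -/

lemma continuous_bumpDensity (j : ℕ) : Continuous (bumpDensity j) := continuous_density _ _

lemma continuous_bumpPotential (j : ℕ) : Continuous (bumpPotential j) := continuous_potential _ _

lemma integrable_bumpDensity (j : ℕ) : Integrable (bumpDensity j) :=
  integrable_density (bumpRadius_pos j) _

lemma integral_bumpDensity (j : ℕ) : ∫ x, bumpDensity j x = densityMass :=
  integral_density (bumpRadius_pos j) _

/-- The density lives on the plateau of its bump, where the logarithm of the datum is an explicit
constant. -/
lemma initialDatum_of_bumpDensity_ne_zero {j : ℕ} {x : Plane} (h : bumpDensity j x ≠ 0) :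
    initialDatum x = (j.factorial : ℝ)⁻¹ := by
  refine initialDatum_of_le ?_
  by_contra! hx
  exact h (bumpDensity_of_lt hx)

lemma mem_tsupport_of_bumpDensity_ne_zero {j : ℕ} {x : Plane} (h : bumpDensity j x ≠ 0) :
    x ∈ tsupport initialDatum := by
  refine subset_tsupport _ ?_
  rw [Function.mem_support, initialDatum_of_bumpDensity_ne_zero h]
  positivity

lemma norm_bumpDensity_mul_le {j : ℕ} {f : Plane → ℝ} {K : ℝ}
    (hf : ∀ x, bumpDensity j x ≠ 0 → |f x| ≤ K) (x : Plane) :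
    ‖bumpDensity j x * f x‖ ≤ bumpDensity j x * K := by
  rw [norm_mul, Real.norm_of_nonneg (bumpDensity_nonneg j x)]
  by_cases h : bumpDensity j x = 0
  · simp [h]
  · exact mul_le_mul_of_nonneg_left (hf x h) (bumpDensity_nonneg j x)

lemma integrable_bumpDensity_mul {j : ℕ} {f : Plane → ℝ} {K : ℝ} (hm : Measurable f)
    (hf : ∀ x, bumpDensity j x ≠ 0 → |f x| ≤ K) : Integrable fun x => bumpDensity j x * f x :=
  ((integrable_bumpDensity j).mul_const K).mono'
    ((continuous_bumpDensity j).measurable.mul hm).aestronglyMeasurable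
    (Filter.Eventually.of_forall (norm_bumpDensity_mul_le hf))

lemma abs_integral_bumpDensity_mul_le {j : ℕ} {f : Plane → ℝ} {K : ℝ}
    (hf : ∀ x, bumpDensity j x ≠ 0 → |f x| ≤ K) :
    |∫ x, bumpDensity j x * f x| ≤ densityMass * K := by
  have := norm_integral_le_of_norm_le ((integrable_bumpDensity j).mul_const K)
    (Filter.Eventually.of_forall (norm_bumpDensity_mul_le hf))
  rwa [integral_mul_const, integral_bumpDensity] at this

lemma summable_geometric_mul_of_abs_le {q K : ℝ} (hq : q ∈ Ioo (0 : ℝ) 1) {a : ℕ → ℝ}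
    (ha : ∀ j, |a j| ≤ K) : Summable fun j => q ^ j * a j :=
  ((summable_geometric_of_lt_one hq.1.le hq.2).mul_right K).of_norm_bounded fun j => by
    rw [norm_mul, norm_pow, Real.norm_of_nonneg hq.1.le]
    exact mul_le_mul_of_nonneg_left (ha j) (pow_nonneg hq.1.le j)

lemma abs_log_inv_factorial_le (j : ℕ) : |Real.log (j.factorial : ℝ)⁻¹| ≤ (j : ℝ) ^ 2 := by
  have h1 : (1 : ℝ) ≤ j.factorial := by exact_mod_cast j.factorial_pos
  rw [Real.log_inv, abs_neg, abs_of_nonneg (Real.log_nonneg h1)]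
  rcases Nat.eq_zero_or_pos j with rfl | hj
  · simp
  have hj' : (0 : ℝ) < j := by exact_mod_cast hj
  calc Real.log j.factorial ≤ Real.log ((j : ℝ) ^ j) :=
        Real.log_le_log (by positivity) (by exact_mod_cast j.factorial_le_pow)
    _ = j * Real.log j := Real.log_pow _ _
    _ ≤ j * j := by gcongr; linarith [Real.log_le_sub_one_of_pos hj']
    _ = (j : ℝ) ^ 2 := by ring

lemma summable_geometric_mul_log {q : ℝ} (hq : q ∈ Ioo (0 : ℝ) 1) (K : ℝ) :
    Summable fun j : ℕ => q ^ j * (|Real.log (j.factorial : ℝ)⁻¹| + K) := by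
  have hq1 : ‖q‖ < 1 := by rw [Real.norm_of_nonneg hq.1.le]; exact hq.2
  have h1 : Summable fun j : ℕ => q ^ j * |Real.log (j.factorial : ℝ)⁻¹| := by
    refine (summable_pow_mul_geometric_of_norm_lt_one 2 hq1).of_norm_bounded fun j => ?_
    rw [norm_mul, norm_pow, Real.norm_of_nonneg hq.1.le, mul_comm, Real.norm_eq_abs, abs_abs]
    exact mul_le_mul_of_nonneg_right (abs_log_inv_factorial_le j) (pow_nonneg hq.1.le j)
  simp_rw [mul_add]
  exact h1.add ((summable_geometric_of_lt_one hq.1.le hq.2).mul_right K)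

/-- The mean of `log u` against the `j`-th density. -/
def logMean (j : ℕ) (u : Plane → ℝ) : ℝ := ∫ x, bumpDensity j x * Real.log (u x)

/-- The geometrically weighted sum of the logarithmic means. -/
def logEnergy (q : ℝ) (u : Plane → ℝ) : ℝ := ∑' j, q ^ j * logMean j u

/-- The graph of `exp` lies above its tangent at `a`, evaluated at `log y`. Integrated against the
densities, it yields Jensen's inequality. -/
lemma one_add_sub_mul_exp_le {a y : ℝ} (hy : 0 < y) :
    Real.exp a * (1 + Real.log y - a) ≤ y := by
  have h := Real.add_one_le_exp (Real.log y - a)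
  have e : Real.exp a * Real.exp (Real.log y - a) = y := by
    rw [← Real.exp_add, add_sub_cancel, Real.exp_log hy]
  calc Real.exp a * (1 + Real.log y - a) ≤ Real.exp a * Real.exp (Real.log y - a) := by
        gcongr
        linarith
    _ = y := e

/-- Comparison with the Riccati equation: a function with `F' ≥ m e^{F/m}` on `(0, b)` satisfies
`t - s ≤ e^{-F(s)/m}`. -/
lemma sub_le_exp_of_deriv_ge {F F' : ℝ → ℝ} {b m : ℝ} (hm : 0 < m)
    (hF : ∀ t ∈ Ioo 0 b, HasDerivAt F (F' t) t)
    (hF' : ∀ t ∈ Ioo 0 b, m * Real.exp (F t / m) ≤ F' t) {s t : ℝ} (hs : 0 < s) (hst : s ≤ t)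
    (ht : t < b) : t - s ≤ Real.exp (-(F s / m)) := by
  -- The Riccati inequality says exactly that `exp (-F / m) + t` is nonincreasing.
  have hd : ∀ t ∈ Ioo 0 b, HasDerivAt (fun t => Real.exp (-(F t / m)) + t)
      (Real.exp (-(F t / m)) * -(F' t / m) + 1) t := fun t ht =>
    (((hF t ht).div_const m).neg.exp).add (hasDerivAt_id t)
  have ha : AntitoneOn (fun t => Real.exp (-(F t / m)) + t) (Ioo 0 b) := by
    refine antitoneOn_of_hasDerivWithinAt_nonpos (convex_Ioo 0 b)
      (fun t ht => (hd t ht).continuousAt.continuousWithinAt)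
      (fun t ht => (hd t (interior_subset ht)).hasDerivWithinAt) fun t ht => ?_
    have h1 := hF' t (interior_subset ht)
    have h2 : Real.exp (F t / m) ≤ F' t / m := by rw [le_div_iff₀ hm, mul_comm]; exact h1
    have h3 : Real.exp (-(F t / m)) * Real.exp (F t / m) = 1 := by
      rw [← Real.exp_add, neg_add_cancel, Real.exp_zero]
    nlinarith [Real.exp_pos (-(F t / m))]
  have := ha ⟨hs, hst.trans_lt ht⟩ ⟨hs.trans_le hst, ht⟩ hst
  simp only at this
  linarith [Real.exp_pos (-(F t / m))]

namespace IsSmoothSolution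

variable {T b M q t : ℝ} {w : ℝ → Plane → ℝ}

/-- `w` and `R₁² w` are bounded by `M` on the support of the datum up to time `b`. -/
def BoundedBy (w : ℝ → Plane → ℝ) (b M : ℝ) : Prop :=
  ∀ t ∈ Icc 0 b, ∀ x ∈ tsupport initialDatum, |w t x| ≤ M ∧ |rieszSq (w t) x| ≤ M

lemma abs_integral_rieszSq_le (hM : BoundedBy w b M) (ht : t ∈ Icc 0 b) {x : Plane}
    (hx : x ∈ tsupport initialDatum) : |∫ s in (0 : ℝ)..t, rieszSq (w s) x| ≤ M * t := by
  have := intervalIntegral.norm_integral_le_of_norm_le_const (a := 0) (b := t)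
    (f := fun s => rieszSq (w s) x) (C := M) fun s hs => by
      rw [uIoc_of_le ht.1] at hs
      exact (hM s ⟨hs.1.le, hs.2.trans ht.2⟩ x hx).2
  rwa [sub_zero, abs_of_nonneg ht.1] at this

/-! ### Evolution of the logarithmic means along a solution -/

lemma pos_of_bumpDensity_ne_zero (h : IsSmoothSolution T initialDatum w) (ht : t ∈ Ico 0 T)
    {j : ℕ} {x : Plane} (hx : bumpDensity j x ≠ 0) : 0 < w t x := by
  rw [h.eq_mul_exp isTest_initialDatum ht, initialDatum_of_bumpDensity_ne_zero hx]
  positivity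

lemma abs_log_sub_le (h : IsSmoothSolution T initialDatum w) (hb : b < T)
    (hM : BoundedBy w b M) (ht : t ∈ Icc 0 b) {j : ℕ} {x : Plane} (hx : bumpDensity j x ≠ 0) :
    |Real.log (w t x) - Real.log (j.factorial : ℝ)⁻¹| ≤ M * t := by
  rw [h.eq_mul_exp isTest_initialDatum ⟨ht.1, ht.2.trans_lt hb⟩,
    initialDatum_of_bumpDensity_ne_zero hx, Real.log_mul (by positivity) (Real.exp_ne_zero _),
    Real.log_exp, add_sub_cancel_left]
  exact abs_integral_rieszSq_le hM ht (mem_tsupport_of_bumpDensity_ne_zero hx)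

lemma abs_log_le (h : IsSmoothSolution T initialDatum w) (hb : b < T) (hM0 : 0 ≤ M)
    (hM : BoundedBy w b M) (ht : t ∈ Icc 0 b) {j : ℕ} {x : Plane} (hx : bumpDensity j x ≠ 0) :
    |Real.log (w t x)| ≤ |Real.log (j.factorial : ℝ)⁻¹| + M * b := by
  have h1 := h.abs_log_sub_le hb hM ht hx
  have h2 := abs_sub_abs_le_abs_sub (Real.log (w t x)) (Real.log (j.factorial : ℝ)⁻¹)
  have h3 : M * t ≤ M * b := mul_le_mul_of_nonneg_left ht.2 hM0
  linarith

lemma measurable (h : IsSmoothSolution T initialDatum w) (ht : t ∈ Ico 0 T) : Measurable (w t) :=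
  (h.isTest isTest_initialDatum ht).continuous.measurable

lemma integrable_bumpDensity_mul_log (h : IsSmoothSolution T initialDatum w) (hb : b < T)
    (hM0 : 0 ≤ M) (hM : BoundedBy w b M) (ht : t ∈ Icc 0 b) (j : ℕ) :
    Integrable fun x => bumpDensity j x * Real.log (w t x) :=
  integrable_bumpDensity_mul (h.measurable ⟨ht.1, ht.2.trans_lt hb⟩).log
    fun _ hx => h.abs_log_le hb hM0 hM ht hx

lemma summable_logMean (h : IsSmoothSolution T initialDatum w) (hb : b < T) (hM0 : 0 ≤ M)
    (hM : BoundedBy w b M) (hq : q ∈ Ioo (0 : ℝ) 1) (ht : t ∈ Icc 0 b) :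
    Summable fun j => q ^ j * logMean j (w t) := by
  refine ((summable_geometric_mul_log hq (M * b)).mul_left densityMass).of_norm_bounded
    fun j => ?_
  rw [norm_mul, norm_pow, Real.norm_of_nonneg hq.1.le, mul_left_comm]
  exact mul_le_mul_of_nonneg_left
    (abs_integral_bumpDensity_mul_le fun x hx => h.abs_log_le hb hM0 hM ht hx)
    (pow_nonneg hq.1.le j)

/-- Dividing the equation by `w`, which is positive where the density is not zero, gives `∂ₜ log w =
R₁² w`. -/
lemma hasDerivAt_logMean (h : IsSmoothSolution T initialDatum w) (hb : b < T) (hM0 : 0 ≤ M)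
    (hM : BoundedBy w b M) (ht : t ∈ Ioo 0 b) (j : ℕ) :
    HasDerivAt (fun t => logMean j (w t)) (∫ x, bumpDensity j x * rieszSq (w t) x) t := by
  have hs : Ioo 0 b ∈ nhds t := isOpen_Ioo.mem_nhds ht
  refine (hasDerivAt_integral_of_dominated_loc_of_deriv_le (μ := volume)
    (F := fun t x => bumpDensity j x * Real.log (w t x))
    (F' := fun t x => bumpDensity j x * rieszSq (w t) x) (bound := fun x => bumpDensity j x * M)
    hs ?_ (h.integrable_bumpDensity_mul_log hb hM0 hM (Ioo_subset_Icc_self ht) j) ?_ ?_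
    ((integrable_bumpDensity j).mul_const M) ?_).2
  · filter_upwards [hs] with s hs
    exact (h.integrable_bumpDensity_mul_log hb hM0 hM (Ioo_subset_Icc_self hs) j).1
  · exact ((continuous_bumpDensity j).mul
      (h.isTest isTest_initialDatum ⟨ht.1.le, ht.2.trans hb⟩).contDiff_rieszSq.continuous
      ).aestronglyMeasurable
  · exact Filter.Eventually.of_forall fun x s hs => norm_bumpDensity_mul_le (fun y hy =>
      (hM s (Ioo_subset_Icc_self hs) y (mem_tsupport_of_bumpDensity_ne_zero hy)).2) x
  · refine Filter.Eventually.of_forall fun x s hs => ?_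
    by_cases hx : bumpDensity j x = 0
    · simpa [hx] using hasDerivAt_const s (0 : ℝ)
    · have hpos := h.pos_of_bumpDensity_ne_zero ⟨hs.1.le, hs.2.trans hb⟩ hx
      have := ((h.hasDerivAt isTest_initialDatum ⟨hs.1, hs.2.trans hb⟩ x).log
        hpos.ne').const_mul (bumpDensity j x)
      rwa [mul_div_cancel_left₀ _ hpos.ne'] at this

lemma abs_integral_bumpDensity_mul_rieszSq_le (hM : BoundedBy w b M) (ht : t ∈ Icc 0 b) (j : ℕ) :
    |∫ x, bumpDensity j x * rieszSq (w t) x| ≤ densityMass * M :=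
  abs_integral_bumpDensity_mul_le fun x hx =>
    (hM t ht x (mem_tsupport_of_bumpDensity_ne_zero hx)).2

lemma hasDerivAt_logEnergy (h : IsSmoothSolution T initialDatum w) (hb : b < T) (hM0 : 0 ≤ M)
    (hM : BoundedBy w b M) (hq : q ∈ Ioo (0 : ℝ) 1) (ht : t ∈ Ioo 0 b) :
    HasDerivAt (fun t => logEnergy q (w t))
      (∑' j, q ^ j * ∫ x, bumpDensity j x * rieszSq (w t) x) t := by
  refine hasDerivAt_tsum_of_isPreconnected (g := fun j t => q ^ j * logMean j (w t))
    (g' := fun j t => q ^ j * ∫ x, bumpDensity j x * rieszSq (w t) x)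
    ((summable_geometric_of_lt_one hq.1.le hq.2).mul_right (densityMass * M)) isOpen_Ioo
    isPreconnected_Ioo (fun j s hs => (h.hasDerivAt_logMean hb hM0 hM hs j).const_mul _)
    (fun j s hs => ?_) ht (h.summable_logMean hb hM0 hM hq (Ioo_subset_Icc_self ht)) ht
  rw [norm_mul, norm_pow, Real.norm_of_nonneg hq.1.le]
  exact mul_le_mul_of_nonneg_left
    (abs_integral_bumpDensity_mul_rieszSq_le hM (Ioo_subset_Icc_self hs) j)
    (pow_nonneg hq.1.le j)

lemma nonneg (h : IsSmoothSolution T initialDatum w) (ht : t ∈ Ico 0 T) (x : Plane) :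
    0 ≤ w t x := by
  rw [h.eq_mul_exp isTest_initialDatum ht]
  exact mul_nonneg (initialDatum_nonneg x) (Real.exp_pos _).le

/-- The kernels are bounded against `w`, uniformly in the scale. -/
lemma exists_kernel_mul_le (h : IsSmoothSolution T initialDatum w) (hb : b < T)
    (hM : BoundedBy w b M) (ht : t ∈ Icc 0 b) :
    ∃ D, ∀ j x, ‖(bumpPotential j x - bumpDensity j x) * w t x‖ ≤
      (tsupport initialDatum).indicator (fun _ => D) x := by
  obtain ⟨C, hC, hC'⟩ := exists_bumpKernel_le_div_norm
  obtain ⟨A, hA, hA'⟩ := exists_initialDatum_le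
  refine ⟨C * (A * Real.exp (M * t)), fun j x => ?_⟩
  have ht' : t ∈ Ico 0 T := ⟨ht.1, ht.2.trans_lt hb⟩
  by_cases hx : initialDatum x = 0
  · rw [h.eq_zero ht' hx, mul_zero, norm_zero]
    exact indicator_nonneg (fun _ _ => by positivity) x
  have hx0 := ne_zero_of_initialDatum_ne_zero hx
  have hxs : x ∈ tsupport initialDatum := subset_tsupport _ hx
  have hn : 0 < ‖x‖ := norm_pos_iff.2 hx0
  rw [indicator_of_mem hxs, norm_mul, Real.norm_of_nonneg (h.nonneg ht' x)]
  have h1 : ‖bumpPotential j x - bumpDensity j x‖ ≤ C / ‖x‖ ^ 2 := by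
    refine le_trans ?_ (hC' j x hx0)
    refine (abs_sub _ _).trans_eq ?_
    rw [abs_of_nonneg (bumpDensity_nonneg j x)]
  have h2 : w t x ≤ A * ‖x‖ ^ 2 * Real.exp (M * t) := by
    rw [h.eq_mul_exp isTest_initialDatum ht']
    gcongr
    · exact hA' x
    · exact (le_abs_self _).trans (abs_integral_rieszSq_le hM ht hxs)
  calc ‖bumpPotential j x - bumpDensity j x‖ * w t x
      ≤ C / ‖x‖ ^ 2 * (A * ‖x‖ ^ 2 * Real.exp (M * t)) := by
        gcongr
        exact h.nonneg ht' x
    _ = C * (A * Real.exp (M * t)) := by field_simp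

lemma integrable_kernel_mul (h : IsSmoothSolution T initialDatum w) (ht : t ∈ Ico 0 T)
    {K : Plane → ℝ} (hK : Continuous K) : Integrable fun x => K x * w t x :=
  (hK.mul (h.isTest isTest_initialDatum ht).continuous).integrable_of_hasCompactSupport
    (h.isTest isTest_initialDatum ht).compact.mul_left

/-- By duality the right side is the sum of the integrals of `bumpPotential j` against `w`. Summing
under the integral leaves the pointwise domination `hdom` times `w ≥ 0`, and off the support of the
datum `w` vanishes. -/
lemma tsum_integral_density_le (h : IsSmoothSolution T initialDatum w) (hb : b < T)
    (hM : BoundedBy w b M) (hq : q ∈ Ioo (0 : ℝ) 1)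
    (hdom : ∀ x, initialDatum x ≠ 0 →
      ∑' j, q ^ j * bumpDensity j x ≤ ∑' j, q ^ j * bumpPotential j x) (ht : t ∈ Icc 0 b) :
    ∑' j, q ^ j * ∫ x, bumpDensity j x * w t x ≤
      ∑' j, q ^ j * ∫ x, bumpDensity j x * rieszSq (w t) x := by
  have ht' : t ∈ Ico 0 T := ⟨ht.1, ht.2.trans_lt hb⟩
  obtain ⟨D, hD⟩ := h.exists_kernel_mul_le hb hM ht
  have hq0 := hq.1
  have e : ∀ j, ∫ x, bumpDensity j x * rieszSq (w t) x = ∫ x, bumpPotential j x * w t x :=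
    fun j => integral_density_mul_rieszSq (bumpRadius_pos j) _ (h.isTest isTest_initialDatum ht')
  have s1 : Summable fun j => q ^ j * ∫ x, bumpDensity j x * rieszSq (w t) x :=
    summable_geometric_mul_of_abs_le hq (abs_integral_bumpDensity_mul_rieszSq_le hM ht)
  have s2 : Summable fun j => q ^ j * ∫ x, bumpDensity j x * w t x :=
    summable_geometric_mul_of_abs_le hq fun j => abs_integral_bumpDensity_mul_le fun x hx =>
      (hM t ht x (mem_tsupport_of_bumpDensity_ne_zero hx)).1
  have hIntegrable : ∀ j,
      Integrable fun x => q ^ j * ((bumpPotential j x - bumpDensity j x) * w t x) :=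
    fun j => (h.integrable_kernel_mul ht'
      ((continuous_bumpPotential j).sub (continuous_bumpDensity j))).const_mul _
  have hind : Integrable ((tsupport initialDatum).indicator fun _ => D) :=
    (integrable_indicator_iff (isClosed_tsupport _).measurableSet).2
      (integrableOn_const isTest_initialDatum.compact.measure_lt_top.ne)
  have hsum := hasSum_integral_of_summable_integral_norm hIntegrable <| by
    refine Summable.of_nonneg_of_le (fun j => integral_nonneg fun x => norm_nonneg _) (fun j => ?_)
      ((summable_geometric_of_lt_one hq.1.le hq.2).mul_right
        (∫ x, (tsupport initialDatum).indicator (fun _ => D) x))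
    rw [← integral_const_mul]
    refine integral_mono (hIntegrable j).norm (hind.const_mul _) fun x => ?_
    simp only
    rw [norm_mul, norm_pow, Real.norm_of_nonneg hq0.le]
    exact mul_le_mul_of_nonneg_left (hD j x) (pow_nonneg hq0.le j)
  have e2 : ∀ j, ∫ x, q ^ j * ((bumpPotential j x - bumpDensity j x) * w t x) =
      q ^ j * (∫ x, bumpDensity j x * rieszSq (w t) x) - q ^ j * ∫ x, bumpDensity j x * w t x :=
    fun j => by
      rw [integral_const_mul, e, ← mul_sub, ← integral_sub
        (h.integrable_kernel_mul ht' (continuous_bumpPotential j))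
        (h.integrable_kernel_mul ht' (continuous_bumpDensity j))]
      simp_rw [sub_mul]
  simp_rw [e2] at hsum
  rw [← sub_nonneg, ← s1.tsum_sub s2, hsum.tsum_eq]
  refine integral_nonneg fun x => ?_
  by_cases hx : initialDatum x = 0
  · simp [h.eq_zero ht' hx]
  obtain ⟨p1, p2⟩ := summable_bumpKernel hq (ne_zero_of_initialDatum_ne_zero hx)
  have e3 : ∑' j, q ^ j * ((bumpPotential j x - bumpDensity j x) * w t x) =
      (∑' j, q ^ j * bumpPotential j x - ∑' j, q ^ j * bumpDensity j x) * w t x := by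
    rw [← p1.tsum_sub p2, ← tsum_mul_right]
    exact tsum_congr fun j => by ring
  simp only [Pi.zero_apply]
  rw [e3]
  exact mul_nonneg (sub_nonneg.2 (hdom x hx)) (h.nonneg ht' x)

/-- Jensen's inequality for the exponential. -/
lemma mul_exp_logEnergy_le (h : IsSmoothSolution T initialDatum w) (hb : b < T) (hM0 : 0 ≤ M)
    (hM : BoundedBy w b M) (hq : q ∈ Ioo (0 : ℝ) 1) (ht : t ∈ Icc 0 b) :
    densityMass * (1 - q)⁻¹ * Real.exp (logEnergy q (w t) / (densityMass * (1 - q)⁻¹)) ≤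
      ∑' j, q ^ j * ∫ x, bumpDensity j x * w t x := by
  have ht' : t ∈ Ico 0 T := ⟨ht.1, ht.2.trans_lt hb⟩
  have hm : 0 < densityMass * (1 - q)⁻¹ :=
    mul_pos densityMass_pos (inv_pos.2 (sub_pos.2 hq.2))
  set a := logEnergy q (w t) / (densityMass * (1 - q)⁻¹) with ha
  have hF : logEnergy q (w t) = a * (densityMass * (1 - q)⁻¹) := by
    rw [ha, div_mul_cancel₀ _ hm.ne']
  have hg := summable_geometric_of_lt_one hq.1.le hq.2
  have hl := h.summable_logMean hb hM0 hM hq ht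
  have s2 : Summable fun j => q ^ j * ∫ x, bumpDensity j x * w t x :=
    summable_geometric_mul_of_abs_le hq fun j => abs_integral_bumpDensity_mul_le fun x hx =>
      (hM t ht x (mem_tsupport_of_bumpDensity_ne_zero hx)).1
  have s1 : Summable fun j => Real.exp a * (q ^ j * logMean j (w t)) +
      q ^ j * (Real.exp a * (1 - a) * densityMass) := (hl.mul_left _).add (hg.mul_right _)
  -- With mass `m` and `a = F / m` the tangent bounds sum to `exp a * (F + (1 - a) * m) = m * exp
  -- a`.
  have e : densityMass * (1 - q)⁻¹ * Real.exp a = ∑' j, (Real.exp a * (q ^ j * logMean j (w t)) +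
      q ^ j * (Real.exp a * (1 - a) * densityMass)) := by
    rw [(hl.mul_left _).tsum_add (hg.mul_right _), tsum_mul_left, tsum_mul_right,
      tsum_geometric_of_lt_one hq.1.le hq.2, show ∑' j, q ^ j * logMean j (w t) =
        logEnergy q (w t) from rfl, hF]
    ring
  rw [e]
  refine s1.tsum_le_tsum (fun j => ?_) s2
  have h1 : Real.exp a * logMean j (w t) + Real.exp a * (1 - a) * densityMass ≤
      ∫ x, bumpDensity j x * w t x := by
    have i1 := (h.integrable_bumpDensity_mul_log hb hM0 hM ht j).const_mul (Real.exp a)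
    have i2 := (integrable_bumpDensity j).const_mul (Real.exp a * (1 - a))
    rw [logMean, ← integral_bumpDensity j, ← integral_const_mul, ← integral_const_mul,
      ← integral_add i1 i2]
    refine integral_mono (i1.add i2) (h.integrable_kernel_mul ht' (continuous_bumpDensity j))
      fun x => ?_
    by_cases hx : bumpDensity j x = 0
    · simp [hx]
    · have := mul_le_mul_of_nonneg_left
        (one_add_sub_mul_exp_le (a := a) (h.pos_of_bumpDensity_ne_zero ht' hx))
        (bumpDensity_nonneg j x)
      refine le_trans (le_of_eq ?_) this
      simp only
      ring
  calc Real.exp a * (q ^ j * logMean j (w t)) + q ^ j * (Real.exp a * (1 - a) * densityMass)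
      = q ^ j * (Real.exp a * logMean j (w t) + Real.exp a * (1 - a) * densityMass) := by ring
    _ ≤ _ := mul_le_mul_of_nonneg_left h1 (pow_nonneg hq.1.le j)

/-- The differential inequality is available only at positive times; this bound lets the starting
time tend to zero. -/
lemma le_logEnergy (h : IsSmoothSolution T initialDatum w) (hb : b < T) (hM0 : 0 ≤ M)
    (hM : BoundedBy w b M) (hq : q ∈ Ioo (0 : ℝ) 1) (ht : t ∈ Icc 0 b) :
    logEnergy q initialDatum - densityMass * (1 - q)⁻¹ * (M * t) ≤ logEnergy q (w t) := by
  have h0 : (0 : ℝ) ∈ Icc 0 b := ⟨le_rfl, ht.1.trans ht.2⟩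
  have hl0 := h.summable_logMean hb hM0 hM hq h0
  rw [h.initial] at hl0
  have hg := (summable_geometric_of_lt_one hq.1.le hq.2).mul_right (densityMass * (M * t))
  have e : logEnergy q initialDatum - densityMass * (1 - q)⁻¹ * (M * t) =
      ∑' j, (q ^ j * logMean j initialDatum - q ^ j * (densityMass * (M * t))) := by
    rw [hl0.tsum_sub hg, tsum_mul_right, tsum_geometric_of_lt_one hq.1.le hq.2, logEnergy]
    ring
  rw [e]
  refine (hl0.sub hg).tsum_le_tsum (fun j => ?_) (h.summable_logMean hb hM0 hM hq ht)
  rw [← mul_sub]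
  refine mul_le_mul_of_nonneg_left ?_ (pow_nonneg hq.1.le j)
  have i0 := h.integrable_bumpDensity_mul_log hb hM0 hM h0 j
  rw [h.initial] at i0
  have i1 := h.integrable_bumpDensity_mul_log hb hM0 hM ht j
  have i2 := (integrable_bumpDensity j).mul_const (M * t)
  rw [logMean, logMean, ← integral_bumpDensity j, ← integral_mul_const, ← integral_sub i0 i2]
  refine integral_mono (i0.sub i2) i1 fun x => ?_
  simp only
  rw [← mul_sub]
  by_cases hx : bumpDensity j x = 0
  · simp [hx]
  · refine mul_le_mul_of_nonneg_left ?_ (bumpDensity_nonneg j x)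
    rw [initialDatum_of_bumpDensity_ne_zero hx]
    linarith [neg_le_of_abs_le (h.abs_log_sub_le hb hM ht hx)]

end IsSmoothSolution

open IsSmoothSolution in
-- The logarithmic energy satisfies `F' ≥ m exp (F / m)`, whose solutions blow up by the time `exp
-- (-F(0) / m)`.
theorem exists_lifespan_bound :
    ∃ B, ∀ T w, IsSmoothSolution T initialDatum w → T ≤ B := by
  obtain ⟨q, hq, hdom⟩ := exists_tsum_density_le_tsum_potential
  set m := densityMass * (1 - q)⁻¹ with hm'
  have hm : 0 < m := mul_pos densityMass_pos (inv_pos.2 (sub_pos.2 hq.2))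
  have hB := Real.exp_pos (-(logEnergy q initialDatum / m))
  refine ⟨Real.exp (-(logEnergy q initialDatum / m)), fun T w h => ?_⟩
  refine le_of_forall_lt fun t htT => ?_
  rcases le_or_gt t 0 with ht0 | ht0
  · exact ht0.trans_lt hB
  -- The bounds on `w` and `R₁² w` hold only up to some `b < T`; the extra room between `t` and `t'`
  -- gives the strict inequality after the limit `s → 0`.
  obtain ⟨t', htt', ht'T⟩ := exists_between htT
  obtain ⟨b, htb, hb⟩ := exists_between ht'T
  obtain ⟨M, hM0, hM⟩ := h.exists_bound isTest_initialDatum hb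
  refine htt'.trans_le ?_
  have key : ∀ᶠ s in nhdsWithin (0 : ℝ) (Ioi 0),
      t' ≤ Real.exp (-(logEnergy q initialDatum / m) + M * s) + s := by
    filter_upwards [Ioo_mem_nhdsGT (ht0.trans htt')] with s hs
    have hsb : s ∈ Icc 0 b := ⟨hs.1.le, (hs.2.trans htb).le⟩
    have h1 := sub_le_exp_of_deriv_ge hm
      (fun r hr => h.hasDerivAt_logEnergy hb hM0 hM hq hr)
      (fun r hr => (h.mul_exp_logEnergy_le hb hM0 hM hq (Ioo_subset_Icc_self hr)).trans
        (h.tsum_integral_density_le hb hM hq hdom (Ioo_subset_Icc_self hr))) hs.1 hs.2.le htb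
    have h2 := h.le_logEnergy hb hM0 hM hq hsb
    have h3 : -(logEnergy q (w s) / m) ≤ -(logEnergy q initialDatum / m) + M * s := by
      have : (logEnergy q initialDatum - m * (M * s)) / m ≤ logEnergy q (w s) / m := by gcongr
      rw [sub_div, mul_div_cancel_left₀ _ hm.ne'] at this
      linarith
    linarith [Real.exp_le_exp.2 h3]
  have hlim : Filter.Tendsto (fun s => Real.exp (-(logEnergy q initialDatum / m) + M * s) + s)
      (nhdsWithin 0 (Ioi 0)) (nhds (Real.exp (-(logEnergy q initialDatum / m)))) := by
    have hc : Continuous fun s => Real.exp (-(logEnergy q initialDatum / m) + M * s) + s := by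
      fun_prop
    have := hc.tendsto 0
    simp only [mul_zero, add_zero] at this
    exact this.mono_left nhdsWithin_le_nhds
  exact ge_of_tendsto hlim key

end

theorem theorem3p1 :
    ∃ w₀ : Plane → ℝ, (∀ x, 0 ≤ w₀ x) ∧ ContDiff ℝ ∞ w₀ ∧ HasCompactSupport w₀ ∧
      ∃ (T : ℝ) (w : ℝ → Plane → ℝ), 0 < T ∧ IsSmoothSolution T w₀ w ∧
        (∀ (T' : ℝ) (v : ℝ → Plane → ℝ), IsSmoothSolution T' w₀ v →
          T' ≤ T ∧ ∀ t ∈ Ico 0 T', v t = w t) ∧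
        ¬ ∃ W : ℝ × Plane → ℝ, ContDiffOn ℝ ∞ W (Icc 0 T ×ˢ univ) ∧
          ∀ t ∈ Ico 0 T, ∀ x, W (t, x) = w t x := by
  obtain ⟨B, hB⟩ := exists_lifespan_bound
  exact ⟨initialDatum, initialDatum_nonneg, isTest_initialDatum.smooth,
    isTest_initialDatum.compact, exists_maximal_solution isTest_initialDatum hB⟩
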